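/- Let $m,p,n$ be non-negative integers with $n>p$, let $\Xi\in\mathbb{C}^{m\times p}$, and let $\Sigma$ be a positive definite Hermitian $p\times p$ matrix. Let $Z$ (an $m\times p$ complex random matrix) and $S$ (a $p\times p$ positive definite Hermitian random matrix) be independent, where $Z\sim\mathbb{C}N_{m\times p}(\Xi, I_m\otimes\Sigma)$ has the density $$\pi^{-mp}\det(\Sigma)^{-m}\exp\{-\operatorname{Tr}((z-\Xi)\Sigma^{-1}(z-\Xi)^*)\}$$ with respect to Lebesgue measure on $\mathbb{C}^{m\times p}$, and $S\sim\mathbb{C}W_p(\Sigma,n)$ has the density $$\frac{\det(s)^{n-p}\exp\{-\operatorname{Tr}(s\Sigma^{-1})\}}{\det(\Sigma)^n\,\pi^{p(p-1)/2}\prod_{k=1}^p\Gamma(n+1-k)}$$ on the set $\mathbb{C}^{p\times p}_+$ of positive definite Hermitian matrices, with respect to Lebesgue measure in the coordinates $s_{jj}$, $\operatorname{Re}s_{jk}$, $\operatorname{Im}s_{jk}$ ($j<k$). The loss of an estimate $\widehat\Xi$ of $\Xi$ is $\operatorname{Tr}\{\Sigma^{-1}(\widehat\Xi-\Xi)^*(\widehat\Xi-\Xi)\}$,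 and the risk $\mathcal{R}(\widehat\Xi,(\Xi,\Sigma))$ of an estimator is its expected loss. Put $\frac{\partial}{\partial z_{ij}}=\frac12\left(\frac{\partial}{\partial\operatorname{Re}z_{ij}}-\sqrt{-1}\,\frac{\partial}{\partial\operatorname{Im}z_{ij}}\right)$ and $\frac{\partial}{\partial s_{jk}}=\frac12(1+\delta_{jk})\left\{\frac{\partial}{\partial\operatorname{Re}s_{jk}}+(1-\delta_{jk})\sqrt{-1}\,\frac{\partial}{\partial\operatorname{Im}s_{jk}}\right\}$, the derivatives in $s$ being taken within the Hermitian matrices. For matrix functions $G$ ($m\times p$) and $H$ ($p\times p$) let $\nabla_Z'G$ be the $p\times p$ matrix with $(j,k)$ entry $\sum_i\partial g_{ik}/\partial z_{ij}$, and let $D_SH$ be the $p\times p$ matrix with $(j,k)$ entry $\sum_l\partial h_{lk}/\partial s_{jl}$. Let $G=(g_{ij})$ be a measurable function of $(Z,S)\in\mathbb{C}^{m\times p}\times\mathbb{C}^{p\times p}_+$ with values in $\mathbb{C}^{m\times p}$, all of whose entries are absolutely continuous functions of $Z$ and $S$, in the sense that along each of the real coordinates of $Z$ and $S$ they are absolutely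 continuous on every compact interval, inside the domain, of almost every coordinate line. Assume that the terms below have finite expectations: for all $i,j,l$, $$\mathbb{E}\left|\frac{\partial\operatorname{Re}g_{ij}}{\partial\operatorname{Re}z_{ij}}\right|,\quad \mathbb{E}\left|\frac{\partial\operatorname{Im}g_{ij}}{\partial\operatorname{Im}z_{ij}}\right|,\quad \mathbb{E}\left|\frac{\partial(G^*G)_{lj}}{\partial\operatorname{Re}s_{jl}}\right|,\quad \mathbb{E}\left|\frac{\partial(G^*G)_{lj}}{\partial\operatorname{Im}s_{jl}}\right|\ (j\ne l),\quad \mathbb{E}\left|\operatorname{Tr}(G^*GS^{-1})\right|$$ are finite, all functions being evaluated at $(Z,S)$. Then $Z+G(Z,S)$ has finite risk, and $$\mathcal{R}(Z+G(Z,S),(\Xi,\Sigma))=mp+\mathbb{E}\left[2\operatorname{Tr}\{\operatorname{Re}(\nabla_Z'G)\}+\operatorname{Tr}\{D_S(G^*G)\}+(n-p)\operatorname{Tr}(G^*GS^{-1})\right].$$ -/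

import Mathlib

open MeasureTheory ProbabilityTheory Matrix Complex
open scoped ComplexOrder

noncomputable section

namespace ComplexNormalMean

/-- Complex `m × p` matrices carry the product Borel σ-algebra. -/
instance instMeasurableSpaceMatrix (m p : ℕ) :
    MeasurableSpace (Matrix (Fin m) (Fin p) ℂ) :=
  inferInstanceAs (MeasurableSpace (Fin m → Fin p → ℂ))

/-- Lebesgue measure on the space of complex `m × p` matrices. -/
def lebMat (m p : ℕ) : Measure (Matrix (Fin m) (Fin p) ℂ) :=
  Measure.map (fun x : Fin m → Fin p → ℂ => Matrix.of x) volume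

/-- The Hermitian matrix with real coordinates `x`: the diagonal entries are `x j j`, and for
`j < k` the real part of the `(j, k)` entry is `x j k` while its imaginary part is `x k j`. -/
def hermOf (p : ℕ) (x : Fin p → Fin p → ℝ) : Matrix (Fin p) (Fin p) ℂ :=
  Matrix.of fun j k =>
    if j = k then (x j j : ℂ)
    else if j < k then (x j k : ℂ) + (x k j : ℂ) * I
    else (x k j : ℂ) - (x j k : ℂ) * I

/-- Lebesgue measure on the Hermitian `p × p` matrices in the coordinates `s_jj` and
`Re s_jk`, `Im s_jk` for `j < k`, as a measure on all complex `p × p` matrices. -/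
def lebHerm (p : ℕ) : Measure (Matrix (Fin p) (Fin p) ℂ) :=
  Measure.map (hermOf p) volume

/-- Density of the complex matrix normal law with mean `Ξ` and covariance `I_m ⊗ Σ`. -/
def normalDensity {m p : ℕ} (Ξ : Matrix (Fin m) (Fin p) ℂ) (Sig : Matrix (Fin p) (Fin p) ℂ)
    (z : Matrix (Fin m) (Fin p) ℂ) : ℝ :=
  (Real.pi ^ (m * p))⁻¹ * (Sig.det.re ^ m)⁻¹
    * Real.exp (-((z - Ξ) * Sig⁻¹ * (z - Ξ)ᴴ).trace.re)

/-- The complex matrix normal law with mean `Ξ` and covariance `I_m ⊗ Σ`. -/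
def complexNormal {m p : ℕ} (Ξ : Matrix (Fin m) (Fin p) ℂ) (Sig : Matrix (Fin p) (Fin p) ℂ) :
    Measure (Matrix (Fin m) (Fin p) ℂ) :=
  (lebMat m p).withDensity fun z => ENNReal.ofReal (normalDensity Ξ Sig z)

/-- Density, on positive definite Hermitian matrices, of the complex Wishart law with parameter
`Σ` and `n` degrees of freedom (used for `n > p`). -/
def wishartDensity {p : ℕ} (Sig : Matrix (Fin p) (Fin p) ℂ) (n : ℕ)
    (s : Matrix (Fin p) (Fin p) ℂ) : ℝ :=
  s.det.re ^ (n - p) * Real.exp (-(s * Sig⁻¹).trace.re)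
    / (Sig.det.re ^ n * Real.pi ^ (p * (p - 1) / 2)
        * ∏ k ∈ Finset.Icc 1 p, Real.Gamma ((n : ℝ) + 1 - (k : ℝ)))

/-- The complex Wishart law with parameter `Σ` and `n` degrees of freedom (used for `n > p`). -/
def complexWishart {p : ℕ} (Sig : Matrix (Fin p) (Fin p) ℂ) (n : ℕ) :
    Measure (Matrix (Fin p) (Fin p) ℂ) :=
  (lebHerm p).withDensity
    ({s | s.PosDef}.indicator fun s => ENNReal.ofReal (wishartDensity Sig n s))

/-- The invariant loss `Tr {Σ⁻¹ (Ξ̂ - Ξ)^* (Ξ̂ - Ξ)}` of the estimate `Ξ̂ = X` (a nonnegative real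
number when `Σ` is positive definite). -/
def loss {m p : ℕ} (Ξ : Matrix (Fin m) (Fin p) ℂ) (Sig : Matrix (Fin p) (Fin p) ℂ)
    (X : Matrix (Fin m) (Fin p) ℂ) : ℝ :=
  (Sig⁻¹ * (X - Ξ)ᴴ * (X - Ξ)).trace.re

/-! ### Directions of the real coordinates and the differential operators -/

/-- Direction of the coordinate `Re z_ij`. -/
def reDir {m p : ℕ} (i : Fin m) (j : Fin p) : Matrix (Fin m) (Fin p) ℂ :=
  Matrix.single i j 1

/-- Direction of the coordinate `Im z_ij`. -/
def imDir {m p : ℕ} (i : Fin m) (j : Fin p) : Matrix (Fin m) (Fin p) ℂ :=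
  Matrix.single i j I

/-- Direction of the coordinate `Re s_jk` in the space of Hermitian matrices. -/
def hermReDir {p : ℕ} (j k : Fin p) : Matrix (Fin p) (Fin p) ℂ :=
  if j = k then Matrix.single j j 1 else Matrix.single j k 1 + Matrix.single k j 1

/-- Direction of the coordinate `Im s_jk`, `j ≠ k`, in the space of Hermitian matrices
(zero for `j = k`, where there is no such coordinate). -/
def hermImDir {p : ℕ} (j k : Fin p) : Matrix (Fin p) (Fin p) ℂ :=
  if j = k then 0 else Matrix.single j k I - Matrix.single k j I

/-- The operator `∂/∂z_ij = (1/2) (∂/∂(Re z_ij) - √-1 ∂/∂(Im z_ij))`. -/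
def dZ {m p : ℕ} (i : Fin m) (j : Fin p) (f : Matrix (Fin m) (Fin p) ℂ → ℂ)
    (z : Matrix (Fin m) (Fin p) ℂ) : ℂ :=
  (1 / 2) * (lineDeriv ℝ f z (reDir i j) - I * lineDeriv ℝ f z (imDir i j))

/-- The matrix `∇_z' G`, with `(j, k)` entry `∑ i, ∂ g_ik / ∂ z_ij`. -/
def nablaT {m p : ℕ} (F : Matrix (Fin m) (Fin p) ℂ → Matrix (Fin m) (Fin p) ℂ)
    (z : Matrix (Fin m) (Fin p) ℂ) : Matrix (Fin p) (Fin p) ℂ :=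
  Matrix.of fun j k => ∑ i, dZ i j (fun w => F w i k) z

/-- The operator `∂/∂s_jk = (1/2) (1 + δ_jk) {∂/∂(Re s_jk) + (1 - δ_jk) √-1 ∂/∂(Im s_jk)}`. -/
def dS {p : ℕ} (j k : Fin p) (f : Matrix (Fin p) (Fin p) ℂ → ℂ)
    (s : Matrix (Fin p) (Fin p) ℂ) : ℂ :=
  (1 / 2) * (1 + if j = k then 1 else 0)
    * (lineDeriv ℝ f s (hermReDir j k)
        + (1 - if j = k then 1 else 0) * I * lineDeriv ℝ f s (hermImDir j k))

/-- The matrix `D_S H`, with `(j, k)` entry `∑ l, ∂ h_lk / ∂ s_jl`. -/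
def matD {p : ℕ} (H : Matrix (Fin p) (Fin p) ℂ → Matrix (Fin p) (Fin p) ℂ)
    (s : Matrix (Fin p) (Fin p) ℂ) : Matrix (Fin p) (Fin p) ℂ :=
  Matrix.of fun j k => ∑ l, dS j l (fun t => H t l k) s

/-! ### Absolute continuity -/

/-- Lebesgue measure on pairs `(z, s)`, `z` a complex `m × p` matrix and `s` a positive definite
Hermitian `p × p` matrix. -/
def lebDom (m p : ℕ) : Measure (Matrix (Fin m) (Fin p) ℂ × Matrix (Fin p) (Fin p) ℂ) :=
  (lebMat m p).prod ((lebHerm p).restrict {s | s.PosDef})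

/-- `g` is absolutely continuous along almost every line with direction `v` (an increment of
`(z, s)`): for almost every base point, the restriction of `g` to the line is absolutely continuous
on each compact interval on which the line stays in the set of all `(z, s)` with `s` positive
definite. -/
def AbsContAlong {m p : ℕ} (g : Matrix (Fin m) (Fin p) ℂ → Matrix (Fin p) (Fin p) ℂ → ℂ)
    (v : Matrix (Fin m) (Fin p) ℂ × Matrix (Fin p) (Fin p) ℂ) : Prop :=
  ∀ᵐ x ∂(lebDom m p), ∀ a b : ℝ,
    (∀ t ∈ Set.uIcc a b, (x.2 + t • v.2).PosDef) →
      AbsolutelyContinuousOnInterval (fun t : ℝ => g (x.1 + t • v.1) (x.2 + t • v.2)) a b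

/-- `g` is a measurable function of `(z, s)`, `s` positive definite, which is absolutely continuous
in each of the real coordinates of `z` and of `s` on almost every coordinate line. -/
structure IsAbsCont {m p : ℕ}
    (g : Matrix (Fin m) (Fin p) ℂ → Matrix (Fin p) (Fin p) ℂ → ℂ) : Prop where
  aemeasurable : AEMeasurable (fun x : Matrix (Fin m) (Fin p) ℂ × Matrix (Fin p) (Fin p) ℂ =>
    g x.1 x.2) (lebDom m p)
  along_re_z : ∀ i j, AbsContAlong g (reDir i j, 0)
  along_im_z : ∀ i j, AbsContAlong g (imDir i j, 0)
  along_re_s : ∀ j k, AbsContAlong g (0, hermReDir j k)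
  along_im_s : ∀ j k, AbsContAlong g (0, hermImDir j k)

end ComplexNormalMean

end

/-! Write H = G^*G. Expanding the loss of Z + G (`loss_add`) gives the loss of Z, twice Re Tr(Σ⁻¹(Z
- Ξ)^*G), and Tr(HΣ⁻¹). Each expectation comes from integration by parts against the joint density.
The normal factor has logarithmic derivative -2 Re Tr(wΣ⁻¹(z - Ξ)^*) in a direction w, so Stein's
identity (`JointLaw.integral_trace_normal`) turns the cross term into E Tr Re(∇_Z'G). Applied to G =
Z - Ξ it gives mp for the loss of Z. The Wishart factor has logarithmic derivative (n - p) Re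
Tr(s⁻¹v) - Re Tr(Σ⁻¹v) in a Hermitian direction v. Combining the coordinate directions with the
weights of D_S yields E Tr(HΣ⁻¹) = E[Tr D_S H + (n - p) Tr(HS⁻¹)]
(`JointLaw.integral_trace_wishart`).

The difficulty is integrability: neither G nor Tr(HΣ⁻¹) is assumed integrable. The Wishart identity
is therefore proved first, with a cutoff vanishing near singular matrices and for large Tr(sΣ⁻¹).
Since ‖G‖² ≤ Tr(S) Tr(HS⁻¹) (`frobSq_le_trace_mul`), every truncated term is integrable. The
cutoff's own logarithmic derivatives add terms with uniformly bounded coefficients that tend to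
zero, so dominated convergence handles the side with D_S H and HS⁻¹. Fatou's lemma then makes the
nonnegative Tr(HΣ⁻¹) integrable (`integrable_and_integral_eq_of_tendsto`). Consequently G is square
integrable, the cross term is integrable by Cauchy-Schwarz, and Stein's identity needs no cutoff.

Integration by parts is done without coordinates. If W is the derivative of Φ along v, then ∫₀¹ W(x
+ tv) dt = Φ(x + v) - Φ(x) on almost every line. Integrating over x against a measure invariant
under translation by v gives ∫ W = 0 as soon as W and Φ are integrable
(`integral_lineDeriv_mul_add_eq_zero`). -/

open Filter Topology Set in
/-- A function continuous near `0` whose difference quotients along the rationals converge is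
differentiable at `0`. -/
theorem hasDerivAt_zero_of_tendsto_rat {f : ℝ → ℝ} {c : ℝ}
    (hf : ∀ᶠ t in 𝓝 (0 : ℝ), ContinuousAt f t)
    (h : Tendsto (fun q : ℚ => (q : ℝ)⁻¹ * (f q - f 0)) (comap ((↑) : ℚ → ℝ) (𝓝[≠] 0)) (𝓝 c)) :
    HasDerivAt f c 0 := by
  rw [hasDerivAt_iff_tendsto_slope_zero, Metric.tendsto_nhds]
  intro ε hε
  have h1 := (Metric.tendsto_nhds.1 h) (ε / 2) (half_pos hε)
  rw [eventually_comap, eventually_nhdsWithin_iff] at h1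
  rw [eventually_nhdsWithin_iff]
  filter_upwards [h1.eventually_nhds, hf] with t ht hct ht0
  have hct' : ContinuousAt (fun s => dist (s⁻¹ • (f (0 + s) - f 0)) c) t := by
    have : ContinuousAt (fun s => f (0 + s)) t := by simpa using hct
    exact Filter.Tendsto.dist ((continuousAt_inv₀ ht0).smul (this.sub continuousAt_const))
      tendsto_const_nhds
  have hfreq : ∃ᶠ s in 𝓝 t, s ∈ range ((↑) : ℚ → ℝ) :=
    mem_closure_iff_frequently.1 (Rat.denseRange_cast t)
  -- The bound holds at the rational points near t and passes to t because the difference quotient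
  -- is continuous at t ≠ 0.
  have : dist (t⁻¹ • (f (0 + t) - f 0)) c ≤ ε / 2 := by
    refine le_of_tendsto_of_frequently hct' ?_
    refine (hfreq.and_eventually (ht.and (eventually_ne_nhds ht0))).mono ?_
    rintro s ⟨⟨q, rfl⟩, hs, hs0⟩
    simpa using (hs hs0 q rfl).le
  linarith

/-! ### Differentiability along almost every line -/

namespace DirectionalCalculus

open Filter Topology Set

variable {E : Type*} [AddCommGroup E] [Module ℝ E]

/-- The restriction of `g` to the line through `x` with direction `v` is absolutely continuous on
the compact intervals on which the line stays in `U`. -/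
def AbsContLine {F : Type*} [PseudoMetricSpace F] (g : E → F) (U : Set E) (v x : E) : Prop :=
  ∀ a b : ℝ, (∀ t ∈ uIcc a b, x + t • v ∈ U) →
    AbsolutelyContinuousOnInterval (fun t : ℝ => g (x + t • v)) a b

variable [MeasurableSpace E]

/-- The measure `μ` is invariant under all translations along `v`. -/
structure LineInvariant (μ : Measure E) (v : E) : Prop where
  measurable_shift : Measurable fun y : E × ℝ => y.1 + y.2 • v
  map_shift : ∀ t : ℝ, Measure.map (fun x => x + t • v) μ = μ

/-- `U` is measurable and meets the lines with direction `v` in open intervals. -/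
structure LineDomain (U : Set E) (v : E) : Prop where
  measurableSet : MeasurableSet U
  isOpen : ∀ x, IsOpen {t : ℝ | x + t • v ∈ U}
  ordConnected : ∀ x, OrdConnected {t : ℝ | x + t • v ∈ U}

variable {μ : Measure E} {v : E} {U : Set E}

theorem LineInvariant.measurable_add (h : LineInvariant μ v) (t : ℝ) :
    Measurable fun x : E => x + t • v :=
  h.measurable_shift.comp (measurable_id.prodMk measurable_const)

theorem LineInvariant.measurePreserving (h : LineInvariant μ v) (t : ℝ) :
    MeasurePreserving (fun x : E => x + t • v) μ μ :=
  ⟨h.measurable_add t, h.map_shift t⟩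

/-- Each translate of μ is μ, and so is their average over a parameter interval of length one. This
replaces Fubini in coordinates: it transfers null sets and integrals between μ and the lines with
direction v. -/
theorem LineInvariant.measurePreserving_prod [SFinite μ] (h : LineInvariant μ v) :
    MeasurePreserving (fun y : E × ℝ => y.1 + y.2 • v)
      (μ.prod (volume.restrict (Ioc (0 : ℝ) 1))) μ := by
  refine ⟨h.measurable_shift, ?_⟩
  ext s hs
  rw [Measure.map_apply h.measurable_shift hs,
    Measure.prod_apply_symm (h.measurable_shift hs)]
  have : ∀ t : ℝ, μ ((fun x : E => (x, t)) ⁻¹' ((fun y : E × ℝ => y.1 + y.2 • v) ⁻¹' s)) = μ s :=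
    fun t => (h.measurePreserving t).measure_preimage hs.nullMeasurableSet
  simp [this]

/-- A line that meets U does so in an open set of parameters, hence at a rational one. Countably
many shifts thus provide a base point in U for almost every such line, even when x itself lies
outside U. -/
theorem LineInvariant.ae_shift (h : LineInvariant μ v) {Q : E → Prop} (hQ : ∀ᵐ x ∂μ, Q x) :
    ∀ᵐ x ∂μ, ∀ q : ℚ, Q (x + (q : ℝ) • v) :=
  ae_all_iff.2 fun q => (h.measurePreserving q).quasiMeasurePreserving.ae hQ

/-- Absolutely continuous functions are differentiable almost everywhere, and countably many compact
intervals with rational endpoints cover the open parameter set. -/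
theorem AbsContLine.ae_lineDifferentiableAt {g : E → ℝ} (hU : LineDomain U v) {x : E}
    (hg : AbsContLine g U v x) :
    ∀ᵐ t : ℝ, x + t • v ∈ U → LineDifferentiableAt ℝ g (x + t • v) v := by
  have key : ∀ᵐ t : ℝ, ∀ a b : ℚ, (∀ t ∈ uIcc (a : ℝ) b, x + t • v ∈ U) → t ∈ uIcc (a : ℝ) b →
      DifferentiableAt ℝ (fun t : ℝ => g (x + t • v)) t := by
    refine ae_all_iff.2 fun a => ae_all_iff.2 fun b => ?_
    by_cases hab : ∀ t ∈ uIcc (a : ℝ) b, x + t • v ∈ U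
    · filter_upwards [(hg a b hab).ae_differentiableAt] with t ht _ using ht
    · exact Eventually.of_forall fun t h => absurd h hab
  filter_upwards [key] with t ht htU
  obtain ⟨l, u, ⟨hl, hu⟩, hlu⟩ := mem_nhds_iff_exists_Ioo_subset.1 ((hU.isOpen x).mem_nhds htU)
  obtain ⟨a, hla, hat⟩ := exists_rat_btwn hl
  obtain ⟨b, htb, hbu⟩ := exists_rat_btwn hu
  have hd : DifferentiableAt ℝ (fun t : ℝ => g (x + t • v)) t := by
    refine ht a b (fun s hs => hlu ?_) ?_
    · rw [uIcc_of_le (hat.trans htb).le] at hs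
      exact ⟨hla.trans_le hs.1, hs.2.trans_lt hbu⟩
    · rw [uIcc_of_le (hat.trans htb).le]
      exact ⟨hat.le, htb.le⟩
  have h2 : DifferentiableAt ℝ ((fun t : ℝ => g (x + t • v)) ∘ fun s => t + s) 0 :=
    DifferentiableAt.comp 0 (by simpa using hd) (by fun_prop)
  have e : (fun s : ℝ => g (x + t • v + s • v)) =
      (fun t : ℝ => g (x + t • v)) ∘ fun s => t + s := by
    ext s
    simp only [Function.comp_apply, add_smul, add_assoc]
  unfold LineDifferentiableAt
  rw [e]
  exact h2

theorem AbsContLine.eventually_continuousAt {g : E → ℝ} (hU : LineDomain U v) {x : E}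
    (hx : x ∈ U) (hg : AbsContLine g U v x) :
    ∀ᶠ t in 𝓝 (0 : ℝ), ContinuousAt (fun t : ℝ => g (x + t • v)) t := by
  have h0 : (0 : ℝ) ∈ {t : ℝ | x + t • v ∈ U} := by simpa using hx
  obtain ⟨ε, hε, hb⟩ := Metric.isOpen_iff.1 (hU.isOpen x) 0 h0
  have hac := hg (-(ε / 2)) (ε / 2) fun t ht => hb (by
    rw [uIcc_of_le (by linarith)] at ht
    rw [Metric.mem_ball, dist_zero_right, Real.norm_eq_abs, abs_lt]
    constructor <;> linarith [ht.1, ht.2])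
  have hco := hac.continuousOn
  rw [uIcc_of_le (by linarith)] at hco
  filter_upwards [Ioo_mem_nhds (show -(ε / 2) < (0 : ℝ) by linarith) (half_pos hε)] with t ht
  exact hco.continuousAt (Icc_mem_nhds ht.1 ht.2)

/-- A function which is absolutely continuous on almost every line is differentiable in the
direction of the lines almost everywhere. -/
theorem ae_lineDifferentiableAt [SFinite μ] (hμ : LineInvariant μ v) (hU : LineDomain U v)
    {g : E → ℝ} (hm : AEMeasurable g (μ.restrict U))
    (hg : ∀ᵐ x ∂μ.restrict U, AbsContLine g U v x) :
    ∀ᵐ x ∂μ.restrict U, LineDifferentiableAt ℝ g x v := by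
  rw [ae_restrict_iff' hU.measurableSet] at hg ⊢
  have hm' : AEMeasurable (U.indicator g) μ :=
    (aemeasurable_indicator_iff hU.measurableSet).2 hm
  set g' := hm'.mk with hg'
  have hR : ∀ᵐ x ∂μ, ∀ q : ℚ, U.indicator g (x + (q : ℝ) • v) = g' (x + (q : ℝ) • v) :=
    hμ.ae_shift hm'.ae_eq_mk
  have hR0 : ∀ x, (∀ q : ℚ, U.indicator g (x + (q : ℝ) • v) = g' (x + (q : ℝ) • v)) →
      U.indicator g x = g' x := fun x hx => by simpa using hx 0
  -- The set of points of differentiability of `g` is not known to be measurable. Rational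
  -- difference quotients of a measurable representative define a measurable substitute, which
  -- agrees with it on the good lines by `h1` and `h2`.
  set D : Set E := {x | ∃ c, Tendsto (fun q : ℚ => (q : ℝ)⁻¹ * (g' (x + (q : ℝ) • v) - g' x))
    (comap ((↑) : ℚ → ℝ) (𝓝[≠] 0)) (𝓝 c)} with hD
  have hDm : MeasurableSet D := by
    refine measurableSet_exists_tendsto fun q => ?_
    exact measurable_const.mul
      ((hm'.measurable_mk.comp (hμ.measurable_add q)).sub hm'.measurable_mk)
  have hmemU : ∀ x ∈ U, ∀ᶠ t in 𝓝 (0 : ℝ), x + t • v ∈ U := fun x hx =>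
    (hU.isOpen x).mem_nhds (by simpa using hx)
  have hmemU' : ∀ x ∈ U, ∀ᶠ q : ℚ in comap ((↑) : ℚ → ℝ) (𝓝[≠] 0), x + (q : ℝ) • v ∈ U :=
    fun x hx => tendsto_comap.eventually ((hmemU x hx).filter_mono nhdsWithin_le_nhds)
  have h1 : ∀ x ∈ U, (∀ q : ℚ, U.indicator g (x + (q : ℝ) • v) = g' (x + (q : ℝ) • v)) →
      LineDifferentiableAt ℝ g x v → x ∈ D := by
    intro x hx hxR hd
    have := (hasDerivAt_iff_tendsto_slope_zero.1 hd.hasDerivAt).comp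
      (tendsto_comap (f := ((↑) : ℚ → ℝ)) (x := 𝓝[≠] (0 : ℝ)))
    refine ⟨_, this.congr' ?_⟩
    filter_upwards [hmemU' x hx] with q hq
    have e1 := hxR q
    have e2 := hR0 x hxR
    rw [indicator_of_mem hq] at e1
    rw [indicator_of_mem hx] at e2
    simp [e1, e2]
  have h2 : ∀ x ∈ U, (∀ q : ℚ, U.indicator g (x + (q : ℝ) • v) = g' (x + (q : ℝ) • v)) →
      AbsContLine g U v x → x ∈ D → LineDifferentiableAt ℝ g x v := by
    rintro x hx hxR hac ⟨c, hc⟩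
    refine (hasDerivAt_zero_of_tendsto_rat (hac.eventually_continuousAt hU hx)
      (c := c) (hc.congr' ?_)).differentiableAt
    filter_upwards [hmemU' x hx] with q hq
    have e1 := hxR q
    have e2 := hR0 x hxR
    rw [indicator_of_mem hq] at e1
    rw [indicator_of_mem hx] at e2
    simp [e1, e2]
  -- Measurability of D allows the claim to be pulled back to pairs (x, t) and checked for almost
  -- every t on almost every line.
  have hN : ∀ᵐ x ∂μ, x ∈ U → x ∈ D := by
    have hNm : MeasurableSet {x | x ∈ U → x ∈ D} := by
      have : {x | x ∈ U → x ∈ D} = Uᶜ ∪ D := by ext x; simp [imp_iff_not_or]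
      rw [this]
      exact hU.measurableSet.compl.union hDm
    rw [← hμ.measurePreserving_prod.map_eq,
      ae_map_iff hμ.measurable_shift.aemeasurable hNm]
    refine (Measure.ae_prod_iff_ae_ae (hμ.measurable_shift hNm)).2 ?_
    have hRt := Measure.ae_ae_of_ae_prod
      (hμ.measurePreserving_prod.quasiMeasurePreserving.ae hR)
    filter_upwards [hμ.ae_shift hg, hRt] with x hx hxR
    have hd : ∀ᵐ t : ℝ, ∀ r : ℚ, x + (r : ℝ) • v ∈ U → x + t • v ∈ U →
        LineDifferentiableAt ℝ g (x + t • v) v := by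
      refine ae_all_iff.2 fun r => ?_
      by_cases hr : x + (r : ℝ) • v ∈ U
      · have := (quasiMeasurePreserving_add_right volume (-(r : ℝ))).ae
          ((hx r hr).ae_lineDifferentiableAt hU)
        filter_upwards [this] with t ht _
        have e : x + (r : ℝ) • v + (t + -(r : ℝ)) • v = x + t • v := by module
        rwa [e] at ht
      · exact Eventually.of_forall fun t h => absurd h hr
    filter_upwards [hxR, ae_restrict_of_ae hd] with t htR htd htU
    obtain ⟨r, hr⟩ := Rat.denseRange_cast.exists_mem_open (hU.isOpen x) ⟨t, htU⟩
    exact h1 _ htU htR (htd r hr htU)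
  filter_upwards [hg, hR, hN] with x hx hxR hxN hxU
  exact h2 x hxU hxR (hx hxU) (hxN hxU)

/-- The directional derivative of an almost everywhere directionally differentiable function is
measurable. -/
theorem aemeasurable_lineDeriv (hμ : LineInvariant μ v) (hU : LineDomain U v)
    {g : E → ℝ} (hm : AEMeasurable g (μ.restrict U))
    (hd : ∀ᵐ x ∂μ.restrict U, LineDifferentiableAt ℝ g x v) :
    AEMeasurable (fun x => lineDeriv ℝ g x v) (μ.restrict U) := by
  have hm' : AEMeasurable (U.indicator g) μ :=
    (aemeasurable_indicator_iff hU.measurableSet).2 hm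
  have hseq : Tendsto (fun n : ℕ => (1 : ℝ) / (n + 1)) atTop (𝓝[≠] 0) :=
    tendsto_nhdsWithin_iff.2 ⟨tendsto_one_div_add_atTop_nhds_zero_nat,
      Eventually.of_forall fun n => by simp only [mem_compl_iff, mem_singleton_iff]; positivity⟩
  refine aemeasurable_of_tendsto_metrizable_ae atTop
    (f := fun (n : ℕ) x => ((1 : ℝ) / (n + 1))⁻¹ *
      (U.indicator g (x + ((1 : ℝ) / (n + 1)) • v) - U.indicator g x)) (fun n => ?_) ?_
  · refine AEMeasurable.restrict (AEMeasurable.const_mul ?_ _)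
    exact (hm'.comp_quasiMeasurePreserving
      (hμ.measurePreserving _).quasiMeasurePreserving).sub hm'
  · filter_upwards [hd, ae_restrict_mem hU.measurableSet] with x hx hxU
    have h1 := (hasDerivAt_iff_tendsto_slope_zero.1 hx.hasDerivAt).comp hseq
    refine h1.congr' ?_
    have h0 : ∀ᶠ t in 𝓝[≠] (0 : ℝ), x + t • v ∈ U :=
      Eventually.filter_mono nhdsWithin_le_nhds
        ((hU.isOpen x).mem_nhds (show (0 : ℝ) ∈ {t : ℝ | x + t • v ∈ U} by simpa using hxU))
    filter_upwards [hseq.eventually h0] with n hn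
    simp only [Function.comp_apply, zero_add, zero_smul, add_zero, smul_eq_mul]
    rw [indicator_of_mem hn, indicator_of_mem hxU]

end DirectionalCalculus

/-! ### Integration by parts along lines -/

namespace DirectionalCalculus

open Filter Topology Set

variable {E : Type*} [AddCommGroup E] [Module ℝ E] {v : E} {U : Set E}

theorem lineDeriv_add_smul_eq_deriv {F : Type*} [NormedAddCommGroup F] [NormedSpace ℝ F]
    (g : E → F) (x v : E) (t : ℝ) :
    lineDeriv ℝ g (x + t • v) v = deriv (fun s : ℝ => g (x + s • v)) t := by
  have e : (fun s : ℝ => g (x + t • v + s • v)) = fun s => (fun r : ℝ => g (x + r • v)) (t + s) := by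
    ext s
    simp only [add_smul, add_assoc]
  rw [lineDeriv, e, deriv_comp_const_add (fun r : ℝ => g (x + r • v)) t 0, add_zero]

/-- `F` has the continuous derivative `F'` along the lines with direction `v` inside `U`, and is
supported in a subset `K` of `U` which meets these lines in closed sets. -/
structure LineTest (U K : Set E) (v : E) (F F' : E → ℝ) : Prop where
  subset : K ⊆ U
  isClosed : ∀ x, IsClosed {t : ℝ | x + t • v ∈ K}
  hasDerivAt : ∀ x ∈ U, HasDerivAt (fun t : ℝ => F (x + t • v)) (F' x) 0
  continuousOn : ∀ x, ContinuousOn (fun t : ℝ => F' (x + t • v)) {t : ℝ | x + t • v ∈ U}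
  eq_zero : ∀ x ∈ U, x ∉ K → F x = 0 ∧ F' x = 0

theorem LineTest.hasDerivAt_line {K : Set E} {F F' : E → ℝ} (h : LineTest U K v F F') {x : E}
    {t : ℝ} (ht : x + t • v ∈ U) :
    HasDerivAt (fun s : ℝ => F (x + s • v)) (F' (x + t • v)) t := by
  have h1 := h.hasDerivAt _ ht
  have e : (fun s : ℝ => F (x + s • v)) = fun s => (fun r : ℝ => F (x + t • v + r • v)) (s - t) := by
    ext s
    congr 1
    module
  rw [e]
  exact HasDerivAt.comp_sub_const t t (by simpa using h1)

theorem AbsContLine.comp_lipschitz {X Y : Type*} [PseudoMetricSpace X] [PseudoMetricSpace Y]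
    {g : E → X} {x : E} (hg : AbsContLine g U v x) {f : X → Y} {C : NNReal}
    (hf : LipschitzWith C f) : AbsContLine (fun y => f (g y)) U v x := by
  intro a b hab
  have h := Filter.Tendsto.const_mul (C : ℝ) (hg a b hab)
  rw [mul_zero] at h
  refine squeeze_zero (fun t => Finset.sum_nonneg fun i _ => dist_nonneg) (fun t => ?_) h
  rw [Finset.mul_sum]
  exact Finset.sum_le_sum fun i _ => hf.dist_le_mul _ _

theorem AbsContLine.re {g : E → ℂ} {x : E} (hg : AbsContLine g U v x) :
    AbsContLine (fun y => (g y).re) U v x :=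
  hg.comp_lipschitz (C := 1) (LipschitzWith.of_dist_le_mul fun a b => by
    rw [NNReal.coe_one, one_mul, Real.dist_eq, ← Complex.sub_re, dist_eq_norm]
    exact Complex.abs_re_le_norm _)

theorem AbsContLine.im {g : E → ℂ} {x : E} (hg : AbsContLine g U v x) :
    AbsContLine (fun y => (g y).im) U v x :=
  hg.comp_lipschitz (C := 1) (LipschitzWith.of_dist_le_mul fun a b => by
    rw [NNReal.coe_one, one_mul, Real.dist_eq, ← Complex.sub_im, dist_eq_norm]
    exact Complex.abs_im_le_norm _)

theorem AbsContLine.conj_mul {f g : E → ℂ} {x : E} (hf : AbsContLine f U v x)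
    (hg : AbsContLine g U v x) : AbsContLine (fun y => star (f y) * g y) U v x := by
  intro a b hab
  have hf' : AbsContLine (fun y => star (f y)) U v x :=
    hf.comp_lipschitz (C := 1) (LipschitzWith.of_dist_le_mul fun a b => by simp)
  exact (hf' a b hab).smul (hg a b hab)

theorem AbsContLine.sum {ι : Type*} (s : Finset ι) {g : ι → E → ℂ} {x : E}
    (hg : ∀ i ∈ s, AbsContLine (g i) U v x) :
    AbsContLine (fun y => ∑ i ∈ s, g i y) U v x := by
  classical
  induction s using Finset.induction_on with
  | empty =>
    intro a b _
    simp only [Finset.sum_empty]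
    exact (LipschitzWith.const (0 : ℂ)).lipschitzOnWith.absolutelyContinuousOnInterval
  | insert i s his ih =>
    intro a b hab
    simp only [Finset.sum_insert his]
    exact (hg i (by simp) a b hab).add (ih (fun j hj => hg j (by simp [hj])) a b hab)

theorem hasLineDerivAt_complex {g : E → ℂ} {x : E}
    (hre : LineDifferentiableAt ℝ (fun y => (g y).re) x v)
    (him : LineDifferentiableAt ℝ (fun y => (g y).im) x v) :
    HasLineDerivAt ℝ g (((lineDeriv ℝ (fun y => (g y).re) x v : ℝ) : ℂ) +
      ((lineDeriv ℝ (fun y => (g y).im) x v : ℝ) : ℂ) * I) x v := by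
  have h1 := hre.hasLineDerivAt
  have h2 := him.hasLineDerivAt
  unfold HasLineDerivAt at *
  have := h1.ofReal_comp.add (h2.ofReal_comp.mul_const I)
  refine this.congr_of_eventuallyEq (Eventually.of_forall fun t => ?_)
  simp [Complex.re_add_im]

variable [MeasurableSpace E] {μ : Measure E}

/-- The line may leave U between the parameters a and b. Those at which it lies in K form a compact
set; between its least element α and its greatest element β the line stays in U, by order
connectedness. Outside [α, β] everything vanishes, and on it the usual formula for absolutely
continuous functions applies. -/
theorem AbsContLine.intervalIntegral_eq (hU : LineDomain U v) {g : E → ℝ} {x : E}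
    (hg : AbsContLine g U v x) {K : Set E} {F F' : E → ℝ} (hF : LineTest U K v F F')
    {a b : ℝ} (hab : a ≤ b) :
    ∫ t in a..b, U.indicator (fun y => lineDeriv ℝ g y v * F y + g y * F' y) (x + t • v) =
      U.indicator (fun y => g y * F y) (x + b • v) -
        U.indicator (fun y => g y * F y) (x + a • v) := by
  set C : Set ℝ := Icc a b ∩ {t : ℝ | x + t • v ∈ K} with hC
  have hCc : IsCompact C := isCompact_Icc.inter_right (hF.isClosed x)
  set W : E → ℝ := U.indicator (fun y => lineDeriv ℝ g y v * F y + g y * F' y) with hW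
  set Φ : E → ℝ := U.indicator (fun y => g y * F y) with hΦ
  have hz : ∀ t ∈ Icc a b, t ∉ C → Φ (x + t • v) = 0 ∧ W (x + t • v) = 0 := by
    intro t ht htC
    by_cases htU : x + t • v ∈ U
    · have := hF.eq_zero _ htU (fun h => htC ⟨ht, h⟩)
      simp [hΦ, hW, htU, this.1, this.2]
    · simp [hΦ, hW, htU]
  rw [intervalIntegral.integral_of_le hab, ← integral_Icc_eq_integral_Ioc]
  rcases C.eq_empty_or_nonempty with hemp | hne
  · have hz' : ∀ t ∈ Icc a b, Φ (x + t • v) = 0 ∧ W (x + t • v) = 0 := fun t ht =>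
      hz t ht (by simp [hemp])
    rw [setIntegral_congr_fun (g := fun _ => (0 : ℝ)) measurableSet_Icc fun t ht => (hz' t ht).2,
      (hz' a ⟨le_rfl, hab⟩).1, (hz' b ⟨hab, le_rfl⟩).1]
    simp
  obtain ⟨α, hα⟩ := hCc.exists_isLeast hne
  obtain ⟨β, hβ⟩ := hCc.exists_isGreatest hne
  have hαβ : α ≤ β := hα.2 hβ.1
  have hJ : ∀ t ∈ Icc α β, x + t • v ∈ U := fun t ht =>
    (hU.ordConnected x).out (hF.subset hα.1.2) (hF.subset hβ.1.2) ht
  have hsub : Icc α β ⊆ Icc a b := Icc_subset_Icc hα.1.1.1 hβ.1.1.2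
  rw [setIntegral_eq_of_subset_of_forall_sdiff_eq_zero measurableSet_Icc hsub
    fun t ht => (hz t ht.1 fun h => ht.2 ⟨hα.2 h, hβ.2 h⟩).2]
  have hderiv : ∀ t ∈ Icc α β,
      HasDerivAt (fun s : ℝ => F (x + s • v)) (F' (x + t • v)) t := fun t ht =>
    hF.hasDerivAt_line (hJ t ht)
  -- The continuous derivative is bounded on the compact interval, so F is Lipschitz there.
  have hFac : AbsolutelyContinuousOnInterval (fun s : ℝ => F (x + s • v)) α β := by
    obtain ⟨M, hM⟩ := isCompact_Icc.exists_bound_of_continuousOn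
      ((hF.continuousOn x).mono fun t ht => hJ t ht)
    refine LipschitzOnWith.absolutelyContinuousOnInterval (K := M.toNNReal) ?_
    rw [uIcc_of_le hαβ]
    refine (convex_Icc α β).lipschitzOnWith_of_nnnorm_hasDerivWithin_le
      (fun t ht => (hderiv t ht).hasDerivWithinAt) fun t ht => ?_
    rw [← NNReal.coe_le_coe, coe_nnnorm]
    exact (hM t ht).trans (Real.le_coe_toNNReal M)
  have hgac := hg α β fun t ht => hJ t (by rwa [uIcc_of_le hαβ] at ht)
  have hmain := hgac.integral_deriv_mul_eq_sub hFac
  rw [intervalIntegral.integral_of_le hαβ, ← integral_Icc_eq_integral_Ioc] at hmain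
  have hWc : ∫ t in Icc α β, W (x + t • v) = Φ (x + β • v) - Φ (x + α • v) := by
    rw [hΦ, indicator_of_mem (hJ β ⟨hαβ, le_rfl⟩), indicator_of_mem (hJ α ⟨le_rfl, hαβ⟩), ← hmain]
    refine setIntegral_congr_fun measurableSet_Icc fun t ht => ?_
    simp only [hW]
    rw [indicator_of_mem (hJ t ht), lineDeriv_add_smul_eq_deriv, (hderiv t ht).deriv]
  rw [hWc]
  -- The boundary values at α, β are exchanged for those at a, b. If β < b, then F is zero
  -- immediately to the right of β, hence at β by continuity; the case a < α is symmetric.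
  congr 1
  · rcases hβ.1.1.2.eq_or_lt with h | h
    · rw [h]
    rw [(hz b ⟨hab, le_rfl⟩ fun hb => absurd (hβ.2 hb) (not_le.2 h)).1]
    have hc := (hderiv β ⟨hαβ, le_rfl⟩).continuousAt
    have hF0 : F (x + β • v) = 0 := by
      refine tendsto_nhds_unique (hc.tendsto.mono_left (nhdsWithin_le_nhds (s := Ioi β)))
        (tendsto_const_nhds.congr' ?_)
      have hUn : ∀ᶠ t in 𝓝 β, x + t • v ∈ U := (hU.isOpen x).mem_nhds (hJ β ⟨hαβ, le_rfl⟩)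
      filter_upwards [hUn.filter_mono nhdsWithin_le_nhds, Ioc_mem_nhdsGT h] with t htU ht
      exact ((hF.eq_zero _ htU fun hK =>
        absurd (hβ.2 ⟨⟨hβ.1.1.1.trans ht.1.le, ht.2⟩, hK⟩) (not_le.2 ht.1)).1).symm
    simp [hΦ, indicator, hF0]
  · rcases hα.1.1.1.eq_or_lt with h | h
    · rw [h]
    rw [(hz a ⟨le_rfl, hab⟩ fun hb => absurd (hα.2 hb) (not_le.2 h)).1]
    have hc := (hderiv α ⟨le_rfl, hαβ⟩).continuousAt
    have hF0 : F (x + α • v) = 0 := by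
      refine tendsto_nhds_unique (hc.tendsto.mono_left (nhdsWithin_le_nhds (s := Iio α)))
        (tendsto_const_nhds.congr' ?_)
      have hUn : ∀ᶠ t in 𝓝 α, x + t • v ∈ U := (hU.isOpen x).mem_nhds (hJ α ⟨le_rfl, hαβ⟩)
      filter_upwards [hUn.filter_mono nhdsWithin_le_nhds, Ico_mem_nhdsLT h] with t htU ht
      exact ((hF.eq_zero _ htU fun hK =>
        absurd (hα.2 ⟨⟨ht.1, ht.2.le.trans hα.1.1.2⟩, hK⟩) (not_le.2 ht.2)).1).symm
    simp [hΦ, indicator, hF0]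

/-- Integration by parts along lines, without boundary term. -/
theorem integral_lineDeriv_mul_add_eq_zero [SFinite μ] (hμ : LineInvariant μ v)
    (hU : LineDomain U v) {g : E → ℝ} (hg : ∀ᵐ x ∂μ.restrict U, AbsContLine g U v x)
    {K : Set E} {F F' : E → ℝ} (hF : LineTest U K v F F')
    (hgF : Integrable (fun x => g x * F x) (μ.restrict U))
    (hw : Integrable (fun x => lineDeriv ℝ g x v * F x + g x * F' x) (μ.restrict U)) :
    ∫ x in U, (lineDeriv ℝ g x v * F x + g x * F' x) ∂μ = 0 := by
  rw [ae_restrict_iff' hU.measurableSet] at hg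
  set W : E → ℝ := U.indicator (fun y => lineDeriv ℝ g y v * F y + g y * F' y) with hW
  set Φ : E → ℝ := U.indicator (fun y => g y * F y) with hΦ
  have hWi : Integrable W μ := (integrable_indicator_iff hU.measurableSet).2 hw
  have hΦi : Integrable Φ μ := (integrable_indicator_iff hU.measurableSet).2 hgF
  rw [← integral_indicator hU.measurableSet]
  have hmp := hμ.measurePreserving_prod
  -- Integrated over x, the left side becomes ∫ W by averaging, and the right side becomes zero
  -- since Φ and its translate have the same integral.
  have hline : ∀ᵐ x ∂μ, ∫ t in Ioc (0 : ℝ) 1, W (x + t • v) = Φ (x + (1 : ℝ) • v) - Φ x := by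
    filter_upwards [hμ.ae_shift hg] with x hx
    rcases {t : ℝ | x + t • v ∈ U}.eq_empty_or_nonempty with hemp | hne
    · have hn : ∀ t : ℝ, x + t • v ∉ U := fun t ht => (eq_empty_iff_forall_notMem.1 hemp t) ht
      have hW0 : ∀ t : ℝ, W (x + t • v) = 0 := fun t => indicator_of_notMem (hn t) _
      have hΦ0 : ∀ t : ℝ, Φ (x + t • v) = 0 := fun t => indicator_of_notMem (hn t) _
      have h0 := hΦ0 0
      rw [zero_smul, add_zero] at h0
      rw [hΦ0, h0]
      simp [hW0]
    · obtain ⟨r, hr⟩ := Rat.denseRange_cast.exists_mem_open (hU.isOpen x) hne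
      have h1 := (hx r hr).intervalIntegral_eq hU hF (a := 0 - r) (b := 1 - r) (by simp)
      have e : ∀ t : ℝ, x + (r : ℝ) • v + (t - r) • v = x + t • v := fun t => by module
      rw [← intervalIntegral.integral_comp_sub_right] at h1
      simp only [e] at h1
      rw [intervalIntegral.integral_of_le zero_le_one] at h1
      rw [h1]
      simp [hΦ]
  have h1 : ∫ x, W x ∂μ =
      ∫ y, W (y.1 + y.2 • v) ∂(μ.prod (volume.restrict (Ioc (0 : ℝ) 1))) := by
    conv_lhs => rw [← hmp.map_eq]
    exact integral_map hmp.aemeasurable (by rw [hmp.map_eq]; exact hWi.aestronglyMeasurable)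
  have hWi2 : Integrable (fun y : E × ℝ => W (y.1 + y.2 • v))
      (μ.prod (volume.restrict (Ioc (0 : ℝ) 1))) := hmp.integrable_comp_of_integrable hWi
  have hmp1 := hμ.measurePreserving 1
  have hΦi1 : Integrable (fun x => Φ (x + (1 : ℝ) • v)) μ := hmp1.integrable_comp_of_integrable hΦi
  have h2 : ∫ x, Φ (x + (1 : ℝ) • v) ∂μ = ∫ x, Φ x ∂μ := by
    conv_rhs => rw [← hmp1.map_eq]
    exact (integral_map hmp1.aemeasurable
      (by rw [hmp1.map_eq]; exact hΦi.aestronglyMeasurable)).symm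
  rw [h1, integral_prod _ hWi2, integral_congr_ae hline, integral_sub hΦi1 hΦi, h2, sub_self]

theorem ae_hasLineDerivAt_complex [SFinite μ] (hμ : LineInvariant μ v) (hU : LineDomain U v)
    {g : E → ℂ} (hm : AEMeasurable g (μ.restrict U))
    (hg : ∀ᵐ x ∂μ.restrict U, AbsContLine g U v x) :
    ∀ᵐ x ∂μ.restrict U, HasLineDerivAt ℝ g (((lineDeriv ℝ (fun y => (g y).re) x v : ℝ) : ℂ) +
      ((lineDeriv ℝ (fun y => (g y).im) x v : ℝ) : ℂ) * I) x v := by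
  filter_upwards [ae_lineDifferentiableAt hμ hU (measurable_re.comp_aemeasurable hm)
      (hg.mono fun x hx => hx.re), ae_lineDifferentiableAt hμ hU
      (measurable_im.comp_aemeasurable hm) (hg.mono fun x hx => hx.im)] with x h1 h2
  exact hasLineDerivAt_complex h1 h2

theorem aemeasurable_lineDeriv_complex [SFinite μ] (hμ : LineInvariant μ v)
    (hU : LineDomain U v) {g : E → ℂ} (hm : AEMeasurable g (μ.restrict U))
    (hg : ∀ᵐ x ∂μ.restrict U, AbsContLine g U v x) :
    AEMeasurable (fun x => lineDeriv ℝ g x v) (μ.restrict U) := by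
  have hr := aemeasurable_lineDeriv hμ hU (measurable_re.comp_aemeasurable hm)
    (ae_lineDifferentiableAt hμ hU (measurable_re.comp_aemeasurable hm)
      (hg.mono fun x hx => hx.re))
  have hi := aemeasurable_lineDeriv hμ hU (measurable_im.comp_aemeasurable hm)
    (ae_lineDifferentiableAt hμ hU (measurable_im.comp_aemeasurable hm)
      (hg.mono fun x hx => hx.im))
  refine AEMeasurable.congr (f := fun x => (((lineDeriv ℝ (fun y => (g y).re) x v : ℝ) : ℂ) +
      ((lineDeriv ℝ (fun y => (g y).im) x v : ℝ) : ℂ) * I)) ?_ ?_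
  · exact (measurable_ofReal.comp_aemeasurable hr).add
      ((measurable_ofReal.comp_aemeasurable hi).mul_const I)
  · filter_upwards [ae_hasLineDerivAt_complex hμ hU hm hg] with x hx
    exact hx.lineDeriv.symm

theorem integral_lineDeriv_mul_add_eq_zero_complex [SFinite μ] (hμ : LineInvariant μ v)
    (hU : LineDomain U v) {g : E → ℂ} (hm : AEMeasurable g (μ.restrict U))
    (hg : ∀ᵐ x ∂μ.restrict U, AbsContLine g U v x)
    {K : Set E} {F F' : E → ℝ} (hF : LineTest U K v F F')
    (hgF : Integrable (fun x => g x * F x) (μ.restrict U))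
    (hw : Integrable (fun x => lineDeriv ℝ g x v * F x + g x * F' x) (μ.restrict U)) :
    ∫ x in U, (lineDeriv ℝ g x v * F x + g x * F' x) ∂μ = 0 := by
  have hd := ae_hasLineDerivAt_complex hμ hU hm hg
  have hre : (fun x => (lineDeriv ℝ g x v * F x + g x * F' x).re) =ᵐ[μ.restrict U]
      fun x => lineDeriv ℝ (fun y => (g y).re) x v * F x + (g x).re * F' x := by
    filter_upwards [hd] with x hx
    rw [hx.lineDeriv]
    simp
  have him : (fun x => (lineDeriv ℝ g x v * F x + g x * F' x).im) =ᵐ[μ.restrict U]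
      fun x => lineDeriv ℝ (fun y => (g y).im) x v * F x + (g x).im * F' x := by
    filter_upwards [hd] with x hx
    rw [hx.lineDeriv]
    simp
  apply Complex.ext
  · have h1 : (∫ x in U, (lineDeriv ℝ g x v * F x + g x * F' x) ∂μ).re =
        ∫ x in U, (lineDeriv ℝ g x v * F x + g x * F' x).re ∂μ := (integral_re hw).symm
    rw [h1, integral_congr_ae hre]
    refine integral_lineDeriv_mul_add_eq_zero hμ hU (hg.mono fun x hx => hx.re) hF ?_
      (hw.re.congr hre)
    simpa using hgF.re
  · have h1 : (∫ x in U, (lineDeriv ℝ g x v * F x + g x * F' x) ∂μ).im =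
        ∫ x in U, (lineDeriv ℝ g x v * F x + g x * F' x).im ∂μ := (integral_im hw).symm
    rw [h1, integral_congr_ae him]
    refine integral_lineDeriv_mul_add_eq_zero hμ hU (hg.mono fun x hx => hx.im) hF ?_
      (hw.im.congr him)
    simpa using hgF.im

end DirectionalCalculus

/-! ### Translation invariance of the Lebesgue measures, and lines in the positive definite cone -/

namespace ComplexNormalMean

open Filter Topology Set DirectionalCalculus

section Measurability

variable (m p : ℕ)

instance instBorelSpaceMatrix : BorelSpace (Matrix (Fin m) (Fin p) ℂ) :=
  inferInstanceAs (BorelSpace (Fin m → Fin p → ℂ))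

instance instSecondCountableTopologyMatrix :
    SecondCountableTopology (Matrix (Fin m) (Fin p) ℂ) :=
  inferInstanceAs (SecondCountableTopology (Fin m → Fin p → ℂ))

theorem continuous_hermOf : Continuous (hermOf p) := by
  refine continuous_matrix fun j k => ?_
  simp only [hermOf, Matrix.of_apply]
  split_ifs <;> fun_prop

instance instSFiniteLebMat : SFinite (lebMat m p) := by
  unfold lebMat
  infer_instance

instance instSFiniteLebHerm : SFinite (lebHerm p) := by
  unfold lebHerm
  infer_instance

end Measurability

variable {m p : ℕ}

theorem lebMat_eq : lebMat m p = (volume : Measure (Fin m → Fin p → ℂ)) :=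
  Measure.map_id

theorem hermOf_add (x y : Fin p → Fin p → ℝ) : hermOf p (x + y) = hermOf p x + hermOf p y := by
  ext j k
  simp only [hermOf, Matrix.of_apply, Matrix.add_apply, Pi.add_apply]
  split_ifs <;> push_cast <;> ring

theorem exists_hermOf_eq {v : Matrix (Fin p) (Fin p) ℂ} (hv : v.IsHermitian) :
    ∃ y, hermOf p y = v := by
  refine ⟨fun j k => if j ≤ k then (v j k).re else (v k j).im, ?_⟩
  ext j k
  simp only [hermOf, Matrix.of_apply]
  have hjk : star (v j k) = v k j := hv.apply k j
  rcases lt_trichotomy j k with h | h | h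
  · rw [if_neg h.ne, if_pos h, if_pos h.le, if_neg h.not_ge]
    exact Complex.re_add_im _
  · subst h
    rw [if_pos rfl, if_pos le_rfl]
    have : (v j j).im = 0 := by
      have := congrArg Complex.im hjk
      simp at this
      linarith
    exact Complex.ext (by simp) (by simp [this])
  · rw [if_neg h.ne', if_neg h.not_gt, if_pos h.le, if_neg h.not_ge, ← hjk]
    exact Complex.ext (by simp) (by simp)

theorem map_add_lebMat (w : Matrix (Fin m) (Fin p) ℂ) :
    Measure.map (fun z => z + w) (lebMat m p) = lebMat m p := by
  rw [lebMat_eq]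
  exact map_add_right_eq_self (volume : Measure (Fin m → Fin p → ℂ)) w

/-- Since `hermOf` is additive and reaches every Hermitian matrix, a Hermitian translation lifts to
a translation of the real coordinates. -/
theorem map_add_lebHerm {v : Matrix (Fin p) (Fin p) ℂ} (hv : v.IsHermitian) :
    Measure.map (fun s => s + v) (lebHerm p) = lebHerm p := by
  obtain ⟨y, rfl⟩ := exists_hermOf_eq hv
  have hc := (continuous_hermOf p).measurable
  have h1 : Measurable fun s : Matrix (Fin p) (Fin p) ℂ => s + hermOf p y :=
    (continuous_id.add continuous_const).measurable
  unfold lebHerm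
  rw [Measure.map_map h1 hc]
  have h2 : (fun s => s + hermOf p y) ∘ hermOf p = hermOf p ∘ fun x => x + y := by
    ext1 x
    exact (hermOf_add x y).symm
  rw [h2, ← Measure.map_map hc (measurable_add_const y),
    map_add_right_eq_self (volume : Measure (Fin p → Fin p → ℝ)) y]

theorem lineInvariant_prod (w : Matrix (Fin m) (Fin p) ℂ) {v : Matrix (Fin p) (Fin p) ℂ}
    (hv : v.IsHermitian) : LineInvariant ((lebMat m p).prod (lebHerm p)) (w, v) := by
  refine ⟨Continuous.measurable (by fun_prop), fun t => ?_⟩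
  have e : (fun x : Matrix (Fin m) (Fin p) ℂ × Matrix (Fin p) (Fin p) ℂ => x + t • (w, v)) =
      Prod.map (fun z => z + t • w) (fun s => s + t • v) := by
    ext1 x
    rfl
  have hm1 : Measurable fun z : Matrix (Fin m) (Fin p) ℂ => z + t • w :=
    (continuous_id.add continuous_const).measurable
  have hm2 : Measurable fun s : Matrix (Fin p) (Fin p) ℂ => s + t • v :=
    (continuous_id.add continuous_const).measurable
  have htv : (t • v).IsHermitian := IsSelfAdjoint.smul (IsSelfAdjoint.all t) hv
  rw [e, ← Measure.map_prod_map _ _ hm1 hm2, map_add_lebMat, map_add_lebHerm htv]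

theorem isClosed_posSemidef : IsClosed {s : Matrix (Fin p) (Fin p) ℂ | s.PosSemidef} := by
  have : {s : Matrix (Fin p) (Fin p) ℂ | s.PosSemidef} = {s | sᴴ = s} ∩
      ⋂ x : Fin p → ℂ, {s | 0 ≤ star x ⬝ᵥ (s *ᵥ x)} := by
    ext s
    simp only [mem_ofPred_eq, mem_inter_iff, mem_iInter, posSemidef_iff_dotProduct_mulVec]
    rfl
  rw [this]
  refine (isClosed_eq continuous_id.matrix_conjTranspose continuous_id).inter
    (isClosed_iInter fun x => ?_)
  exact isClosed_Ici.preimage (f := fun s : Matrix (Fin p) (Fin p) ℂ => star x ⬝ᵥ (s *ᵥ x))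
    (by fun_prop)

theorem measurableSet_posDef : MeasurableSet {s : Matrix (Fin p) (Fin p) ℂ | s.PosDef} := by
  have : {s : Matrix (Fin p) (Fin p) ℂ | s.PosDef} =
      {s | s.PosSemidef} ∩ {s | s.det = 0}ᶜ := by
    ext s
    constructor
    · exact fun h => ⟨h.posSemidef, (h.posSemidef.posDef_iff_det_ne_zero).1 h⟩
    · exact fun h => (h.1.posDef_iff_det_ne_zero).2 h.2
  rw [this]
  refine isClosed_posSemidef.measurableSet.inter (IsClosed.measurableSet ?_).compl
  exact isClosed_eq (by fun_prop) continuous_const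

theorem posDef_of_forall_sphere {M : Matrix (Fin p) (Fin p) ℂ} (hM : M.IsHermitian)
    (h : ∀ x ∈ Metric.sphere (0 : Fin p → ℂ) 1, 0 < (star x ⬝ᵥ (M *ᵥ x)).re) : M.PosDef := by
  refine PosDef.of_dotProduct_mulVec_pos hM fun x hx => ?_
  have hn : 0 < ‖x‖ := norm_pos_iff.2 hx
  have h1 := h ((‖x‖⁻¹ : ℂ) • x) (by simp [norm_smul, hn.ne'])
  rw [Complex.pos_iff]
  refine ⟨?_, (hM.im_star_dotProduct_mulVec_self x).symm⟩
  have e : star ((‖x‖⁻¹ : ℂ) • x) ⬝ᵥ (M *ᵥ ((‖x‖⁻¹ : ℂ) • x)) =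
      ((‖x‖⁻¹ ^ 2 : ℝ) : ℂ) * (star x ⬝ᵥ (M *ᵥ x)) := by
    rw [star_smul, Matrix.mulVec_smul, smul_dotProduct, dotProduct_smul]
    simp only [smul_eq_mul, RCLike.star_def, map_inv₀, Complex.conj_ofReal]
    push_cast
    ring
  rw [e, Complex.re_ofReal_mul] at h1
  exact (pos_iff_pos_of_mul_pos h1).1 (by positivity)

/-- Positive definite matrices need not form an open set among all complex matrices, so openness is
only claimed along Hermitian directions. Positivity of the quadratic form persists near t₀ uniformly
on the compact unit sphere. -/
theorem isOpen_posDef_line (s : Matrix (Fin p) (Fin p) ℂ) {v : Matrix (Fin p) (Fin p) ℂ}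
    (hv : v.IsHermitian) : IsOpen {t : ℝ | (s + t • v).PosDef} := by
  rw [isOpen_iff_mem_nhds]
  intro t₀ ht₀
  have htv : ∀ t : ℝ, (t • v).IsHermitian := fun t => IsSelfAdjoint.smul (IsSelfAdjoint.all t) hv
  have hs : s.IsHermitian := by
    have := ht₀.isHermitian.sub (htv t₀)
    simpa using this
  have hcont : Continuous fun z : ℝ × (Fin p → ℂ) => (star z.2 ⬝ᵥ ((s + z.1 • v) *ᵥ z.2)).re := by
    fun_prop
  have h := (isCompact_sphere (0 : Fin p → ℂ) 1).eventually_forall_of_forall_eventually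
    (x₀ := t₀) (P := fun t x => 0 < (star x ⬝ᵥ ((s + t • v) *ᵥ x)).re) fun x hx => by
      refine hcont.continuousAt.eventually (lt_mem_nhds ?_)
      have hx0 : x ≠ 0 := by
        rintro rfl
        simp at hx
      exact ht₀.re_dotProduct_pos hx0
  filter_upwards [h] with t ht
  exact posDef_of_forall_sphere (hs.add (htv t)) ht

theorem ordConnected_posDef_line (s v : Matrix (Fin p) (Fin p) ℂ) :
    OrdConnected {t : ℝ | (s + t • v).PosDef} := by
  refine ⟨fun a ha b hb t ht => ?_⟩
  rcases ht.1.eq_or_lt with rfl | hat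
  · exact ha
  rcases ht.2.eq_or_lt with rfl | htb
  · exact hb
  have hab : 0 < b - a := by linarith
  have e : s + t • v = ((b - t) / (b - a)) • (s + a • v) + ((t - a) / (b - a)) • (s + b • v) := by
    have h1 : (b - t) / (b - a) + (t - a) / (b - a) = 1 := by field_simp; ring
    have h2 : (b - t) / (b - a) * a + (t - a) / (b - a) * b = t := by field_simp; ring
    calc s + t • v = ((b - t) / (b - a) + (t - a) / (b - a)) • s +
        ((b - t) / (b - a) * a + (t - a) / (b - a) * b) • v := by rw [h1, h2, one_smul]
      _ = _ := by module
  change (s + t • v).PosDef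
  rw [e]
  exact (PosDef.smul ha (div_pos (by linarith) hab)).add
    (PosDef.smul hb (div_pos (by linarith) hab))

/-- The pairs `(z, s)` with `s` positive definite. -/
def posDom (m p : ℕ) : Set (Matrix (Fin m) (Fin p) ℂ × Matrix (Fin p) (Fin p) ℂ) :=
  {x | x.2.PosDef}

theorem lineDomain_posDom (w : Matrix (Fin m) (Fin p) ℂ) {v : Matrix (Fin p) (Fin p) ℂ}
    (hv : v.IsHermitian) : LineDomain (posDom m p) (w, v) where
  measurableSet := measurable_snd measurableSet_posDef
  isOpen x := isOpen_posDef_line x.2 hv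
  ordConnected x := ordConnected_posDef_line x.2 v

theorem lebDom_eq : lebDom m p = ((lebMat m p).prod (lebHerm p)).restrict (posDom m p) := by
  rw [lebDom]
  conv_lhs => rw [← Measure.restrict_univ (μ := lebMat m p)]
  rw [Measure.prod_restrict]
  congr 1
  ext x
  simp [posDom]

theorem isHermitian_hermReDir (j k : Fin p) : (hermReDir j k).IsHermitian := by
  unfold hermReDir Matrix.IsHermitian
  split_ifs with h
  · simp
  · simp [Matrix.conjTranspose_add, add_comm]

theorem isHermitian_hermImDir (j k : Fin p) : (hermImDir j k).IsHermitian := by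
  unfold hermImDir Matrix.IsHermitian
  split_ifs with h
  · simp
  · simp only [Matrix.conjTranspose_sub, Matrix.conjTranspose_single, RCLike.star_def, conj_I]
    ext a b
    simp only [Matrix.sub_apply, Matrix.single_apply]
    split_ifs <;> simp

theorem AbsContAlong.ae_absContLine
    {g : Matrix (Fin m) (Fin p) ℂ → Matrix (Fin p) (Fin p) ℂ → ℂ}
    {v : Matrix (Fin m) (Fin p) ℂ × Matrix (Fin p) (Fin p) ℂ} (hg : AbsContAlong g v) :
    ∀ᵐ x ∂((lebMat m p).prod (lebHerm p)).restrict (posDom m p),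
      AbsContLine (fun x => g x.1 x.2) (posDom m p) v x := by
  rw [← lebDom_eq]
  exact hg

end ComplexNormalMean

/-! ### Frobenius norm, trace inequalities, and the derivative of the determinant -/

namespace ComplexNormalMean

open Filter Topology Set DirectionalCalculus

variable {m p : ℕ}

section Frobenius

variable {l n k : Type*} [Fintype l] [Fintype n] [Fintype k]

/-- The square of the Frobenius norm. -/
noncomputable def frobSq (A : Matrix l n ℂ) : ℝ := ∑ i, ∑ j, ‖A i j‖ ^ 2

theorem frobSq_nonneg (A : Matrix l n ℂ) : 0 ≤ frobSq A :=
  Finset.sum_nonneg fun _ _ => Finset.sum_nonneg fun _ _ => by positivity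

theorem trace_conjTranspose_mul_self_eq (A : Matrix l n ℂ) :
    (Aᴴ * A).trace = (frobSq A : ℂ) := by
  simp only [Matrix.trace, Matrix.diag_apply, Matrix.mul_apply, Matrix.conjTranspose_apply, frobSq,
    RCLike.star_def]
  rw [Finset.sum_comm]
  push_cast
  refine Finset.sum_congr rfl fun i _ => Finset.sum_congr rfl fun j _ => ?_
  rw [mul_comm, Complex.mul_conj, Complex.normSq_eq_norm_sq]
  push_cast
  rfl

theorem frobSq_mul_le (A : Matrix l n ℂ) (B : Matrix n k ℂ) :
    frobSq (A * B) ≤ frobSq A * frobSq B := by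
  have h : ∀ i j, ‖(A * B) i j‖ ^ 2 ≤ (∑ x, ‖A i x‖ ^ 2) * ∑ x, ‖B x j‖ ^ 2 := by
    intro i j
    rw [Matrix.mul_apply]
    calc ‖∑ x, A i x * B x j‖ ^ 2 ≤ (∑ x, ‖A i x‖ * ‖B x j‖) ^ 2 := by
          gcongr
          exact (norm_sum_le _ _).trans (Finset.sum_le_sum fun x _ => (norm_mul _ _).le)
      _ ≤ _ := Finset.sum_mul_sq_le_sq_mul_sq _ _ _
  calc frobSq (A * B) ≤ ∑ i, ∑ j, (∑ x, ‖A i x‖ ^ 2) * ∑ x, ‖B x j‖ ^ 2 :=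
        Finset.sum_le_sum fun i _ => Finset.sum_le_sum fun j _ => h i j
    _ = frobSq A * frobSq B := by
        have e : frobSq B = ∑ j, ∑ x, ‖B x j‖ ^ 2 := Finset.sum_comm
        rw [e, frobSq, Finset.sum_mul_sum]

theorem norm_conjTranspose_mul_self_apply_le (A : Matrix l n ℂ) (j k : n) :
    ‖(Aᴴ * A) j k‖ ≤ frobSq A := by
  have hcol : ∀ j, ∑ i, ‖A i j‖ ^ 2 ≤ frobSq A := fun j =>
    Finset.sum_le_sum fun i _ =>
      Finset.single_le_sum (f := fun j => ‖A i j‖ ^ 2) (fun _ _ => by positivity)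
        (Finset.mem_univ j)
  rw [Matrix.mul_apply]
  calc ‖∑ i, Aᴴ j i * A i k‖ ≤ ∑ i, (‖A i j‖ ^ 2 + ‖A i k‖ ^ 2) / 2 := by
        refine (norm_sum_le _ _).trans (Finset.sum_le_sum fun i _ => ?_)
        rw [norm_mul, Matrix.conjTranspose_apply, norm_star]
        nlinarith [sq_nonneg (‖A i j‖ - ‖A i k‖)]
    _ = (∑ i, ‖A i j‖ ^ 2 + ∑ i, ‖A i k‖ ^ 2) / 2 := by
        rw [← Finset.sum_div, Finset.sum_add_distrib]
    _ ≤ frobSq A := by linarith [hcol j, hcol k]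

open scoped MatrixOrder in
theorem PosSemidef.exists_eq_conjTranspose_mul_self [DecidableEq n] {M : Matrix n n ℂ}
    (hM : M.PosSemidef) : ∃ B : Matrix n n ℂ, M = Bᴴ * B :=
  CStarAlgebra.nonneg_iff_eq_star_mul_self.1 hM.nonneg

theorem norm_apply_le_trace_of_posSemidef [DecidableEq n] {M : Matrix n n ℂ}
    (hM : M.PosSemidef) (j k : n) : ‖M j k‖ ≤ M.trace.re := by
  obtain ⟨B, rfl⟩ := PosSemidef.exists_eq_conjTranspose_mul_self hM
  rw [trace_conjTranspose_mul_self_eq, Complex.ofReal_re]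
  exact norm_conjTranspose_mul_self_apply_le B j k

/-- The trace of `A^* A M` is a squared Frobenius norm when `M` is positive semidefinite. -/
theorem trace_conjTranspose_mul_self_mul_nonneg [DecidableEq n] (A : Matrix l n ℂ)
    {M : Matrix n n ℂ} (hM : M.PosSemidef) : 0 ≤ (Aᴴ * A * M).trace := by
  obtain ⟨B, rfl⟩ := PosSemidef.exists_eq_conjTranspose_mul_self hM
  have e : (Aᴴ * A * (Bᴴ * B)).trace = ((A * Bᴴ)ᴴ * (A * Bᴴ)).trace := by
    rw [Matrix.conjTranspose_mul, Matrix.conjTranspose_conjTranspose,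
      show B * Aᴴ * (A * Bᴴ) = B * (Aᴴ * A * Bᴴ) by simp only [Matrix.mul_assoc],
      Matrix.trace_mul_comm B]
    simp only [Matrix.mul_assoc]
  rw [e, trace_conjTranspose_mul_self_eq]
  exact_mod_cast frobSq_nonneg _

/-- With s⁻¹ = B^*B, apply submultiplicativity to A = (AB^*)(B^*)⁻¹; the squared norms of the
factors are Tr(A^*As⁻¹) and Tr s. This is how integrability of Tr(G^*GS⁻¹) controls the entries of
G^*G wherever Tr S is bounded. -/
theorem frobSq_le_trace_mul [DecidableEq n] (A : Matrix l n ℂ) {s : Matrix n n ℂ}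
    (hs : s.PosDef) : frobSq A ≤ s.trace.re * (Aᴴ * A * s⁻¹).trace.re := by
  obtain ⟨B, hB⟩ := PosSemidef.exists_eq_conjTranspose_mul_self hs.inv.posSemidef
  have hdet : IsUnit s.det := (Matrix.isUnit_iff_isUnit_det s).1 hs.isUnit
  have hBdet : IsUnit B.det := by
    have h1 : IsUnit (s⁻¹).det := Matrix.isUnit_nonsing_inv_det s hdet
    rw [hB, Matrix.det_mul] at h1
    exact isUnit_of_mul_isUnit_right h1
  have hBHdet : IsUnit (Bᴴ).det := by
    rw [Matrix.det_conjTranspose]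
    exact hBdet.star
  have hsB : s = B⁻¹ * (B⁻¹)ᴴ := by
    rw [← Matrix.nonsing_inv_nonsing_inv s hdet, hB, Matrix.mul_inv_rev,
      Matrix.conjTranspose_nonsing_inv]
  have h1 : frobSq A ≤ frobSq (A * Bᴴ) * frobSq ((Bᴴ)⁻¹) := by
    have := frobSq_mul_le (A * Bᴴ) ((Bᴴ)⁻¹)
    rwa [Matrix.mul_nonsing_inv_cancel_right _ _ hBHdet] at this
  have h2 : (frobSq (A * Bᴴ) : ℂ) = (Aᴴ * A * s⁻¹).trace := by
    rw [← trace_conjTranspose_mul_self_eq, hB, Matrix.conjTranspose_mul,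
      Matrix.conjTranspose_conjTranspose,
      show B * Aᴴ * (A * Bᴴ) = B * (Aᴴ * A * Bᴴ) by simp only [Matrix.mul_assoc],
      Matrix.trace_mul_comm B]
    simp only [Matrix.mul_assoc]
  have h3 : (frobSq ((Bᴴ)⁻¹) : ℂ) = s.trace := by
    rw [← trace_conjTranspose_mul_self_eq, hsB, ← Matrix.conjTranspose_nonsing_inv,
      Matrix.conjTranspose_conjTranspose]
  have h2' : frobSq (A * Bᴴ) = (Aᴴ * A * s⁻¹).trace.re := by rw [← h2, Complex.ofReal_re]
  have h3' : frobSq ((Bᴴ)⁻¹) = s.trace.re := by rw [← h3, Complex.ofReal_re]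
  rw [← h2', ← h3', mul_comm]
  exact h1

/-- The trace of `s` is controlled by that of `s Σ⁻¹`. -/
theorem trace_le_trace_mul_inv [DecidableEq n] {s S : Matrix n n ℂ} (hs : s.PosSemidef)
    (hS : S.PosDef) : s.trace.re ≤ S.trace.re * (s * S⁻¹).trace.re := by
  obtain ⟨B, rfl⟩ := PosSemidef.exists_eq_conjTranspose_mul_self hs
  have := frobSq_le_trace_mul B hS
  rwa [trace_conjTranspose_mul_self_eq, Complex.ofReal_re]

theorem trace_mul_nonneg_of_posSemidef [DecidableEq n] {s M : Matrix n n ℂ} (hs : s.PosSemidef)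
    (hM : M.PosSemidef) : 0 ≤ (s * M).trace := by
  obtain ⟨B, rfl⟩ := PosSemidef.exists_eq_conjTranspose_mul_self hs
  exact trace_conjTranspose_mul_self_mul_nonneg B hM

end Frobenius

theorem PosDef.det_re_pos {s : Matrix (Fin p) (Fin p) ℂ} (hs : s.PosDef) :
    0 < s.det.re ∧ s.det.im = 0 := by
  have := Complex.pos_iff.1 hs.det_pos
  exact ⟨this.1, this.2.symm⟩

theorem PosDef.isUnit_det {s : Matrix (Fin p) (Fin p) ℂ} (hs : s.PosDef) : IsUnit s.det :=
  (Matrix.isUnit_iff_isUnit_det s).1 hs.isUnit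

theorem continuousAt_inv_of_posDef {s : Matrix (Fin p) (Fin p) ℂ} (hs : s.PosDef) :
    ContinuousAt (fun t : Matrix (Fin p) (Fin p) ℂ => t⁻¹) s := by
  refine continuousAt_matrix_inv s ?_
  rw [Ring.inverse_eq_inv']
  exact continuousAt_inv₀ (PosDef.isUnit_det hs).ne_zero

/-- Jacobi's formula for the derivative of the determinant. -/
theorem hasDerivAt_det_add_smul {s : Matrix (Fin p) (Fin p) ℂ} (hs : IsUnit s.det)
    (v : Matrix (Fin p) (Fin p) ℂ) :
    HasDerivAt (fun t : ℝ => (s + t • v).det) (s.det * (s⁻¹ * v).trace) 0 := by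
  set M := s⁻¹ * v with hM
  -- Factor s + tv = s(1 + tM); det(1 + tM) is a polynomial in t whose first two coefficients are 1
  -- and Tr M.
  have e : ∀ t : ℝ, (s + t • v).det = s.det * (1 + M.trace * t +
      (det (1 + (Polynomial.X : Polynomial ℂ) • M.map Polynomial.C)).divX.divX.eval (t : ℂ)
        * (t : ℂ) ^ 2) := by
    intro t
    rw [← Matrix.det_one_add_smul, ← Matrix.det_mul, mul_add, mul_one, Matrix.mul_smul, hM,
      Matrix.mul_nonsing_inv_cancel_left _ _ hs]
    rfl
  set P := (det (1 + (Polynomial.X : Polynomial ℂ) • M.map Polynomial.C)).divX.divX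
  have h : HasDerivAt (fun z : ℂ => s.det * (1 + M.trace * z + P.eval z * z ^ 2))
      (s.det * M.trace) 0 := by
    have h1 := (((hasDerivAt_id (0 : ℂ)).const_mul M.trace).const_add 1).add
      ((P.hasDerivAt 0).mul ((hasDerivAt_id (0 : ℂ)).pow 2))
    have h2 := h1.const_mul s.det
    simp at h2
    exact h2
  have h' := HasDerivAt.comp_ofReal (z := 0) (by simpa using h)
  exact h'.congr_of_eventuallyEq (Eventually.of_forall e)

theorem hasDerivAt_det_re_add_smul {s : Matrix (Fin p) (Fin p) ℂ} (hs : s.PosDef)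
    (v : Matrix (Fin p) (Fin p) ℂ) :
    HasDerivAt (fun t : ℝ => (s + t • v).det.re) (s.det.re * (s⁻¹ * v).trace.re) 0 := by
  have h := hasDerivAt_det_add_smul (PosDef.isUnit_det hs) v
  have h2 := (Complex.reCLM.hasFDerivAt.comp_hasDerivAt (0 : ℝ) h)
  simp only [Complex.reCLM_apply, Complex.mul_re, (PosDef.det_re_pos hs).2, zero_mul, sub_zero] at h2
  exact h2

/-- The logarithmic derivative of the determinant is bounded away from the boundary of a bounded
set of positive definite matrices. -/
theorem exists_bound_trace_inv_mul (v : Matrix (Fin p) (Fin p) ℂ) (C : ℝ) {ε : ℝ} (hε : 0 < ε) :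
    ∃ B, ∀ s : Matrix (Fin p) (Fin p) ℂ, s.PosDef → s.trace.re ≤ C → ε ≤ s.det.re →
      |(s⁻¹ * v).trace.re| ≤ B := by
  -- Semidefiniteness makes K closed, the trace bounds every entry, and the lower bound on the
  -- determinant excludes singular matrices. Thus K is compact and the inverse is continuous on it.
  set K : Set (Matrix (Fin p) (Fin p) ℂ) := {s | s.PosSemidef} ∩ {s | s.trace.re ≤ C} ∩
    {s | ε ≤ s.det.re} with hK
  have hposdef : ∀ s ∈ K, s.PosDef := by
    rintro s ⟨⟨h1, -⟩, h3⟩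
    refine h1.posDef_iff_det_ne_zero.2 fun h => ?_
    change ε ≤ s.det.re at h3
    rw [h, Complex.zero_re] at h3
    linarith
  have hcl : IsClosed K := by
    refine (isClosed_posSemidef.inter ?_).inter ?_
    · exact isClosed_le (Complex.continuous_re.comp continuous_id.matrix_trace) continuous_const
    · exact isClosed_le continuous_const (Complex.continuous_re.comp continuous_id.matrix_det)
  have hcomp : IsCompact K := by
    have hbig : IsCompact (Set.univ.pi fun _ : Fin p => Set.univ.pi fun _ : Fin p =>
        Metric.closedBall (0 : ℂ) C) :=
      isCompact_univ_pi fun _ => isCompact_univ_pi fun _ => isCompact_closedBall 0 C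
    refine IsCompact.of_isClosed_subset (X := Matrix (Fin p) (Fin p) ℂ) hbig hcl ?_
    rintro s ⟨⟨h1, h2⟩, -⟩ j - k -
    rw [mem_closedBall_zero_iff]
    exact (norm_apply_le_trace_of_posSemidef h1 j k).trans h2
  have hcont : ContinuousOn (fun s : Matrix (Fin p) (Fin p) ℂ => (s⁻¹ * v).trace.re) K := by
    intro s hs
    refine ContinuousAt.continuousWithinAt ?_
    have h1 : Continuous fun M : Matrix (Fin p) (Fin p) ℂ => (M * v).trace.re :=
      Complex.continuous_re.comp (Continuous.matrix_trace (by fun_prop))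
    exact ContinuousAt.comp (g := fun M : Matrix (Fin p) (Fin p) ℂ => (M * v).trace.re)
      h1.continuousAt (continuousAt_inv_of_posDef (hposdef s hs))
  obtain ⟨B, hB⟩ := hcomp.exists_bound_of_continuousOn hcont
  exact ⟨B, fun s hs h1 h2 => hB s ⟨⟨hs.posSemidef, h1⟩, h2⟩⟩

end ComplexNormalMean

/-! ### The joint density, and integration by parts under the joint law -/

namespace ComplexNormalMean

open Filter Topology Set DirectionalCalculus

variable {m p n : ℕ}

theorem continuous_normalDensity (Ξ : Matrix (Fin m) (Fin p) ℂ) (Sig : Matrix (Fin p) (Fin p) ℂ) :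
    Continuous (normalDensity Ξ Sig) := by
  unfold normalDensity
  refine continuous_const.mul (Real.continuous_exp.comp (Continuous.neg ?_))
  exact Complex.continuous_re.comp (Continuous.matrix_trace (by fun_prop))

theorem continuous_wishartDensity (Sig : Matrix (Fin p) (Fin p) ℂ) (n : ℕ) :
    Continuous (wishartDensity Sig n) := by
  unfold wishartDensity
  refine Continuous.div_const (Continuous.mul ?_ (Real.continuous_exp.comp (Continuous.neg ?_))) _
  · exact (Complex.continuous_re.comp continuous_id.matrix_det).pow _
  · exact Complex.continuous_re.comp (Continuous.matrix_trace (by fun_prop))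

theorem normalDensity_pos (Ξ : Matrix (Fin m) (Fin p) ℂ) {Sig : Matrix (Fin p) (Fin p) ℂ}
    (hSig : Sig.PosDef) (z : Matrix (Fin m) (Fin p) ℂ) : 0 < normalDensity Ξ Sig z := by
  have := (PosDef.det_re_pos hSig).1
  unfold normalDensity
  positivity

theorem wishartDensity_pos (hn : p < n) {Sig : Matrix (Fin p) (Fin p) ℂ} (hSig : Sig.PosDef)
    {s : Matrix (Fin p) (Fin p) ℂ} (hs : s.PosDef) : 0 < wishartDensity Sig n s := by
  have h1 := (PosDef.det_re_pos hSig).1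
  have h2 := (PosDef.det_re_pos hs).1
  have h3 : 0 < ∏ k ∈ Finset.Icc 1 p, Real.Gamma ((n : ℝ) + 1 - (k : ℝ)) := by
    refine Finset.prod_pos fun k hk => Real.Gamma_pos_of_pos ?_
    have : (k : ℝ) ≤ p := by exact_mod_cast (Finset.mem_Icc.1 hk).2
    have : (p : ℝ) < n := by exact_mod_cast hn
    linarith
  unfold wishartDensity
  positivity

/-- The joint density of `Z` and `S`. -/
noncomputable def jointDensity (Ξ : Matrix (Fin m) (Fin p) ℂ) (Sig : Matrix (Fin p) (Fin p) ℂ)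
    (n : ℕ) (x : Matrix (Fin m) (Fin p) ℂ × Matrix (Fin p) (Fin p) ℂ) : ℝ :=
  normalDensity Ξ Sig x.1 * wishartDensity Sig n x.2

theorem continuous_jointDensity (Ξ : Matrix (Fin m) (Fin p) ℂ) (Sig : Matrix (Fin p) (Fin p) ℂ)
    (n : ℕ) : Continuous (jointDensity Ξ Sig n) :=
  ((continuous_normalDensity Ξ Sig).comp continuous_fst).mul
    ((continuous_wishartDensity Sig n).comp continuous_snd)

theorem jointDensity_pos (hn : p < n) (Ξ : Matrix (Fin m) (Fin p) ℂ)
    {Sig : Matrix (Fin p) (Fin p) ℂ} (hSig : Sig.PosDef)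
    {x : Matrix (Fin m) (Fin p) ℂ × Matrix (Fin p) (Fin p) ℂ} (hx : x ∈ posDom m p) :
    0 < jointDensity Ξ Sig n x :=
  mul_pos (normalDensity_pos Ξ hSig _) (wishartDensity_pos hn hSig hx)

theorem prod_complexNormal_complexWishart (Ξ : Matrix (Fin m) (Fin p) ℂ)
    {Sig : Matrix (Fin p) (Fin p) ℂ} (hSig : Sig.PosDef) (n : ℕ) :
    (complexNormal Ξ Sig).prod (complexWishart Sig n) =
      (lebDom m p).withDensity fun x => ENNReal.ofReal (jointDensity Ξ Sig n x) := by
  have hm1 : Measurable fun z => ENNReal.ofReal (normalDensity Ξ Sig z) :=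
    (continuous_normalDensity Ξ Sig).measurable.ennreal_ofReal
  have hm2 : Measurable fun s => ENNReal.ofReal (wishartDensity Sig n s) :=
    (continuous_wishartDensity Sig n).measurable.ennreal_ofReal
  rw [complexNormal, complexWishart, withDensity_indicator measurableSet_posDef,
    prod_withDensity hm1 hm2, lebDom]
  congr 1
  ext1 x
  rw [jointDensity, ENNReal.ofReal_mul (normalDensity_pos Ξ hSig _).le]

section Law

variable {Ξ : Matrix (Fin m) (Fin p) ℂ} {Sig : Matrix (Fin p) (Fin p) ℂ}
  {Ω : Type*} [MeasurableSpace Ω] {P : Measure Ω}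
  {X : Ω → Matrix (Fin m) (Fin p) ℂ × Matrix (Fin p) (Fin p) ℂ}

/-- `X` has the joint law of the normal matrix and the Wishart matrix. -/
structure JointLaw (Ξ : Matrix (Fin m) (Fin p) ℂ) (Sig : Matrix (Fin p) (Fin p) ℂ) (n : ℕ)
    (P : Measure Ω) (X : Ω → Matrix (Fin m) (Fin p) ℂ × Matrix (Fin p) (Fin p) ℂ) : Prop where
  lt : p < n
  posDef : Sig.PosDef
  aemeasurable : AEMeasurable X P
  map_eq : P.map X = (lebDom m p).withDensity fun x => ENNReal.ofReal (jointDensity Ξ Sig n x)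

theorem jointLaw_of_indepFun [IsProbabilityMeasure P] (hn : p < n) (hSig : Sig.PosDef)
    {Z : Ω → Matrix (Fin m) (Fin p) ℂ} {S : Ω → Matrix (Fin p) (Fin p) ℂ}
    (hZ : HasLaw Z (complexNormal Ξ Sig) P) (hS : HasLaw S (complexWishart Sig n) P)
    (hZS : IndepFun Z S P) : JointLaw Ξ Sig n P fun ω => (Z ω, S ω) := by
  refine ⟨hn, hSig, hZ.aemeasurable.prodMk hS.aemeasurable, ?_⟩
  rw [(indepFun_iff_map_prod_eq_prod_map_map hZ.aemeasurable hS.aemeasurable).1 hZS, hZ.map_eq,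
    hS.map_eq, prod_complexNormal_complexWishart Ξ hSig n]

namespace JointLaw

theorem map_absolutelyContinuous (hX : JointLaw Ξ Sig n P X) : P.map X ≪ lebDom m p := by
  rw [hX.map_eq]
  exact withDensity_absolutelyContinuous _ _

theorem ae_of_ae_lebDom (hX : JointLaw Ξ Sig n P X)
    {Q : Matrix (Fin m) (Fin p) ℂ × Matrix (Fin p) (Fin p) ℂ → Prop}
    (h : ∀ᵐ x ∂lebDom m p, Q x) : ∀ᵐ ω ∂P, Q (X ω) :=
  ae_of_ae_map hX.aemeasurable (hX.map_absolutelyContinuous.ae_le h)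

theorem ae_posDef (hX : JointLaw Ξ Sig n P X) : ∀ᵐ ω ∂P, (X ω).2.PosDef := by
  refine hX.ae_of_ae_lebDom (Q := fun x => x.2.PosDef) ?_
  rw [lebDom_eq]
  exact ae_restrict_mem (measurable_snd measurableSet_posDef)

variable {F : Type*} [NormedAddCommGroup F]

theorem aestronglyMeasurable_comp (hX : JointLaw Ξ Sig n P X)
    {w : Matrix (Fin m) (Fin p) ℂ × Matrix (Fin p) (Fin p) ℂ → F}
    (hw : AEStronglyMeasurable w (lebDom m p)) :
    AEStronglyMeasurable (fun ω => w (X ω)) P :=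
  (hw.mono_ac hX.map_absolutelyContinuous).comp_aemeasurable hX.aemeasurable

variable [NormedSpace ℝ F]

theorem integrable_comp_iff (hX : JointLaw Ξ Sig n P X)
    {w : Matrix (Fin m) (Fin p) ℂ × Matrix (Fin p) (Fin p) ℂ → F}
    (hw : AEStronglyMeasurable w (lebDom m p)) :
    Integrable (fun ω => w (X ω)) P ↔
      Integrable (fun x => jointDensity Ξ Sig n x • w x) (lebDom m p) := by
  have h1 : Integrable w (P.map X) ↔ Integrable (fun ω => w (X ω)) P :=
    integrable_map_measure (hw.mono_ac hX.map_absolutelyContinuous) hX.aemeasurable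
  rw [← h1, hX.map_eq, integrable_withDensity_iff_integrable_smul'
    (continuous_jointDensity Ξ Sig n).measurable.ennreal_ofReal
    (Eventually.of_forall fun x => ENNReal.ofReal_lt_top)]
  refine integrable_congr ?_
  rw [lebDom_eq]
  filter_upwards [ae_restrict_mem (measurable_snd measurableSet_posDef)] with x hx
  rw [ENNReal.toReal_ofReal (jointDensity_pos hX.lt Ξ hX.posDef hx).le]

theorem integral_comp (hX : JointLaw Ξ Sig n P X)
    {w : Matrix (Fin m) (Fin p) ℂ × Matrix (Fin p) (Fin p) ℂ → F}
    (hw : AEStronglyMeasurable w (lebDom m p)) :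
    ∫ ω, w (X ω) ∂P = ∫ x, jointDensity Ξ Sig n x • w x ∂lebDom m p := by
  have h1 : ∫ x, w x ∂(P.map X) = ∫ ω, w (X ω) ∂P :=
    integral_map hX.aemeasurable (hw.mono_ac hX.map_absolutelyContinuous)
  rw [← h1, hX.map_eq, integral_withDensity_eq_integral_toReal_smul
    (continuous_jointDensity Ξ Sig n).measurable.ennreal_ofReal
    (Eventually.of_forall fun x => ENNReal.ofReal_lt_top)]
  refine integral_congr_ae ?_
  rw [lebDom_eq]
  filter_upwards [ae_restrict_mem (measurable_snd measurableSet_posDef)] with x hx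
  rw [ENNReal.toReal_ofReal (jointDensity_pos hX.lt Ξ hX.posDef hx).le]

end JointLaw

variable {w : Matrix (Fin m) (Fin p) ℂ} {v : Matrix (Fin p) (Fin p) ℂ}
  {K : Set (Matrix (Fin m) (Fin p) ℂ × Matrix (Fin p) (Fin p) ℂ)}
  {κ κ' : Matrix (Fin m) (Fin p) ℂ × Matrix (Fin p) (Fin p) ℂ → ℝ}

/-- Integration by parts under the joint law, for real functions. -/
theorem JointLaw.integral_lineDeriv_mul_add_eq_zero (hX : JointLaw Ξ Sig n P X)
    (hv : v.IsHermitian)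
    {g : Matrix (Fin m) (Fin p) ℂ × Matrix (Fin p) (Fin p) ℂ → ℝ}
    (hm : AEMeasurable g (lebDom m p))
    (hg : ∀ᵐ x ∂lebDom m p, AbsContLine g (posDom m p) (w, v) x)
    (hκm : AEMeasurable κ (lebDom m p)) (hκ'm : AEMeasurable κ' (lebDom m p))
    (hF : LineTest (posDom m p) K (w, v) (fun x => jointDensity Ξ Sig n x * κ x)
      (fun x => jointDensity Ξ Sig n x * κ' x))
    (hgF : Integrable (fun ω => g (X ω) * κ (X ω)) P)
    (hw : Integrable (fun ω => lineDeriv ℝ g (X ω) (w, v) * κ (X ω) + g (X ω) * κ' (X ω)) P) :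
    ∫ ω, (lineDeriv ℝ g (X ω) (w, v) * κ (X ω) + g (X ω) * κ' (X ω)) ∂P = 0 := by
  have hμ := lineInvariant_prod w hv
  have hU := lineDomain_posDom w hv
  have hm' := hm
  have hg' := hg
  rw [lebDom_eq] at hm' hg'
  have hdm : AEMeasurable (fun x => lineDeriv ℝ g x (w, v)) (lebDom m p) := by
    rw [lebDom_eq]
    exact aemeasurable_lineDeriv hμ hU hm' (ae_lineDifferentiableAt hμ hU hm' hg')
  have hwm : AEStronglyMeasurable
      (fun x => lineDeriv ℝ g x (w, v) * κ x + g x * κ' x) (lebDom m p) :=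
    ((hdm.mul hκm).add (hm.mul hκ'm)).aestronglyMeasurable
  rw [hX.integral_comp hwm]
  have h1 := (hX.integrable_comp_iff hwm).1 hw
  have h2 := (hX.integrable_comp_iff (hm.mul hκm).aestronglyMeasurable).1 hgF
  -- κ and κ' are taken relative to the density: multiplied by it, they become the test function and
  -- its line derivative.
  have e1 : ∀ x, jointDensity Ξ Sig n x • (lineDeriv ℝ g x (w, v) * κ x + g x * κ' x) =
      lineDeriv ℝ g x (w, v) * (jointDensity Ξ Sig n x * κ x) +
        g x * (jointDensity Ξ Sig n x * κ' x) := fun x => by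
    rw [smul_eq_mul]; ring
  have e2 : ∀ x, jointDensity Ξ Sig n x • (g * κ) x = g x * (jointDensity Ξ Sig n x * κ x) :=
    fun x => by rw [smul_eq_mul, Pi.mul_apply]; ring
  simp only [e1] at h1 ⊢
  simp only [e2] at h2
  rw [lebDom_eq] at h1 h2 ⊢
  exact DirectionalCalculus.integral_lineDeriv_mul_add_eq_zero hμ hU hg' hF h2 h1

/-- Integration by parts under the joint law, for complex functions. -/
theorem JointLaw.integral_lineDeriv_mul_add_eq_zero_complex (hX : JointLaw Ξ Sig n P X)
    (hv : v.IsHermitian)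
    {g : Matrix (Fin m) (Fin p) ℂ × Matrix (Fin p) (Fin p) ℂ → ℂ}
    (hm : AEMeasurable g (lebDom m p))
    (hg : ∀ᵐ x ∂lebDom m p, AbsContLine g (posDom m p) (w, v) x)
    (hκm : AEMeasurable κ (lebDom m p)) (hκ'm : AEMeasurable κ' (lebDom m p))
    (hF : LineTest (posDom m p) K (w, v) (fun x => jointDensity Ξ Sig n x * κ x)
      (fun x => jointDensity Ξ Sig n x * κ' x))
    (hgF : Integrable (fun ω => g (X ω) * κ (X ω)) P)
    (hw : Integrable (fun ω => lineDeriv ℝ g (X ω) (w, v) * κ (X ω) + g (X ω) * κ' (X ω)) P) :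
    ∫ ω, (lineDeriv ℝ g (X ω) (w, v) * κ (X ω) + g (X ω) * κ' (X ω)) ∂P = 0 := by
  have hμ := lineInvariant_prod w hv
  have hU := lineDomain_posDom w hv
  have hm' := hm
  have hg' := hg
  rw [lebDom_eq] at hm' hg'
  have hdm : AEMeasurable (fun x => lineDeriv ℝ g x (w, v)) (lebDom m p) := by
    rw [lebDom_eq]
    exact aemeasurable_lineDeriv_complex hμ hU hm' hg'
  have hκc := measurable_ofReal.comp_aemeasurable hκm
  have hκ'c := measurable_ofReal.comp_aemeasurable hκ'm
  have hwm : AEStronglyMeasurable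
      (fun x => lineDeriv ℝ g x (w, v) * κ x + g x * κ' x) (lebDom m p) :=
    ((hdm.mul hκc).add (hm.mul hκ'c)).aestronglyMeasurable
  rw [hX.integral_comp hwm]
  have h1 := (hX.integrable_comp_iff hwm).1 hw
  have h2 := (hX.integrable_comp_iff (w := fun x => g x * κ x)
    (hm.mul hκc).aestronglyMeasurable).1 hgF
  have e1 : ∀ x, jointDensity Ξ Sig n x • (lineDeriv ℝ g x (w, v) * κ x + g x * κ' x) =
      lineDeriv ℝ g x (w, v) * ((jointDensity Ξ Sig n x * κ x : ℝ) : ℂ) +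
        g x * ((jointDensity Ξ Sig n x * κ' x : ℝ) : ℂ) := fun x => by
    rw [Complex.real_smul]; push_cast; ring
  have e2 : ∀ x, jointDensity Ξ Sig n x • (g x * κ x) =
      g x * ((jointDensity Ξ Sig n x * κ x : ℝ) : ℂ) :=
    fun x => by rw [Complex.real_smul]; push_cast; ring
  simp only [e1] at h1 ⊢
  simp only [e2] at h2
  rw [lebDom_eq] at h1 h2 ⊢
  exact DirectionalCalculus.integral_lineDeriv_mul_add_eq_zero_complex hμ hU hm' hg' hF h2 h1

end Law

end ComplexNormalMean

/-! ### Stein's identity for the normal matrix -/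

namespace ComplexNormalMean

open Filter Topology Set DirectionalCalculus

variable {m p n : ℕ} {Ξ : Matrix (Fin m) (Fin p) ℂ} {Sig : Matrix (Fin p) (Fin p) ℂ}

/-- The exponent of the normal density is a quadratic polynomial on every line. -/
theorem trace_quadratic_add_smul (hSig : Sig.IsHermitian) (y w : Matrix (Fin m) (Fin p) ℂ)
    (t : ℝ) : ((y + t • w) * Sig⁻¹ * (y + t • w)ᴴ).trace.re =
      (y * Sig⁻¹ * yᴴ).trace.re + t * (2 * (w * Sig⁻¹ * yᴴ).trace.re) +
        t ^ 2 * (w * Sig⁻¹ * wᴴ).trace.re := by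
  have h1 : (y * Sig⁻¹ * wᴴ).trace.re = (w * Sig⁻¹ * yᴴ).trace.re := by
    have : (y * Sig⁻¹ * wᴴ) = (w * Sig⁻¹ * yᴴ)ᴴ := by
      simp only [Matrix.conjTranspose_mul, Matrix.conjTranspose_conjTranspose,
        Matrix.conjTranspose_nonsing_inv, hSig.eq, Matrix.mul_assoc]
    rw [this, Matrix.trace_conjTranspose]
    simp
  simp only [Matrix.conjTranspose_add, Matrix.conjTranspose_smul, star_trivial, Matrix.add_mul,
    Matrix.mul_add, Matrix.smul_mul, Matrix.mul_smul, Matrix.trace_add, Matrix.trace_smul,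
    Complex.add_re, Complex.real_smul, Complex.re_ofReal_mul, h1]
  ring

theorem hasDerivAt_normalDensity (hSig : Sig.PosDef) (z w : Matrix (Fin m) (Fin p) ℂ) :
    HasDerivAt (fun t : ℝ => normalDensity Ξ Sig (z + t • w))
      (normalDensity Ξ Sig z * (-2 * (w * (Sig⁻¹ * (z - Ξ)ᴴ)).trace.re)) 0 := by
  have e : ∀ t : ℝ, normalDensity Ξ Sig (z + t • w) = (Real.pi ^ (m * p))⁻¹ * (Sig.det.re ^ m)⁻¹ *
      Real.exp (-(((z - Ξ) * Sig⁻¹ * (z - Ξ)ᴴ).trace.re +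
        t * (2 * (w * Sig⁻¹ * (z - Ξ)ᴴ).trace.re) + t ^ 2 * (w * Sig⁻¹ * wᴴ).trace.re)) := by
    intro t
    rw [← trace_quadratic_add_smul hSig.isHermitian, normalDensity,
      show z + t • w - Ξ = z - Ξ + t • w by abel]
  have h := (((((hasDerivAt_id (0 : ℝ)).mul_const (2 * (w * Sig⁻¹ * (z - Ξ)ᴴ).trace.re)).const_add
    (((z - Ξ) * Sig⁻¹ * (z - Ξ)ᴴ).trace.re)).add (((hasDerivAt_id (0 : ℝ)).pow 2).mul_const
      ((w * Sig⁻¹ * wᴴ).trace.re))).neg.exp).const_mul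
        ((Real.pi ^ (m * p))⁻¹ * (Sig.det.re ^ m)⁻¹)
  refine (h.congr_of_eventuallyEq (Eventually.of_forall e)).congr_deriv ?_
  simp [normalDensity, Matrix.mul_assoc]
  ring

/-- A direction (w, 0) leaves s fixed, so each line lies wholly inside the domain or misses it.
Hence the whole domain can serve as K, and no cutoff is needed. -/
theorem lineTest_normal (hSig : Sig.PosDef) (n : ℕ) (w : Matrix (Fin m) (Fin p) ℂ) :
    LineTest (posDom m p) (posDom m p) (w, 0) (fun x => jointDensity Ξ Sig n x * 1)
      (fun x => jointDensity Ξ Sig n x * (-2 * (w * (Sig⁻¹ * (x.1 - Ξ)ᴴ)).trace.re)) where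
  subset := Subset.rfl
  isClosed x := by
    have : {t : ℝ | x + t • (w, (0 : Matrix (Fin p) (Fin p) ℂ)) ∈ posDom m p} =
        {_t : ℝ | x.2.PosDef} := by
      ext t
      simp [posDom]
    rw [this]
    exact isClosed_const
  hasDerivAt x hx := by
    have h := (hasDerivAt_normalDensity (Ξ := Ξ) hSig x.1 w).mul_const (wishartDensity Sig n x.2)
    refine (h.congr_of_eventuallyEq (Eventually.of_forall fun t => ?_)).congr_deriv ?_
    · simp [jointDensity]
    · simp only [jointDensity]
      ring
  continuousOn x := by
    refine Continuous.continuousOn ?_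
    have h1 : Continuous fun x : Matrix (Fin m) (Fin p) ℂ × Matrix (Fin p) (Fin p) ℂ =>
        (w * (Sig⁻¹ * (x.1 - Ξ)ᴴ)).trace.re :=
      Complex.continuous_re.comp (Continuous.matrix_trace (by fun_prop))
    have h2 : Continuous fun x : Matrix (Fin m) (Fin p) ℂ × Matrix (Fin p) (Fin p) ℂ =>
        jointDensity Ξ Sig n x * (-2 * (w * (Sig⁻¹ * (x.1 - Ξ)ᴴ)).trace.re) :=
      (continuous_jointDensity Ξ Sig n).mul (continuous_const.mul h1)
    exact h2.comp (by fun_prop)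
  eq_zero x hx hx' := absurd hx hx'

/-- `x * exp (-x)` is dominated by `exp (-x / 2)`. -/
theorem mul_exp_neg_le (x : ℝ) : x * Real.exp (-x) ≤ 2 * Real.exp (-(x / 2)) := by
  have h1 : x ≤ 2 * Real.exp (x / 2) := by
    have := Real.add_one_le_exp (x / 2)
    linarith
  calc x * Real.exp (-x) ≤ 2 * Real.exp (x / 2) * Real.exp (-x) := by gcongr
    _ = 2 * Real.exp (-(x / 2)) := by
      rw [mul_assoc, ← Real.exp_add]
      congr 2
      ring

theorem frobSq_le_quadratic (hSig : Sig.PosDef) (y : Matrix (Fin m) (Fin p) ℂ) :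
    frobSq y ≤ Sig.trace.re * (y * Sig⁻¹ * yᴴ).trace.re := by
  have := frobSq_le_trace_mul y hSig
  rwa [Matrix.mul_assoc, Matrix.trace_mul_comm] at this

/-- The Gaussian weight on the space of matrices has finite second moments. -/
theorem integrable_frobSq_mul_exp (hSig : Sig.PosDef)
    (h : Integrable (normalDensity Ξ Sig) (lebMat m p)) :
    Integrable (fun z => normalDensity Ξ Sig z * frobSq (z - Ξ)) (lebMat m p) := by
  obtain ⟨q, hq⟩ : ∃ q : Matrix (Fin m) (Fin p) ℂ → ℝ, ∀ y, q y = (y * Sig⁻¹ * yᴴ).trace.re :=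
    ⟨_, fun _ => rfl⟩
  obtain ⟨c, hc⟩ : ∃ c : ℝ, c = (Real.pi ^ (m * p))⁻¹ * (Sig.det.re ^ m)⁻¹ := ⟨_, rfl⟩
  have hc0 : 0 < c := by
    have := (PosDef.det_re_pos hSig).1
    rw [hc]
    positivity
  have hqc : Continuous q := by
    rw [show q = fun y => (y * Sig⁻¹ * yᴴ).trace.re from funext hq]
    exact Complex.continuous_re.comp (Continuous.matrix_trace (by fun_prop))
  have hN : ∀ z, normalDensity Ξ Sig z = c * Real.exp (-q (z - Ξ)) := fun z => by
    rw [normalDensity, hq, hc]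
  rw [show normalDensity Ξ Sig = fun z => c * Real.exp (-q (z - Ξ)) from funext hN] at h ⊢
  rw [lebMat_eq] at h ⊢
  have h2 : Integrable (fun y : Fin m → Fin p → ℂ => c * Real.exp (-q (Matrix.of y)))
      volume := by
    have h' : Integrable (fun y : Fin m → Fin p → ℂ => c * Real.exp (-q (Matrix.of y - Ξ)))
        volume := h
    refine (h'.comp_add_right (Matrix.of.symm Ξ)).congr (Eventually.of_forall fun y => ?_)
    change c * Real.exp (-q (Matrix.of y + Ξ - Ξ)) = _
    rw [add_sub_cancel_right]
  -- Rescaling by 1/√2 halves the quadratic form q, so integrability of exp(-q) yields that of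
  -- exp(-q/2), which dominates q exp(-q).
  have h3 : Integrable (fun y : Fin m → Fin p → ℂ => c * Real.exp (-(q (Matrix.of y) / 2)))
      volume := by
    have : (volume : Measure (Fin m → Fin p → ℂ)).IsAddHaarMeasure :=
      Measure.pi.isAddHaarMeasure fun _ : Fin m => (volume : Measure (Fin p → ℂ))
    have h4 := (integrable_comp_smul_iff (volume : Measure (Fin m → Fin p → ℂ))
      (fun y : Fin m → Fin p → ℂ => c * Real.exp (-q (Matrix.of y))) (R := (Real.sqrt 2)⁻¹)
      (by positivity)).2 h2
    refine h4.congr (Eventually.of_forall fun y => ?_)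
    have e : q (Matrix.of ((Real.sqrt 2)⁻¹ • y)) = q (Matrix.of y) / 2 := by
      have := trace_quadratic_add_smul hSig.isHermitian 0 (Matrix.of y) (Real.sqrt 2)⁻¹
      simp only [zero_add, Matrix.conjTranspose_zero, Matrix.mul_zero, Matrix.zero_mul,
        Matrix.trace_zero, Complex.zero_re, mul_zero, inv_pow, Real.sq_sqrt zero_le_two] at this
      rw [hq, hq]
      exact this.trans (by ring)
    simp only [e]
  have h5 : Integrable (fun y : Fin m → Fin p → ℂ =>
      c * Real.exp (-q (Matrix.of y)) * frobSq (Matrix.of y)) volume := by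
    refine (h3.const_mul (Sig.trace.re * 2)).mono' (Continuous.aestronglyMeasurable ?_)
      (Eventually.of_forall fun y => ?_)
    · have hof : Continuous fun y : Fin m → Fin p → ℂ => Matrix.of y := continuous_id
      unfold frobSq
      simp only [Matrix.of_apply]
      exact (continuous_const.mul (Real.continuous_exp.comp (hqc.comp hof).neg)).mul
        (by fun_prop)
    · have hS : 0 ≤ Sig.trace.re := (Complex.nonneg_iff.1 hSig.posSemidef.trace_nonneg).1
      have hb := frobSq_le_quadratic hSig (Matrix.of y)
      rw [← hq] at hb
      have hf := frobSq_nonneg (Matrix.of y)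
      rw [Real.norm_of_nonneg (by positivity)]
      calc c * Real.exp (-q (Matrix.of y)) * frobSq (Matrix.of y)
          ≤ c * Real.exp (-q (Matrix.of y)) * (Sig.trace.re * q (Matrix.of y)) := by gcongr
        _ = c * Sig.trace.re * (q (Matrix.of y) * Real.exp (-q (Matrix.of y))) := by ring
        _ ≤ c * Sig.trace.re * (2 * Real.exp (-(q (Matrix.of y) / 2))) :=
          mul_le_mul_of_nonneg_left (mul_exp_neg_le _) (by positivity)
        _ = _ := by ring
  exact h5.comp_sub_right (Matrix.of.symm Ξ)

/-- No Gaussian integral is computed: integrability of the density follows from the law having total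
mass one. -/
theorem complexNormal_integrable_frobSq (hSig : Sig.PosDef)
    [IsProbabilityMeasure (complexNormal Ξ Sig)] :
    Integrable (fun z => frobSq (z - Ξ)) (complexNormal Ξ Sig) := by
  have hm : Measurable fun z => ENNReal.ofReal (normalDensity Ξ Sig z) :=
    (continuous_normalDensity Ξ Sig).measurable.ennreal_ofReal
  have h1 : Integrable (normalDensity Ξ Sig) (lebMat m p) := by
    refine ⟨(continuous_normalDensity Ξ Sig).aestronglyMeasurable, ?_⟩
    rw [hasFiniteIntegral_iff_ofReal (Eventually.of_forall fun z => (normalDensity_pos Ξ hSig z).le)]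
    have : ∫⁻ z, ENNReal.ofReal (normalDensity Ξ Sig z) ∂lebMat m p = 1 := by
      rw [← setLIntegral_univ, ← withDensity_apply _ MeasurableSet.univ]
      exact measure_univ (μ := complexNormal Ξ Sig)
    rw [this]
    exact ENNReal.one_lt_top
  rw [complexNormal, integrable_withDensity_iff_integrable_smul' hm
    (Eventually.of_forall fun z => ENNReal.ofReal_lt_top)]
  refine (integrable_frobSq_mul_exp hSig h1).congr (Eventually.of_forall fun z => ?_)
  simp only [ENNReal.toReal_ofReal (normalDensity_pos Ξ hSig z).le, smul_eq_mul]

theorem memLp_two_of_integrable_frobSq {Ω : Type*} [MeasurableSpace Ω] {P : Measure Ω}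
    {A : Ω → Matrix (Fin m) (Fin p) ℂ} (hA : ∀ i j, AEStronglyMeasurable (fun ω => A ω i j) P)
    (h : Integrable (fun ω => frobSq (A ω)) P) (i : Fin m) (j : Fin p) :
    MemLp (fun ω => A ω i j) 2 P := by
  rw [memLp_two_iff_integrable_sq_norm (hA i j)]
  refine h.mono' ((hA i j).norm.pow 2) (Eventually.of_forall fun ω => ?_)
  rw [Real.norm_of_nonneg (by positivity)]
  calc ‖A ω i j‖ ^ 2 ≤ ∑ j, ‖A ω i j‖ ^ 2 :=
        Finset.single_le_sum (f := fun j => ‖A ω i j‖ ^ 2) (fun _ _ => by positivity)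
          (Finset.mem_univ j)
    _ ≤ frobSq (A ω) :=
        Finset.single_le_sum (f := fun i => ∑ j, ‖A ω i j‖ ^ 2)
          (fun _ _ => Finset.sum_nonneg fun _ _ => by positivity) (Finset.mem_univ i)

section Stein

variable {Ω : Type*} [MeasurableSpace Ω] {P : Measure Ω}
  {X : Ω → Matrix (Fin m) (Fin p) ℂ × Matrix (Fin p) (Fin p) ℂ}

/-- Stein's identity in one real coordinate of the normal matrix. -/
theorem JointLaw.integral_lineDeriv_normal (hX : JointLaw Ξ Sig n P X)
    (w : Matrix (Fin m) (Fin p) ℂ)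
    {g : Matrix (Fin m) (Fin p) ℂ × Matrix (Fin p) (Fin p) ℂ → ℝ}
    (hm : AEMeasurable g (lebDom m p))
    (hg : ∀ᵐ x ∂lebDom m p, AbsContLine g (posDom m p) (w, 0) x)
    (hgi : Integrable (fun ω => g (X ω)) P)
    (hd : Integrable (fun ω => lineDeriv ℝ g (X ω) (w, 0)) P)
    (hs : Integrable (fun ω => g (X ω) * (w * (Sig⁻¹ * ((X ω).1 - Ξ)ᴴ)).trace.re) P) :
    ∫ ω, lineDeriv ℝ g (X ω) (w, 0) ∂P =
      2 * ∫ ω, g (X ω) * (w * (Sig⁻¹ * ((X ω).1 - Ξ)ᴴ)).trace.re ∂P := by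
  have hκ' : Continuous fun x : Matrix (Fin m) (Fin p) ℂ × Matrix (Fin p) (Fin p) ℂ =>
      -2 * (w * (Sig⁻¹ * (x.1 - Ξ)ᴴ)).trace.re :=
    continuous_const.mul (Complex.continuous_re.comp (Continuous.matrix_trace (by fun_prop)))
  have e : ∀ ω, g (X ω) * (-2 * (w * (Sig⁻¹ * ((X ω).1 - Ξ)ᴴ)).trace.re) =
      -2 * (g (X ω) * (w * (Sig⁻¹ * ((X ω).1 - Ξ)ᴴ)).trace.re) := fun ω => by ring
  have h := hX.integral_lineDeriv_mul_add_eq_zero (w := w) (v := 0) isHermitian_zero hm hg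
    (κ := fun _ => 1) aemeasurable_const hκ'.measurable.aemeasurable
    (lineTest_normal hX.posDef n w) (by simpa using hgi)
    (by simp only [mul_one, e]; exact hd.add (hs.const_mul _))
  simp only [mul_one, e] at h
  rw [integral_add hd (hs.const_mul _), integral_const_mul] at h
  linarith

theorem trace_reDir_mul (i : Fin m) (j : Fin p) (A : Matrix (Fin p) (Fin m) ℂ) :
    (reDir i j * A).trace.re = (A j i).re := by
  simp [reDir, Matrix.trace_single_mul]

theorem trace_imDir_mul (i : Fin m) (j : Fin p) (A : Matrix (Fin p) (Fin m) ℂ) :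
    (imDir i j * A).trace.re = -(A j i).im := by
  simp [imDir, Matrix.trace_single_mul]

/-- Stein's identity for the normal matrix. -/
theorem JointLaw.integral_trace_normal [IsFiniteMeasure P] (hX : JointLaw Ξ Sig n P X)
    (hZ2 : Integrable (fun ω => frobSq ((X ω).1 - Ξ)) P)
    {G : Matrix (Fin m) (Fin p) ℂ × Matrix (Fin p) (Fin p) ℂ → Matrix (Fin m) (Fin p) ℂ}
    (hm : ∀ i j, AEMeasurable (fun x => G x i j) (lebDom m p))
    (hre : ∀ i j, ∀ᵐ x ∂lebDom m p,
      AbsContLine (fun x => G x i j) (posDom m p) (reDir i j, 0) x)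
    (him : ∀ i j, ∀ᵐ x ∂lebDom m p,
      AbsContLine (fun x => G x i j) (posDom m p) (imDir i j, 0) x)
    (hG2 : Integrable (fun ω => frobSq (G (X ω))) P)
    (hdre : ∀ i j, Integrable (fun ω =>
      lineDeriv ℝ (fun x => (G x i j).re) (X ω) (reDir i j, 0)) P)
    (hdim : ∀ i j, Integrable (fun ω =>
      lineDeriv ℝ (fun x => (G x i j).im) (X ω) (imDir i j, 0)) P) :
    Integrable (fun ω => (Sig⁻¹ * ((X ω).1 - Ξ)ᴴ * G (X ω)).trace.re) P ∧
    2 * ∫ ω, (Sig⁻¹ * ((X ω).1 - Ξ)ᴴ * G (X ω)).trace.re ∂P =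
      ∑ i, ∑ j, (∫ ω, lineDeriv ℝ (fun x => (G x i j).re) (X ω) (reDir i j, 0) ∂P +
        ∫ ω, lineDeriv ℝ (fun x => (G x i j).im) (X ω) (imDir i j, 0) ∂P) := by
  obtain ⟨A, hA⟩ : ∃ A : Ω → Matrix (Fin p) (Fin m) ℂ, ∀ ω, Sig⁻¹ * ((X ω).1 - Ξ)ᴴ = A ω :=
    ⟨_, fun _ => rfl⟩
  have hGL : ∀ i j, MemLp (fun ω => G (X ω) i j) 2 P := fun i j =>
    memLp_two_of_integrable_frobSq
      (fun i j => hX.aestronglyMeasurable_comp (hm i j).aestronglyMeasurable) hG2 i j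
  have hZL : ∀ i j, MemLp (fun ω => ((X ω).1 - Ξ) i j) 2 P := fun i j => by
    refine memLp_two_of_integrable_frobSq (fun i j => ?_) hZ2 i j
    refine hX.aestronglyMeasurable_comp (w := fun x => (x.1 - Ξ) i j)
      (Continuous.aestronglyMeasurable ?_)
    simp only [Matrix.sub_apply]
    fun_prop
  have hAL : ∀ j i, MemLp (fun ω => A ω j i) 2 P := fun j i => by
    simp only [← hA, Matrix.mul_apply, Matrix.conjTranspose_apply]
    refine memLp_finsetSum _ fun k _ => MemLp.const_mul ?_ _
    exact (hZL i k).star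
  have hrr : ∀ i j, Integrable (fun ω => (G (X ω) i j).re * (A ω j i).re) P := fun i j =>
    (hGL i j).re.integrable_mul (hAL j i).re
  have hii : ∀ i j, Integrable (fun ω => (G (X ω) i j).im * (A ω j i).im) P := fun i j =>
    (hGL i j).im.integrable_mul (hAL j i).im
  -- The real part of the trace pairs Re g_ij with the direction Re z_ij and Im g_ij with Im z_ij,
  -- so only these two families of derivatives occur.
  have hsum : ∀ ω, (A ω * G (X ω)).trace.re =
      ∑ i, ∑ j, ((G (X ω) i j).re * (A ω j i).re - (G (X ω) i j).im * (A ω j i).im) := by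
    intro ω
    simp only [Matrix.trace, Matrix.diag_apply, Matrix.mul_apply, Complex.re_sum, Complex.mul_re]
    rw [Finset.sum_comm]
    exact Finset.sum_congr rfl fun i _ => Finset.sum_congr rfl fun j _ => by ring
  have h1 : ∀ i j, ∫ ω, lineDeriv ℝ (fun x => (G x i j).re) (X ω) (reDir i j, 0) ∂P =
      2 * ∫ ω, (G (X ω) i j).re * (A ω j i).re ∂P := fun i j => by
    have := hX.integral_lineDeriv_normal (reDir i j) (g := fun x => (G x i j).re)
      (measurable_re.comp_aemeasurable (hm i j))
      ((hre i j).mono fun x hx => hx.re) ((hGL i j).re.integrable (by norm_num)) (hdre i j)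
      (by simpa only [hA, trace_reDir_mul] using hrr i j)
    simpa only [hA, trace_reDir_mul] using this
  have h2 : ∀ i j, ∫ ω, lineDeriv ℝ (fun x => (G x i j).im) (X ω) (imDir i j, 0) ∂P =
      2 * -∫ ω, (G (X ω) i j).im * (A ω j i).im ∂P := fun i j => by
    have := hX.integral_lineDeriv_normal (imDir i j) (g := fun x => (G x i j).im)
      (measurable_im.comp_aemeasurable (hm i j))
      ((him i j).mono fun x hx => hx.im) ((hGL i j).im.integrable (by norm_num)) (hdim i j)
      (by simpa only [hA, trace_imDir_mul, mul_neg] using (hii i j).fun_neg)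
    simpa only [hA, trace_imDir_mul, mul_neg, integral_neg] using this
  simp only [hA, hsum, h1, h2]
  refine ⟨integrable_finsetSum _ fun i _ => integrable_finsetSum _ fun j _ =>
    (hrr i j).sub' (hii i j), ?_⟩
  rw [integral_finsetSum _ fun i _ => integrable_finsetSum _ fun j _ => (hrr i j).sub' (hii i j),
    Finset.mul_sum]
  refine Finset.sum_congr rfl fun i _ => ?_
  rw [integral_finsetSum _ fun j _ => (hrr i j).sub' (hii i j), Finset.mul_sum]
  refine Finset.sum_congr rfl fun j _ => ?_
  rw [integral_sub (hrr i j) (hii i j)]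
  ring

/-- The expected loss of the estimator `Z`. -/
theorem JointLaw.integral_loss_normal [IsProbabilityMeasure P] (hX : JointLaw Ξ Sig n P X)
    (hZ2 : Integrable (fun ω => frobSq ((X ω).1 - Ξ)) P) :
    Integrable (fun ω => (Sig⁻¹ * ((X ω).1 - Ξ)ᴴ * ((X ω).1 - Ξ)).trace.re) P ∧
    ∫ ω, (Sig⁻¹ * ((X ω).1 - Ξ)ᴴ * ((X ω).1 - Ξ)).trace.re ∂P = m * p := by
  have hac : ∀ (i : Fin m) (j : Fin p) (w : Matrix (Fin m) (Fin p) ℂ)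
      (x : Matrix (Fin m) (Fin p) ℂ × Matrix (Fin p) (Fin p) ℂ),
      AbsContLine (fun x : Matrix (Fin m) (Fin p) ℂ × Matrix (Fin p) (Fin p) ℂ => (x.1 - Ξ) i j)
        (posDom m p) (w, 0) x := fun i j w x a b _ => by
    refine ContDiffOn.absolutelyContinuousOnInterval (ContDiff.contDiffOn ?_)
    simp only [Prod.fst_add, Prod.smul_fst, Matrix.sub_apply, Matrix.add_apply, Matrix.smul_apply]
    fun_prop
  have hd1 : ∀ (i : Fin m) (j : Fin p) (x : Matrix (Fin m) (Fin p) ℂ × Matrix (Fin p) (Fin p) ℂ),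
      lineDeriv ℝ (fun x => ((x.1 - Ξ) i j).re) x (reDir i j, 0) = 1 := fun i j x => by
    refine HasLineDerivAt.lineDeriv ?_
    have h := (hasDerivAt_id (0 : ℝ)).const_add ((x.1 - Ξ) i j).re
    refine h.congr_of_eventuallyEq (Eventually.of_forall fun t => ?_)
    simp [reDir]
    ring
  have hd2 : ∀ (i : Fin m) (j : Fin p) (x : Matrix (Fin m) (Fin p) ℂ × Matrix (Fin p) (Fin p) ℂ),
      lineDeriv ℝ (fun x => ((x.1 - Ξ) i j).im) x (imDir i j, 0) = 1 := fun i j x => by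
    refine HasLineDerivAt.lineDeriv ?_
    have h := (hasDerivAt_id (0 : ℝ)).const_add ((x.1 - Ξ) i j).im
    refine h.congr_of_eventuallyEq (Eventually.of_forall fun t => ?_)
    simp [imDir]
    ring
  -- Stein's identity with G = Z - Ξ: each of the 2mp derivatives equals 1, and twice the expected
  -- loss is their sum.
  have h := hX.integral_trace_normal hZ2 (G := fun x => x.1 - Ξ)
    (fun i j => by
      refine (Continuous.measurable ?_).aemeasurable
      simp only [Matrix.sub_apply]
      fun_prop)
    (fun i j => Eventually.of_forall (hac i j _)) (fun i j => Eventually.of_forall (hac i j _))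
    hZ2 (fun i j => by simp only [hd1]; exact integrable_const _)
    (fun i j => by simp only [hd2]; exact integrable_const _)
  refine ⟨h.1, ?_⟩
  have h2 := h.2
  simp only [hd1, hd2, integral_const, probReal_univ, smul_eq_mul, mul_one, Finset.sum_const,
    Finset.card_univ, Fintype.card_fin, nsmul_eq_mul] at h2
  linarith

end Stein

end ComplexNormalMean

/-! ### The cutoff of the Wishart density -/

namespace ComplexNormalMean

open Filter Topology Set DirectionalCalculus

variable {m p n : ℕ} {Ξ : Matrix (Fin m) (Fin p) ℂ} {Sig : Matrix (Fin p) (Fin p) ℂ}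

/-- Squaring the positive part makes it continuously differentiable, which is why both cutoffs enter
squared. -/
theorem hasDerivAt_posPart_sq (y : ℝ) :
    HasDerivAt (fun y : ℝ => max y 0 ^ 2) (2 * max y 0) y := by
  rcases lt_trichotomy y 0 with h | h | h
  · rw [max_eq_right h.le, mul_zero]
    refine (hasDerivAt_const y (0 : ℝ)).congr_of_eventuallyEq ?_
    filter_upwards [eventually_lt_nhds h] with z hz
    rw [max_eq_right hz.le]
    norm_num
  · subst h
    rw [max_self, mul_zero, hasDerivAt_iff_isLittleO]
    have h1 : (fun z : ℝ => max z 0 ^ 2 - max (0 : ℝ) 0 ^ 2 - (z - 0) • (0 : ℝ)) =O[𝓝 0]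
        fun z : ℝ => z ^ 2 := by
      refine Asymptotics.IsBigO.of_bound 1 (Eventually.of_forall fun z => ?_)
      have h : max z 0 ^ 2 ≤ |z| ^ 2 :=
        pow_le_pow_left₀ (le_max_right z 0) (max_le (le_abs_self z) (abs_nonneg z)) 2
      simpa using h
    refine h1.trans_isLittleO ?_
    simpa using Asymptotics.isLittleO_pow_id (𝕜 := ℝ) (n := 2) (by norm_num)
  · rw [max_eq_left h.le]
    have h1 : HasDerivAt (fun y : ℝ => y ^ 2) (2 * y) y := by simpa using hasDerivAt_pow 2 y
    refine h1.congr_of_eventuallyEq ?_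
    filter_upwards [eventually_gt_nhds h] with z hz
    rw [max_eq_left hz.le]

/-- Cutoff away from the singular matrices. -/
noncomputable def cutDet (N : ℝ) (s : Matrix (Fin p) (Fin p) ℂ) : ℝ :=
  max (1 - (N * s.det.re)⁻¹) 0

/-- Cutoff away from infinity. -/
noncomputable def cutTr (Sig : Matrix (Fin p) (Fin p) ℂ) (N : ℝ)
    (s : Matrix (Fin p) (Fin p) ℂ) : ℝ :=
  max (1 - (s * Sig⁻¹).trace.re / N) 0

/-- The compactly supported factor which approximates `1`. -/
noncomputable def cutoff (Sig : Matrix (Fin p) (Fin p) ℂ) (N : ℝ)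
    (s : Matrix (Fin p) (Fin p) ℂ) : ℝ :=
  cutDet N s ^ 2 * cutTr Sig N s ^ 2

/-- The factor of `Tr (S⁻¹ v)` in the derivative of the truncated Wishart density. -/
noncomputable def detCoeff (Sig : Matrix (Fin p) (Fin p) ℂ) (q : ℕ) (N : ℝ)
    (s : Matrix (Fin p) (Fin p) ℂ) : ℝ :=
  q * cutoff Sig N s + 2 * cutDet N s * (N * s.det.re)⁻¹ * cutTr Sig N s ^ 2

/-- The factor of `-Tr (v Σ⁻¹)` in the derivative of the truncated Wishart density. -/
noncomputable def trCoeff (Sig : Matrix (Fin p) (Fin p) ℂ) (N : ℝ)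
    (s : Matrix (Fin p) (Fin p) ℂ) : ℝ :=
  cutoff Sig N s + cutDet N s ^ 2 * (2 / N * cutTr Sig N s)

/-- The derivative of the truncated Wishart density, relative to the Wishart density. -/
noncomputable def scoreCut (Sig : Matrix (Fin p) (Fin p) ℂ) (q : ℕ) (N : ℝ)
    (v s : Matrix (Fin p) (Fin p) ℂ) : ℝ :=
  (s⁻¹ * v).trace.re * detCoeff Sig q N s - (Sig⁻¹ * v).trace.re * trCoeff Sig N s

/-- Scalar form of the score computation: along a line, d is the determinant with logarithmic
derivative τ, x is Tr(sΣ⁻¹) with derivative ξ, and k + 1 = n - p. -/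
theorem hasDerivAt_truncated {d x : ℝ → ℝ} {τ ξ N : ℝ} (k : ℕ) (hN : 0 < N) (hd0 : 0 < d 0)
    (hd : HasDerivAt d (d 0 * τ) 0) (hx : HasDerivAt x ξ 0) :
    HasDerivAt (fun t => d t ^ (k + 1) * Real.exp (-x t) *
        (max (1 - (N * d t)⁻¹) 0 ^ 2 * max (1 - x t / N) 0 ^ 2))
      (d 0 ^ (k + 1) * Real.exp (-x 0) *
        (τ * (((k + 1 : ℕ) : ℝ) * (max (1 - (N * d 0)⁻¹) 0 ^ 2 * max (1 - x 0 / N) 0 ^ 2) +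
          2 * max (1 - (N * d 0)⁻¹) 0 * (N * d 0)⁻¹ * max (1 - x 0 / N) 0 ^ 2) -
        ξ * (max (1 - (N * d 0)⁻¹) 0 ^ 2 * max (1 - x 0 / N) 0 ^ 2 +
          max (1 - (N * d 0)⁻¹) 0 ^ 2 * (2 / N * max (1 - x 0 / N) 0)))) 0 := by
  have h1 := hd.pow (k + 1)
  have h2 := hx.neg.exp
  have h3 : HasDerivAt (fun t => max (1 - (N * d t)⁻¹) 0 ^ 2)
      (2 * max (1 - (N * d 0)⁻¹) 0 * ((N * d 0)⁻¹ * τ)) 0 := by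
    have h := ((hd.const_mul N).inv (by positivity)).const_sub 1
    have := HasDerivAt.comp (0 : ℝ) (hasDerivAt_posPart_sq (1 - (N * d 0)⁻¹)) h
    refine this.congr_deriv ?_
    field_simp
  have h4 : HasDerivAt (fun t => max (1 - x t / N) 0 ^ 2)
      (2 * max (1 - x 0 / N) 0 * (-(ξ / N))) 0 := by
    have h := (hx.div_const N).const_sub 1
    exact HasDerivAt.comp (0 : ℝ) (hasDerivAt_posPart_sq (1 - x 0 / N)) h
  refine ((h1.mul h2).mul (h3.mul h4)).congr_deriv ?_
  simp only [Pi.mul_apply, Pi.pow_apply, Pi.neg_apply, Nat.add_sub_cancel]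
  generalize max (1 - (N * d 0)⁻¹) 0 = A
  generalize max (1 - x 0 / N) 0 = B
  field_simp
  ring

theorem hasDerivAt_wishartDensity_mul_cutoff (hn : p < n) {N : ℝ} (hN : 0 < N)
    {s : Matrix (Fin p) (Fin p) ℂ} (hs : s.PosDef) (v : Matrix (Fin p) (Fin p) ℂ) :
    HasDerivAt (fun t : ℝ => wishartDensity Sig n (s + t • v) * cutoff Sig N (s + t • v))
      (wishartDensity Sig n s * scoreCut Sig (n - p) N v s) 0 := by
  obtain ⟨k, hk⟩ : ∃ k, n - p = k + 1 := ⟨n - p - 1, by omega⟩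
  have hx : HasDerivAt (fun t : ℝ => ((s + t • v) * Sig⁻¹).trace.re) (Sig⁻¹ * v).trace.re 0 := by
    have h := ((hasDerivAt_id (0 : ℝ)).mul_const (Sig⁻¹ * v).trace.re).const_add
      (s * Sig⁻¹).trace.re
    rw [one_mul] at h
    refine h.congr_of_eventuallyEq (Eventually.of_forall fun t => ?_)
    rw [Matrix.trace_mul_comm Sig⁻¹ v]
    simp only [Matrix.add_mul, Matrix.smul_mul, Matrix.trace_add, Matrix.trace_smul,
      Complex.add_re, Complex.real_smul, Complex.re_ofReal_mul, id]
  have h := hasDerivAt_truncated k hN (d := fun t : ℝ => (s + t • v).det.re) (τ := (s⁻¹ * v).trace.re)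
    (by simpa using (PosDef.det_re_pos hs).1) (by simpa using hasDerivAt_det_re_add_smul hs v) hx
  have h2 := h.div_const (Sig.det.re ^ n * Real.pi ^ (p * (p - 1) / 2)
        * ∏ k ∈ Finset.Icc 1 p, Real.Gamma ((n : ℝ) + 1 - (k : ℝ)))
  refine (h2.congr_of_eventuallyEq (Eventually.of_forall fun t => ?_)).congr_deriv ?_
  · simp only [wishartDensity, cutoff, cutDet, cutTr, hk]
    ring
  · simp only [wishartDensity, scoreCut, detCoeff, trCoeff, cutoff, cutDet, cutTr, hk, zero_smul,
      add_zero]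
    ring

theorem cutDet_nonneg (N : ℝ) (s : Matrix (Fin p) (Fin p) ℂ) : 0 ≤ cutDet N s := le_max_right _ _

theorem cutTr_nonneg (N : ℝ) (s : Matrix (Fin p) (Fin p) ℂ) : 0 ≤ cutTr Sig N s := le_max_right _ _

theorem cutDet_le_one {N : ℝ} (hN : 0 < N) {s : Matrix (Fin p) (Fin p) ℂ} (hs : s.PosDef) :
    cutDet N s ≤ 1 := by
  have := (PosDef.det_re_pos hs).1
  have : 0 ≤ (N * s.det.re)⁻¹ := by positivity
  exact max_le (by linarith) zero_le_one

theorem cutTr_le_one (hSig : Sig.PosDef) {N : ℝ} (hN : 0 < N) {s : Matrix (Fin p) (Fin p) ℂ}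
    (hs : s.PosDef) : cutTr Sig N s ≤ 1 := by
  have h1 := (Complex.nonneg_iff.1
    (trace_mul_nonneg_of_posSemidef hs.posSemidef hSig.inv.posSemidef)).1
  have : 0 ≤ (s * Sig⁻¹).trace.re / N := by positivity
  exact max_le (by linarith) zero_le_one

/-- Where the cutoff is nonzero, N det s exceeds 1. Hence differentiating the cutoff adds to the
coefficient of Tr(s⁻¹v) a term bounded independently of N, as dominated convergence requires. -/
theorem cutDet_mul_inv_le_one {N : ℝ} (hN : 0 < N) {s : Matrix (Fin p) (Fin p) ℂ}
    (hs : s.PosDef) : cutDet N s * (N * s.det.re)⁻¹ ≤ 1 := by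
  have h0 := (PosDef.det_re_pos hs).1
  have h1 : 0 ≤ (N * s.det.re)⁻¹ := by positivity
  rcases le_total (1 - (N * s.det.re)⁻¹) 0 with h | h
  · rw [cutDet, max_eq_right h, zero_mul]
    exact zero_le_one
  · exact mul_le_one₀ (cutDet_le_one hN hs) h1 (by linarith)

theorem cutoff_nonneg (N : ℝ) (s : Matrix (Fin p) (Fin p) ℂ) : 0 ≤ cutoff Sig N s := by
  unfold cutoff
  positivity

theorem cutoff_le_one (hSig : Sig.PosDef) {N : ℝ} (hN : 0 < N) {s : Matrix (Fin p) (Fin p) ℂ}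
    (hs : s.PosDef) : cutoff Sig N s ≤ 1 :=
  mul_le_one₀ (pow_le_one₀ (cutDet_nonneg N s) (cutDet_le_one hN hs)) (by positivity)
    (pow_le_one₀ (cutTr_nonneg N s) (cutTr_le_one hSig hN hs))

theorem abs_detCoeff_le (hSig : Sig.PosDef) (q : ℕ) {N : ℝ} (hN : 0 < N)
    {s : Matrix (Fin p) (Fin p) ℂ} (hs : s.PosDef) : |detCoeff Sig q N s| ≤ q + 2 := by
  have h0 := (PosDef.det_re_pos hs).1
  have h1 := cutDet_nonneg N s
  have h2 := cutoff_nonneg (Sig := Sig) N s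
  have h3 : cutTr Sig N s ^ 2 ≤ 1 := pow_le_one₀ (cutTr_nonneg N s) (cutTr_le_one hSig hN hs)
  have h4 : cutDet N s * (N * s.det.re)⁻¹ * cutTr Sig N s ^ 2 ≤ 1 :=
    mul_le_one₀ (cutDet_mul_inv_le_one hN hs) (by positivity) h3
  have h5 : (q : ℝ) * cutoff Sig N s ≤ q * 1 := by
    gcongr
    exact cutoff_le_one hSig hN hs
  rw [abs_of_nonneg (by unfold detCoeff; positivity), detCoeff]
  nlinarith

theorem trCoeff_nonneg {N : ℝ} (hN : 0 < N) (s : Matrix (Fin p) (Fin p) ℂ) :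
    0 ≤ trCoeff Sig N s := by
  have h1 := cutTr_nonneg (Sig := Sig) N s
  have h2 := cutoff_nonneg (Sig := Sig) N s
  unfold trCoeff
  positivity

theorem trCoeff_le (hSig : Sig.PosDef) {N : ℝ} (hN : 1 ≤ N)
    {s : Matrix (Fin p) (Fin p) ℂ} (hs : s.PosDef) : trCoeff Sig N s ≤ 3 := by
  have hN0 : 0 < N := by linarith
  have h1 := cutTr_nonneg (Sig := Sig) N s
  have h2 : cutTr Sig N s ≤ 1 := cutTr_le_one hSig hN0 hs
  have h3 : cutDet N s ^ 2 ≤ 1 := pow_le_one₀ (cutDet_nonneg N s) (cutDet_le_one hN0 hs)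
  have h4 : 2 / N ≤ 2 := div_le_self (by norm_num) hN
  have h5 : 2 / N * cutTr Sig N s ≤ 2 * 1 := mul_le_mul h4 h2 h1 (by norm_num)
  have h6 : cutDet N s ^ 2 * (2 / N * cutTr Sig N s) ≤ 1 * (2 * 1) :=
    mul_le_mul h3 h5 (by positivity) (by norm_num)
  have := cutoff_le_one hSig hN0 hs
  unfold trCoeff
  linarith

theorem tendsto_cutoff (s : Matrix (Fin p) (Fin p) ℂ) :
    Tendsto (fun k : ℕ => cutDet ((k : ℝ) + 1) s) atTop (𝓝 1) ∧
      Tendsto (fun k : ℕ => cutTr Sig ((k : ℝ) + 1) s) atTop (𝓝 1) ∧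
      Tendsto (fun k : ℕ => (((k : ℝ) + 1) * s.det.re)⁻¹) atTop (𝓝 0) ∧
      Tendsto (fun k : ℕ => 2 / ((k : ℝ) + 1)) atTop (𝓝 0) := by
  have h0 : Tendsto (fun k : ℕ => ((k : ℝ) + 1)⁻¹) atTop (𝓝 0) := by
    simpa using tendsto_one_div_add_atTop_nhds_zero_nat (𝕜 := ℝ)
  have h1 : Tendsto (fun k : ℕ => (((k : ℝ) + 1) * s.det.re)⁻¹) atTop (𝓝 0) := by
    simp only [mul_inv]
    simpa using h0.mul_const (s.det.re)⁻¹
  have hmax : Tendsto (fun y : ℝ => max y 0) (𝓝 (1 - 0)) (𝓝 1) := by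
    have : Continuous fun y : ℝ => max y 0 := by fun_prop
    simpa using this.tendsto (1 - 0)
  refine ⟨hmax.comp (h1.const_sub 1), hmax.comp ?_, h1, ?_⟩
  · refine Tendsto.const_sub 1 ?_
    simp only [div_eq_mul_inv]
    simpa using h0.const_mul (s * Sig⁻¹).trace.re
  · simp only [div_eq_mul_inv]
    simpa using h0.const_mul 2

theorem tendsto_coeffs (q : ℕ) (s : Matrix (Fin p) (Fin p) ℂ) :
    Tendsto (fun k : ℕ => cutoff Sig ((k : ℝ) + 1) s) atTop (𝓝 1) ∧
      Tendsto (fun k : ℕ => detCoeff Sig q ((k : ℝ) + 1) s) atTop (𝓝 q) ∧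
      Tendsto (fun k : ℕ => trCoeff Sig ((k : ℝ) + 1) s) atTop (𝓝 1) := by
  obtain ⟨h1, h2, h3, h4⟩ := tendsto_cutoff (Sig := Sig) s
  have hc : Tendsto (fun k : ℕ => cutoff Sig ((k : ℝ) + 1) s) atTop (𝓝 1) := by
    simpa [cutoff] using (h1.pow 2).mul (h2.pow 2)
  refine ⟨hc, ?_, ?_⟩
  · simpa [detCoeff] using (hc.const_mul (q : ℝ)).add (((h1.const_mul 2).mul h3).mul (h2.pow 2))
  · simpa [trCoeff] using hc.add ((h1.pow 2).mul (h4.mul h2))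

theorem continuousOn_coeffs (q : ℕ) {N : ℝ} (hN : 0 < N) :
    ContinuousOn (cutoff Sig N) {s : Matrix (Fin p) (Fin p) ℂ | s.PosDef} ∧
      ContinuousOn (detCoeff Sig q N) {s : Matrix (Fin p) (Fin p) ℂ | s.PosDef} ∧
      ContinuousOn (trCoeff Sig N) {s : Matrix (Fin p) (Fin p) ℂ | s.PosDef} := by
  have hdet : Continuous fun s : Matrix (Fin p) (Fin p) ℂ => N * s.det.re :=
    continuous_const.mul (Complex.continuous_re.comp continuous_id.matrix_det)
  have hinv : ContinuousOn (fun s : Matrix (Fin p) (Fin p) ℂ => (N * s.det.re)⁻¹)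
      {s | s.PosDef} :=
    hdet.continuousOn.inv₀ fun s hs => by
      have := (PosDef.det_re_pos hs).1
      positivity
  have h1 : ContinuousOn (cutDet N) {s : Matrix (Fin p) (Fin p) ℂ | s.PosDef} :=
    (continuousOn_const.sub hinv).sup continuousOn_const
  have h2 : Continuous (cutTr Sig N) := by
    unfold cutTr
    refine Continuous.max (continuous_const.sub (Continuous.div_const ?_ N)) continuous_const
    exact Complex.continuous_re.comp (Continuous.matrix_trace (by fun_prop))
  have hc : ContinuousOn (cutoff Sig N) {s : Matrix (Fin p) (Fin p) ℂ | s.PosDef} :=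
    (h1.pow 2).mul (h2.continuousOn.pow 2)
  refine ⟨hc, ?_, ?_⟩
  · exact (continuousOn_const.mul hc).add
      (((continuousOn_const.mul h1).mul hinv).mul (h2.continuousOn.pow 2))
  · exact hc.add ((h1.pow 2).mul (continuousOn_const.mul h2.continuousOn))

theorem continuousOn_scoreCut (q : ℕ) {N : ℝ} (hN : 0 < N) (v : Matrix (Fin p) (Fin p) ℂ) :
    ContinuousOn (scoreCut Sig q N v) {s : Matrix (Fin p) (Fin p) ℂ | s.PosDef} := by
  obtain ⟨-, h2, h3⟩ := continuousOn_coeffs (p := p) (Sig := Sig) q hN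
  have h1 : ContinuousOn (fun s : Matrix (Fin p) (Fin p) ℂ => (s⁻¹ * v).trace.re)
      {s | s.PosDef} := by
    intro s hs
    have hc : Continuous fun M : Matrix (Fin p) (Fin p) ℂ => (M * v).trace.re :=
      Complex.continuous_re.comp (Continuous.matrix_trace (by fun_prop))
    exact (ContinuousAt.comp (g := fun M : Matrix (Fin p) (Fin p) ℂ => (M * v).trace.re)
      hc.continuousAt (continuousAt_inv_of_posDef hs)).continuousWithinAt
  exact (h1.mul h2).sub (continuousOn_const.mul h3)

theorem aemeasurable_comp_snd {f : Matrix (Fin p) (Fin p) ℂ → ℝ}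
    (hf : ContinuousOn f {s | s.PosDef}) :
    AEMeasurable (fun x : Matrix (Fin m) (Fin p) ℂ × Matrix (Fin p) (Fin p) ℂ => f x.2)
      (lebDom m p) := by
  rw [lebDom_eq]
  exact (hf.comp continuous_snd.continuousOn fun x hx => hx).aemeasurable
    (measurable_snd measurableSet_posDef)

theorem cutDet_eq_zero {N : ℝ} (hN : 0 < N) {s : Matrix (Fin p) (Fin p) ℂ} (hs : s.PosDef)
    (h : s.det.re < N⁻¹) : cutDet N s = 0 := by
  have h0 := (PosDef.det_re_pos hs).1
  have h1 : N * s.det.re ≤ 1 := by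
    have := mul_lt_mul_of_pos_left h hN
    rw [mul_inv_cancel₀ hN.ne'] at this
    exact this.le
  have h2 : 1 ≤ (N * s.det.re)⁻¹ := (one_le_inv₀ (by positivity)).2 h1
  exact max_eq_right (by linarith)

theorem cutTr_eq_zero {N : ℝ} (hN : 0 < N) {s : Matrix (Fin p) (Fin p) ℂ}
    (h : N < (s * Sig⁻¹).trace.re) : cutTr Sig N s = 0 := by
  have : 1 ≤ (s * Sig⁻¹).trace.re / N := (one_le_div hN).2 h.le
  exact max_eq_right (by linarith)

theorem cutoff_scoreCut_eq_zero (q : ℕ) {N : ℝ} {s : Matrix (Fin p) (Fin p) ℂ}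
    (h : cutDet N s = 0 ∨ cutTr Sig N s = 0) (v : Matrix (Fin p) (Fin p) ℂ) :
    cutoff Sig N s = 0 ∧ scoreCut Sig q N v s = 0 := by
  rcases h with h | h <;> simp [scoreCut, detCoeff, trCoeff, cutoff, h]

/-- K is closed among all matrices and avoids singular ones, which removes the boundary of the cone.
It need not be bounded: the cutoff at infinity serves integrability only. -/
theorem lineTest_wishart (hn : p < n) {N : ℝ} (hN : 0 < N)
    {v : Matrix (Fin p) (Fin p) ℂ} :
    LineTest (posDom m p) {x | x.2.PosSemidef ∧ N⁻¹ ≤ x.2.det.re} (0, v)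
      (fun x => jointDensity Ξ Sig n x * cutoff Sig N x.2)
      (fun x => jointDensity Ξ Sig n x * scoreCut Sig (n - p) N v x.2) where
  subset x hx := by
    refine hx.1.posDef_iff_det_ne_zero.2 fun h => ?_
    have h1 := hx.2
    rw [h, Complex.zero_re] at h1
    exact absurd h1 (not_le.2 (by positivity))
  isClosed x := by
    have hc : Continuous fun t : ℝ => (x + t • ((0 : Matrix (Fin m) (Fin p) ℂ), v)).2 := by
      fun_prop
    have hd : Continuous fun t : ℝ => (x + t • ((0 : Matrix (Fin m) (Fin p) ℂ), v)).2.det.re :=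
      Complex.continuous_re.comp hc.matrix_det
    exact (isClosed_posSemidef.preimage hc).inter (isClosed_Ici.preimage hd)
  hasDerivAt x hx := by
    have h := (hasDerivAt_wishartDensity_mul_cutoff (Sig := Sig) hn hN hx v).const_mul
      (normalDensity Ξ Sig x.1)
    refine (h.congr_of_eventuallyEq (Eventually.of_forall fun t => ?_)).congr_deriv ?_
    · simp [jointDensity, mul_assoc]
    · simp only [jointDensity, mul_assoc]
  continuousOn x := by
    have h1 : ContinuousOn (fun x : Matrix (Fin m) (Fin p) ℂ × Matrix (Fin p) (Fin p) ℂ =>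
        jointDensity Ξ Sig n x * scoreCut Sig (n - p) N v x.2) (posDom m p) :=
      (continuous_jointDensity Ξ Sig n).continuousOn.mul
        ((continuousOn_scoreCut (n - p) hN v).comp continuous_snd.continuousOn fun x hx => hx)
    have hc : Continuous fun t : ℝ => x + t • ((0 : Matrix (Fin m) (Fin p) ℂ), v) := by fun_prop
    exact h1.comp hc.continuousOn fun t ht => ht
  eq_zero x hx hxK := by
    have h : x.2.det.re < N⁻¹ := by
      by_contra hc
      exact hxK ⟨PosDef.posSemidef hx, not_lt.1 hc⟩
    have := cutoff_scoreCut_eq_zero (Sig := Sig) (n - p) (Or.inl (cutDet_eq_zero hN hx h)) v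
    simp [this.1, this.2]

/-- Where the cutoff is nonzero, the determinant is bounded below and the trace above, so
compactness bounds Tr(s⁻¹v). The bound may depend on N: it only makes each truncated identity
meaningful, and uniformity is needed only after summing over directions. -/
theorem exists_bound_scoreCut (hSig : Sig.PosDef) (q : ℕ) {N : ℝ} (hN : 1 ≤ N)
    (v : Matrix (Fin p) (Fin p) ℂ) :
    ∃ B, 0 ≤ B ∧ ∀ s : Matrix (Fin p) (Fin p) ℂ, s.PosDef → |scoreCut Sig q N v s| ≤ B := by
  have hN0 : 0 < N := by linarith
  have hS : 0 ≤ Sig.trace.re := (Complex.nonneg_iff.1 hSig.posSemidef.trace_nonneg).1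
  obtain ⟨B, hB⟩ := exists_bound_trace_inv_mul v (Sig.trace.re * N) (inv_pos.2 hN0)
  refine ⟨|B| * (q + 2) + |(Sig⁻¹ * v).trace.re| * 3, by positivity, fun s hs => ?_⟩
  by_cases h : cutDet N s = 0 ∨ cutTr Sig N s = 0
  · rw [(cutoff_scoreCut_eq_zero q h v).2, abs_zero]
    positivity
  rw [not_or] at h
  have h1 : N⁻¹ ≤ s.det.re := by
    by_contra hc
    exact h.1 (cutDet_eq_zero hN0 hs (not_le.1 hc))
  have h2 : (s * Sig⁻¹).trace.re ≤ N := by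
    by_contra hc
    exact h.2 (cutTr_eq_zero hN0 (not_le.1 hc))
  have h3 : s.trace.re ≤ Sig.trace.re * N :=
    (trace_le_trace_mul_inv hs.posSemidef hSig).trans (mul_le_mul_of_nonneg_left h2 hS)
  have h4 := (hB s hs h3 h1).trans (le_abs_self B)
  have h5 : |trCoeff Sig N s| ≤ 3 := by
    rw [abs_of_nonneg (trCoeff_nonneg hN0 s)]
    exact trCoeff_le hSig hN hs
  calc |scoreCut Sig q N v s|
      ≤ |(s⁻¹ * v).trace.re * detCoeff Sig q N s| + |(Sig⁻¹ * v).trace.re * trCoeff Sig N s| :=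
        abs_sub _ _
    _ ≤ _ := by
        rw [abs_mul, abs_mul]
        gcongr
        exact abs_detCoeff_le hSig q hN0 hs

/-- On the support of the cutoff, `A^* A` is controlled by `Tr (A^* A S⁻¹)`. -/
theorem frobSq_le_of_cutTr_ne_zero (hSig : Sig.PosDef) {N : ℝ} (hN : 0 < N)
    {s : Matrix (Fin p) (Fin p) ℂ} (hs : s.PosDef) (h : cutTr Sig N s ≠ 0)
    (A : Matrix (Fin m) (Fin p) ℂ) :
    frobSq A ≤ Sig.trace.re * N * ‖(Aᴴ * A * s⁻¹).trace‖ := by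
  have hS : 0 ≤ Sig.trace.re := (Complex.nonneg_iff.1 hSig.posSemidef.trace_nonneg).1
  have h2 : (s * Sig⁻¹).trace.re ≤ N := by
    by_contra hc
    exact h (cutTr_eq_zero hN (not_le.1 hc))
  have h3 : s.trace.re ≤ Sig.trace.re * N :=
    (trace_le_trace_mul_inv hs.posSemidef hSig).trans (mul_le_mul_of_nonneg_left h2 hS)
  have h4 := (Complex.nonneg_iff.1
    (trace_conjTranspose_mul_self_mul_nonneg A hs.inv.posSemidef)).1
  calc frobSq A ≤ s.trace.re * (Aᴴ * A * s⁻¹).trace.re := frobSq_le_trace_mul A hs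
    _ ≤ Sig.trace.re * N * (Aᴴ * A * s⁻¹).trace.re := by gcongr
    _ ≤ _ := by
        gcongr
        exact Complex.re_le_norm _

end ComplexNormalMean

/-! ### The Wishart identity: truncation and passage to the limit -/

namespace ComplexNormalMean

open Filter Topology Set DirectionalCalculus

variable {m p n : ℕ} {Ξ : Matrix (Fin m) (Fin p) ℂ} {Sig : Matrix (Fin p) (Fin p) ℂ}
  {Ω : Type*} [MeasurableSpace Ω] {P : Measure Ω}

/-- Passage to the limit in a truncated identity whose last term is nonnegative but not known to be
integrable beforehand. -/
theorem integrable_and_integral_eq_of_tendsto {T₁ T₂ : Ω → ℂ} {t : Ω → ℝ} {a b c : ℕ → Ω → ℝ}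
    {q B C : ℝ} (h₁ : Integrable T₁ P) (h₂ : Integrable T₂ P) (ht : AEStronglyMeasurable t P)
    (ht0 : ∀ ω, 0 ≤ t ω) (ham : ∀ k, AEStronglyMeasurable (a k) P)
    (hbm : ∀ k, AEStronglyMeasurable (b k) P)
    (ha : ∀ k, ∀ᵐ ω ∂P, |a k ω| ≤ 1) (hb : ∀ k, ∀ᵐ ω ∂P, |b k ω| ≤ B)
    (hc0 : ∀ k, ∀ᵐ ω ∂P, 0 ≤ c k ω) (hc : ∀ k, ∀ᵐ ω ∂P, c k ω ≤ C)
    (hal : ∀ᵐ ω ∂P, Tendsto (fun k => a k ω) atTop (𝓝 1))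
    (hbl : ∀ᵐ ω ∂P, Tendsto (fun k => b k ω) atTop (𝓝 q))
    (hcl : ∀ᵐ ω ∂P, Tendsto (fun k => c k ω) atTop (𝓝 1))
    (hI : ∀ k, Integrable (fun ω => c k ω * t ω) P)
    (hE : ∀ k, ∫ ω, ((a k ω : ℂ) * T₁ ω + (b k ω : ℂ) * T₂ ω) ∂P =
      ((∫ ω, c k ω * t ω ∂P : ℝ) : ℂ)) :
    Integrable t P ∧ ∫ ω, (T₁ ω + (q : ℂ) * T₂ ω) ∂P = ((∫ ω, t ω ∂P : ℝ) : ℂ) := by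
  have hofReal : ∀ {f : ℕ → Ω → ℝ} {l : ℝ} {ω : Ω}, Tendsto (fun k => f k ω) atTop (𝓝 l) →
      Tendsto (fun k => (f k ω : ℂ)) atTop (𝓝 (l : ℂ)) := fun h =>
    (Complex.continuous_ofReal.tendsto _).comp h
  have hL : Tendsto (fun k => ∫ ω, ((a k ω : ℂ) * T₁ ω + (b k ω : ℂ) * T₂ ω) ∂P) atTop
      (𝓝 (∫ ω, (T₁ ω + (q : ℂ) * T₂ ω) ∂P)) := by
    refine tendsto_integral_of_dominated_convergence (fun ω => 1 * ‖T₁ ω‖ + B * ‖T₂ ω‖)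
      (fun k => ?_) ((h₁.norm.const_mul 1).add (h₂.norm.const_mul B)) (fun k => ?_) ?_
    · exact ((Complex.continuous_ofReal.comp_aestronglyMeasurable (ham k)).mul
        h₁.aestronglyMeasurable).add
        ((Complex.continuous_ofReal.comp_aestronglyMeasurable (hbm k)).mul h₂.aestronglyMeasurable)
    · filter_upwards [ha k, hb k] with ω h1 h2
      refine (norm_add_le _ _).trans ?_
      rw [norm_mul, norm_mul, Complex.norm_real, Complex.norm_real, Real.norm_eq_abs,
        Real.norm_eq_abs]
      gcongr
    · filter_upwards [hal, hbl] with ω h1 h2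
      simpa using ((hofReal h1).mul_const (T₁ ω)).add ((hofReal h2).mul_const (T₂ ω))
  simp only [hE] at hL
  have hLre : Tendsto (fun k => ∫ ω, c k ω * t ω ∂P) atTop
      (𝓝 (∫ ω, (T₁ ω + (q : ℂ) * T₂ ω) ∂P).re) :=
    (Complex.continuous_re.tendsto _).comp hL
  -- The truncated integrals of t converge because they equal the left sides, so Fatou's lemma gives
  -- a finite integral of t.
  have hint : Integrable t P := by
    refine ⟨ht, ?_⟩
    rw [hasFiniteIntegral_iff_ofReal (Eventually.of_forall ht0)]
    have hlim : Tendsto (fun k => ∫⁻ ω, ENNReal.ofReal (c k ω * t ω) ∂P) atTop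
        (𝓝 (ENNReal.ofReal (∫ ω, (T₁ ω + (q : ℂ) * T₂ ω) ∂P).re)) := by
      refine ((ENNReal.continuous_ofReal.tendsto _).comp hLre).congr fun k => ?_
      refine ofReal_integral_eq_lintegral_ofReal (hI k) ?_
      filter_upwards [hc0 k] with ω h
      exact mul_nonneg h (ht0 ω)
    calc ∫⁻ ω, ENNReal.ofReal (t ω) ∂P
        = ∫⁻ ω, liminf (fun k => ENNReal.ofReal (c k ω * t ω)) atTop ∂P := by
          refine lintegral_congr_ae ?_
          filter_upwards [hcl] with ω h
          have := (ENNReal.continuous_ofReal.tendsto _).comp (h.mul_const (t ω))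
          rw [one_mul] at this
          exact this.liminf_eq.symm
      _ ≤ liminf (fun k => ∫⁻ ω, ENNReal.ofReal (c k ω * t ω) ∂P) atTop :=
          lintegral_liminf_le' fun k => (hI k).aestronglyMeasurable.aemeasurable.ennreal_ofReal
      _ < ⊤ := by
          rw [hlim.liminf_eq]
          exact ENNReal.ofReal_lt_top
  refine ⟨hint, tendsto_nhds_unique hL ?_⟩
  -- Once t is integrable, C t is a dominating function and the limit of the right sides is
  -- identified.
  refine (Complex.continuous_ofReal.tendsto _).comp ?_
  refine tendsto_integral_of_dominated_convergence (fun ω => C * t ω)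
    (fun k => (hI k).aestronglyMeasurable) (hint.const_mul C) (fun k => ?_) ?_
  · filter_upwards [hc0 k, hc k] with ω h0 h1
    rw [Real.norm_of_nonneg (mul_nonneg h0 (ht0 ω))]
    exact mul_le_mul_of_nonneg_right h1 (ht0 ω)
  · filter_upwards [hcl] with ω h
    simpa using h.mul_const (t ω)

theorem integral_sum_mul_eq_zero {ι : Type*} [Fintype ι] {f g : ι → ι → Ω → ℂ} (α β : ι → ι → ℂ)
    (hf : ∀ j l, Integrable (f j l) P ∧ ∫ ω, f j l ω ∂P = 0)
    (hg : ∀ j l, Integrable (g j l) P ∧ ∫ ω, g j l ω ∂P = 0) :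
    Integrable (fun ω => ∑ j, ∑ l, α j l * (f j l ω + β j l * g j l ω)) P ∧
      ∫ ω, ∑ j, ∑ l, α j l * (f j l ω + β j l * g j l ω) ∂P = 0 := by
  have h : ∀ j l, Integrable (fun ω => α j l * (f j l ω + β j l * g j l ω)) P := fun j l =>
    ((hf j l).1.add ((hg j l).1.const_mul (β j l))).const_mul (α j l)
  refine ⟨integrable_finsetSum _ fun j _ => integrable_finsetSum _ fun l _ => h j l, ?_⟩
  rw [integral_finsetSum _ fun j _ => integrable_finsetSum _ fun l _ => h j l]
  refine Finset.sum_eq_zero fun j _ => ?_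
  rw [integral_finsetSum _ fun l _ => h j l]
  refine Finset.sum_eq_zero fun l _ => ?_
  rw [integral_const_mul, integral_add (hf j l).1 ((hg j l).1.const_mul _), integral_const_mul,
    (hf j l).2, (hg j l).2]
  simp

/-- The entries of a Hermitian matrix from its pairings with the coordinate directions. -/
theorem trace_mul_hermDir {M : Matrix (Fin p) (Fin p) ℂ} (hM : M.IsHermitian) (j l : Fin p) :
    (1 / 2 : ℂ) * (1 + if j = l then 1 else 0) * (((M * hermReDir j l).trace.re : ℂ) +
      (1 - if j = l then 1 else 0) * I * ((M * hermImDir j l).trace.re : ℂ)) = M j l := by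
  have h := hM.apply l j
  rw [RCLike.star_def] at h
  unfold hermReDir hermImDir
  split_ifs with hjl
  · subst hjl
    have h2 : ((M j j).re : ℂ) = M j j := Complex.conj_eq_iff_re.1 h
    simp [Matrix.trace_mul_single, h2]
    ring
  · rw [Matrix.mul_add, Matrix.mul_sub, Matrix.trace_add, Matrix.trace_sub]
    simp only [Matrix.trace_mul_single, ← h]
    apply Complex.ext <;> simp <;> ring

variable {X : Ω → Matrix (Fin m) (Fin p) ℂ × Matrix (Fin p) (Fin p) ℂ}
  {G : Matrix (Fin m) (Fin p) ℂ × Matrix (Fin p) (Fin p) ℂ → Matrix (Fin m) (Fin p) ℂ}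

theorem aemeasurable_gram (hm : ∀ i j, AEMeasurable (fun x => G x i j) (lebDom m p))
    (l j : Fin p) : AEMeasurable (fun x => ((G x)ᴴ * G x) l j) (lebDom m p) := by
  simp only [Matrix.mul_apply, Matrix.conjTranspose_apply]
  exact Finset.aemeasurable_fun_sum _ fun i _ =>
    (continuous_star.measurable.comp_aemeasurable (hm i l)).mul (hm i j)

theorem ae_absContLine_gram {v : Matrix (Fin m) (Fin p) ℂ × Matrix (Fin p) (Fin p) ℂ}
    (hg : ∀ i j, ∀ᵐ x ∂lebDom m p, AbsContLine (fun x => G x i j) (posDom m p) v x)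
    (l j : Fin p) :
    ∀ᵐ x ∂lebDom m p, AbsContLine (fun x => ((G x)ᴴ * G x) l j) (posDom m p) v x := by
  simp only [Matrix.mul_apply, Matrix.conjTranspose_apply]
  filter_upwards [ae_all_iff.2 fun i => ae_all_iff.2 (hg i)] with x hx
  exact AbsContLine.sum _ fun i _ => (hx i l).conj_mul (hx i j)

/-- Integration by parts in one real coordinate of the Wishart matrix, with a cutoff. -/
theorem JointLaw.integral_lineDeriv_wishart (hX : JointLaw Ξ Sig n P X) {N : ℝ} (hN : 1 ≤ N)
    {v : Matrix (Fin p) (Fin p) ℂ} (hv : v.IsHermitian)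
    (hm : ∀ i j, AEMeasurable (fun x => G x i j) (lebDom m p))
    (hg : ∀ i j, ∀ᵐ x ∂lebDom m p, AbsContLine (fun x => G x i j) (posDom m p) (0, v) x)
    (hT : Integrable (fun ω => ((G (X ω))ᴴ * G (X ω) * (X ω).2⁻¹).trace) P) (l j : Fin p)
    (hd : Integrable (fun ω => lineDeriv ℝ (fun x => ((G x)ᴴ * G x) l j) (X ω) (0, v)) P) :
    Integrable (fun ω => lineDeriv ℝ (fun x => ((G x)ᴴ * G x) l j) (X ω) (0, v) *
        (cutoff Sig N (X ω).2 : ℂ) +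
      ((G (X ω))ᴴ * G (X ω)) l j * (scoreCut Sig (n - p) N v (X ω).2 : ℂ)) P ∧
    ∫ ω, (lineDeriv ℝ (fun x => ((G x)ᴴ * G x) l j) (X ω) (0, v) *
        (cutoff Sig N (X ω).2 : ℂ) +
      ((G (X ω))ᴴ * G (X ω)) l j * (scoreCut Sig (n - p) N v (X ω).2 : ℂ)) ∂P = 0 := by
  have hN0 : 0 < N := by linarith
  have hS : 0 ≤ Sig.trace.re := (Complex.nonneg_iff.1 hX.posDef.posSemidef.trace_nonneg).1
  have hκm := aemeasurable_comp_snd (m := m) (continuousOn_coeffs (p := p) (Sig := Sig) 0 hN0).1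
  have hκ'm := aemeasurable_comp_snd (m := m)
    (continuousOn_scoreCut (p := p) (Sig := Sig) (n - p) hN0 v)
  have hκc := hX.aestronglyMeasurable_comp
    (measurable_ofReal.comp_aemeasurable hκm).aestronglyMeasurable
  have hκ'c := hX.aestronglyMeasurable_comp
    (measurable_ofReal.comp_aemeasurable hκ'm).aestronglyMeasurable
  have hgm := hX.aestronglyMeasurable_comp (aemeasurable_gram hm l j).aestronglyMeasurable
  obtain ⟨B, hB0, hB⟩ := exists_bound_scoreCut (p := p) hX.posDef (n - p) hN v
  have hgb : ∀ ω, (X ω).2.PosDef → cutTr Sig N (X ω).2 ≠ 0 → ‖((G (X ω))ᴴ * G (X ω)) l j‖ ≤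
      Sig.trace.re * N * ‖((G (X ω))ᴴ * G (X ω) * (X ω).2⁻¹).trace‖ := fun ω h1 h2 =>
    (norm_conjTranspose_mul_self_apply_le (G (X ω)) l j).trans
      (frobSq_le_of_cutTr_ne_zero hX.posDef hN0 h1 h2 (G (X ω)))
  have i1 : Integrable (fun ω => ((G (X ω))ᴴ * G (X ω)) l j * (cutoff Sig N (X ω).2 : ℂ)) P := by
    refine (hT.norm.const_mul (Sig.trace.re * N)).mono' (hgm.mul hκc) ?_
    filter_upwards [hX.ae_posDef] with ω hω
    rw [norm_mul, Complex.norm_real, Real.norm_of_nonneg (cutoff_nonneg _ _)]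
    by_cases h : cutTr Sig N (X ω).2 = 0
    · rw [(cutoff_scoreCut_eq_zero 0 (Or.inr h) v).1, mul_zero]
      positivity
    · exact (mul_le_of_le_one_right (norm_nonneg _) (cutoff_le_one hX.posDef hN0 hω)).trans
        (hgb ω hω h)
  have i2 : Integrable (fun ω => ((G (X ω))ᴴ * G (X ω)) l j *
      (scoreCut Sig (n - p) N v (X ω).2 : ℂ)) P := by
    refine (hT.norm.const_mul (Sig.trace.re * N * B)).mono' (hgm.mul hκ'c) ?_
    filter_upwards [hX.ae_posDef] with ω hω
    rw [norm_mul, Complex.norm_real, Real.norm_eq_abs]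
    by_cases h : cutTr Sig N (X ω).2 = 0
    · rw [(cutoff_scoreCut_eq_zero (n - p) (Or.inr h) v).2, abs_zero, mul_zero]
      positivity
    · calc _ ≤ Sig.trace.re * N * ‖((G (X ω))ᴴ * G (X ω) * (X ω).2⁻¹).trace‖ * B :=
            mul_le_mul (hgb ω hω h) (hB _ hω) (abs_nonneg _) (by positivity)
        _ = _ := by ring
  have i3 : Integrable (fun ω => lineDeriv ℝ (fun x => ((G x)ᴴ * G x) l j) (X ω) (0, v) *
      (cutoff Sig N (X ω).2 : ℂ)) P := by
    refine hd.norm.mono' (hd.aestronglyMeasurable.mul hκc) ?_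
    filter_upwards [hX.ae_posDef] with ω hω
    rw [norm_mul, Complex.norm_real, Real.norm_of_nonneg (cutoff_nonneg _ _)]
    exact mul_le_of_le_one_right (norm_nonneg _) (cutoff_le_one hX.posDef hN0 hω)
  exact ⟨i3.add i2, hX.integral_lineDeriv_mul_add_eq_zero_complex hv (aemeasurable_gram hm l j)
    (ae_absContLine_gram hg l j) hκm hκ'm (lineTest_wishart hX.lt hN0) i1 (i3.add i2)⟩

/-- The trace of `D_S (G^* G)`, with the derivatives taken in the product space. -/
noncomputable def traceD
    (G : Matrix (Fin m) (Fin p) ℂ × Matrix (Fin p) (Fin p) ℂ → Matrix (Fin m) (Fin p) ℂ)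
    (x : Matrix (Fin m) (Fin p) ℂ × Matrix (Fin p) (Fin p) ℂ) : ℂ :=
  ∑ j, ∑ l, (1 / 2 : ℂ) * (1 + if j = l then 1 else 0) *
    (lineDeriv ℝ (fun x => ((G x)ᴴ * G x) l j) x (0, hermReDir j l) +
      (1 - if j = l then 1 else 0) * I *
        lineDeriv ℝ (fun x => ((G x)ᴴ * G x) l j) x (0, hermImDir j l))

theorem integrable_traceD
    (hdre : ∀ j l, Integrable (fun ω =>
      lineDeriv ℝ (fun x => ((G x)ᴴ * G x) l j) (X ω) (0, hermReDir j l)) P)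
    (hdim : ∀ j l, Integrable (fun ω =>
      lineDeriv ℝ (fun x => ((G x)ᴴ * G x) l j) (X ω) (0, hermImDir j l)) P) :
    Integrable (fun ω => traceD G (X ω)) P := by
  unfold traceD
  exact integrable_finsetSum _ fun j _ => integrable_finsetSum _ fun l _ =>
    ((hdre j l).add ((hdim j l).const_mul _)).const_mul _

/-- The truncated integrand, in terms of the traces. -/
theorem sum_lineDeriv_mul_add (hSig : Sig.PosDef) (q : ℕ) (N : ℝ)
    {x : Matrix (Fin m) (Fin p) ℂ × Matrix (Fin p) (Fin p) ℂ} (hx : x.2.PosDef) :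
    ∑ j, ∑ l, (1 / 2 : ℂ) * (1 + if j = l then 1 else 0) *
      ((lineDeriv ℝ (fun x => ((G x)ᴴ * G x) l j) x (0, hermReDir j l) * (cutoff Sig N x.2 : ℂ) +
          ((G x)ᴴ * G x) l j * (scoreCut Sig q N (hermReDir j l) x.2 : ℂ)) +
        (1 - if j = l then 1 else 0) * I *
          (lineDeriv ℝ (fun x => ((G x)ᴴ * G x) l j) x (0, hermImDir j l) *
            (cutoff Sig N x.2 : ℂ) +
          ((G x)ᴴ * G x) l j * (scoreCut Sig q N (hermImDir j l) x.2 : ℂ))) =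
      (cutoff Sig N x.2 : ℂ) * traceD G x +
        (detCoeff Sig q N x.2 : ℂ) * ((G x)ᴴ * G x * x.2⁻¹).trace -
        (trCoeff Sig N x.2 : ℂ) * ((G x)ᴴ * G x * Sig⁻¹).trace := by
  have htr : ∀ M : Matrix (Fin p) (Fin p) ℂ, ((G x)ᴴ * G x * M).trace =
      ∑ j, ∑ l, ((G x)ᴴ * G x) l j * M j l := fun M => by
    rw [Finset.sum_comm]
    simp only [Matrix.trace, Matrix.diag_apply, Matrix.mul_apply (M := (G x)ᴴ * G x)]
  rw [htr, htr, traceD, Finset.mul_sum, Finset.mul_sum, Finset.mul_sum, ← Finset.sum_add_distrib,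
    ← Finset.sum_sub_distrib]
  refine Finset.sum_congr rfl fun j _ => ?_
  rw [Finset.mul_sum, Finset.mul_sum, Finset.mul_sum, ← Finset.sum_add_distrib,
    ← Finset.sum_sub_distrib]
  refine Finset.sum_congr rfl fun l _ => ?_
  -- The weights defining ∂/∂s_jl recombine the scores in the coordinate directions into the entries
  -- of s⁻¹ and Σ⁻¹.
  rw [← trace_mul_hermDir hx.inv.isHermitian j l, ← trace_mul_hermDir hSig.inv.isHermitian j l]
  simp only [scoreCut]
  push_cast
  ring

/-- The Wishart identity `E [Tr (D_S H) + (n - p) Tr (H S⁻¹)] = E [Tr (H Σ⁻¹)]` for `H = G^* G`. -/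
theorem JointLaw.integral_trace_wishart (hX : JointLaw Ξ Sig n P X)
    (hm : ∀ i j, AEMeasurable (fun x => G x i j) (lebDom m p))
    (hre : ∀ j l i k, ∀ᵐ x ∂lebDom m p,
      AbsContLine (fun x => G x i k) (posDom m p) (0, hermReDir j l) x)
    (him : ∀ j l i k, ∀ᵐ x ∂lebDom m p,
      AbsContLine (fun x => G x i k) (posDom m p) (0, hermImDir j l) x)
    (hdre : ∀ j l, Integrable (fun ω =>
      lineDeriv ℝ (fun x => ((G x)ᴴ * G x) l j) (X ω) (0, hermReDir j l)) P)
    (hdim : ∀ j l, Integrable (fun ω =>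
      lineDeriv ℝ (fun x => ((G x)ᴴ * G x) l j) (X ω) (0, hermImDir j l)) P)
    (hT : Integrable (fun ω => ((G (X ω))ᴴ * G (X ω) * (X ω).2⁻¹).trace) P) :
    Integrable (fun ω => ((G (X ω))ᴴ * G (X ω) * Sig⁻¹).trace.re) P ∧
    ∫ ω, (traceD G (X ω) +
        ((n - p : ℕ) : ℂ) * ((G (X ω))ᴴ * G (X ω) * (X ω).2⁻¹).trace) ∂P =
      ((∫ ω, ((G (X ω))ᴴ * G (X ω) * Sig⁻¹).trace.re ∂P : ℝ) : ℂ) := by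
  have hT3 : ∀ ω, 0 ≤ ((G (X ω))ᴴ * G (X ω) * Sig⁻¹).trace := fun ω =>
    trace_conjTranspose_mul_self_mul_nonneg (G (X ω)) hX.posDef.inv.posSemidef
  have hT3re : ∀ ω, ((G (X ω))ᴴ * G (X ω) * Sig⁻¹).trace =
      ((((G (X ω))ᴴ * G (X ω) * Sig⁻¹).trace.re : ℝ) : ℂ) := fun ω =>
    Complex.ext rfl (Complex.nonneg_iff.1 (hT3 ω)).2.symm
  have hT1 := integrable_traceD hdre hdim
  have hN0 : ∀ k : ℕ, (0 : ℝ) < (k : ℝ) + 1 := fun k => by positivity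
  have hN1 : ∀ k : ℕ, (1 : ℝ) ≤ (k : ℝ) + 1 := fun k => by
    have : (0 : ℝ) ≤ k := Nat.cast_nonneg k
    linarith
  have hcont := fun k : ℕ => continuousOn_coeffs (p := p) (Sig := Sig) (n - p) (hN0 k)
  have hmeas : ∀ {f : Matrix (Fin p) (Fin p) ℂ → ℝ}, ContinuousOn f {s | s.PosDef} →
      AEStronglyMeasurable (fun ω => f (X ω).2) P := fun hf =>
    hX.aestronglyMeasurable_comp (aemeasurable_comp_snd hf).aestronglyMeasurable
  have ha : ∀ k : ℕ, ∀ᵐ ω ∂P, |cutoff Sig ((k : ℝ) + 1) (X ω).2| ≤ 1 := fun k => by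
    filter_upwards [hX.ae_posDef] with ω hω
    rw [abs_of_nonneg (cutoff_nonneg _ _)]
    exact cutoff_le_one hX.posDef (hN0 k) hω
  have hb : ∀ k : ℕ, ∀ᵐ ω ∂P,
      |detCoeff Sig (n - p) ((k : ℝ) + 1) (X ω).2| ≤ ((n - p : ℕ) : ℝ) + 2 := fun k =>
    hX.ae_posDef.mono fun ω hω => abs_detCoeff_le hX.posDef _ (hN0 k) hω
  have i1 : ∀ k : ℕ, Integrable (fun ω =>
      (cutoff Sig ((k : ℝ) + 1) (X ω).2 : ℂ) * traceD G (X ω)) P := fun k =>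
    hT1.bdd_mul (c := 1)
      (Complex.continuous_ofReal.comp_aestronglyMeasurable (hmeas (hcont k).1))
      ((ha k).mono fun ω h => by rwa [Complex.norm_real, Real.norm_eq_abs])
  have i2 : ∀ k : ℕ, Integrable (fun ω => (detCoeff Sig (n - p) ((k : ℝ) + 1) (X ω).2 : ℂ) *
      ((G (X ω))ᴴ * G (X ω) * (X ω).2⁻¹).trace) P := fun k =>
    hT.bdd_mul (c := ((n - p : ℕ) : ℝ) + 2)
      (Complex.continuous_ofReal.comp_aestronglyMeasurable (hmeas (hcont k).2.1))
      ((hb k).mono fun ω h => by rwa [Complex.norm_real, Real.norm_eq_abs])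
  have hR := fun (k : ℕ) (j l : Fin p) => hX.integral_lineDeriv_wishart (hN1 k)
    (isHermitian_hermReDir j l) hm (hre j l) hT l j (hdre j l)
  have hJ := fun (k : ℕ) (j l : Fin p) => hX.integral_lineDeriv_wishart (hN1 k)
    (isHermitian_hermImDir j l) hm (him j l) hT l j (hdim j l)
  have key : ∀ k : ℕ, Integrable (fun ω =>
        (cutoff Sig ((k : ℝ) + 1) (X ω).2 : ℂ) * traceD G (X ω) +
        (detCoeff Sig (n - p) ((k : ℝ) + 1) (X ω).2 : ℂ) *
          ((G (X ω))ᴴ * G (X ω) * (X ω).2⁻¹).trace -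
        (trCoeff Sig ((k : ℝ) + 1) (X ω).2 : ℂ) * ((G (X ω))ᴴ * G (X ω) * Sig⁻¹).trace) P ∧
      ∫ ω, ((cutoff Sig ((k : ℝ) + 1) (X ω).2 : ℂ) * traceD G (X ω) +
        (detCoeff Sig (n - p) ((k : ℝ) + 1) (X ω).2 : ℂ) *
          ((G (X ω))ᴴ * G (X ω) * (X ω).2⁻¹).trace -
        (trCoeff Sig ((k : ℝ) + 1) (X ω).2 : ℂ) *
          ((G (X ω))ᴴ * G (X ω) * Sig⁻¹).trace) ∂P = 0 := fun k => by
    have hae := hX.ae_posDef.mono fun ω hω =>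
      sum_lineDeriv_mul_add (G := G) hX.posDef (n - p) ((k : ℝ) + 1) hω
    have h := integral_sum_mul_eq_zero (fun j l : Fin p => (1 / 2 : ℂ) * (1 + if j = l then 1 else 0))
      (fun j l => (1 - if j = l then 1 else 0) * I) (hR k) (hJ k)
    exact ⟨h.1.congr hae, (integral_congr_ae hae).symm.trans h.2⟩
  -- The truncated Tr(HΣ⁻¹) is integrable as the difference between two integrable terms and the
  -- integrable total.
  have i3 : ∀ k : ℕ, Integrable (fun ω => (trCoeff Sig ((k : ℝ) + 1) (X ω).2 : ℂ) *
      ((G (X ω))ᴴ * G (X ω) * Sig⁻¹).trace) P := fun k => by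
    refine (((i1 k).add (i2 k)).sub (key k).1).congr (Eventually.of_forall fun ω => ?_)
    simp
  have i3re : ∀ k : ℕ, Integrable (fun ω => trCoeff Sig ((k : ℝ) + 1) (X ω).2 *
      ((G (X ω))ᴴ * G (X ω) * Sig⁻¹).trace.re) P := fun k => by
    refine (i3 k).re.congr (Eventually.of_forall fun ω => ?_)
    simp
  have hT3m : AEStronglyMeasurable (fun ω => ((G (X ω))ᴴ * G (X ω) * Sig⁻¹).trace.re) P := by
    refine hX.aestronglyMeasurable_comp (w := fun x => ((G x)ᴴ * G x * Sig⁻¹).trace.re)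
      (AEMeasurable.aestronglyMeasurable ?_)
    refine measurable_re.comp_aemeasurable ?_
    simp only [Matrix.trace, Matrix.diag_apply, Matrix.mul_apply (N := Sig⁻¹)]
    exact Finset.aemeasurable_fun_sum _ fun i _ => Finset.aemeasurable_fun_sum _ fun j _ =>
      (aemeasurable_gram hm i j).mul_const _
  refine integrable_and_integral_eq_of_tendsto (C := 3) hT1 hT hT3m
    (fun ω => (Complex.nonneg_iff.1 (hT3 ω)).1) (fun k => hmeas (hcont k).1)
    (fun k => hmeas (hcont k).2.1) ha hb
    (fun k => Eventually.of_forall fun ω => trCoeff_nonneg (hN0 k) _)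
    (fun k => hX.ae_posDef.mono fun ω hω => trCoeff_le hX.posDef (hN1 k) hω)
    (Eventually.of_forall fun ω => (tendsto_coeffs (n - p) (X ω).2).1)
    (Eventually.of_forall fun ω => (tendsto_coeffs (n - p) (X ω).2).2.1)
    (Eventually.of_forall fun ω => (tendsto_coeffs (n - p) (X ω).2).2.2) i3re fun k => ?_
  have h := (key k).2
  have i12 : Integrable (fun ω => (cutoff Sig ((k : ℝ) + 1) (X ω).2 : ℂ) * traceD G (X ω) +
      (detCoeff Sig (n - p) ((k : ℝ) + 1) (X ω).2 : ℂ) *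
        ((G (X ω))ᴴ * G (X ω) * (X ω).2⁻¹).trace) P := (i1 k).add (i2 k)
  rw [integral_sub i12 (i3 k), sub_eq_zero] at h
  refine h.trans (Eq.trans (integral_congr_ae (Eventually.of_forall fun ω => ?_)) integral_ofReal)
  simp only [RCLike.ofReal_eq_complex_ofReal, Complex.ofReal_mul, ← hT3re ω]

end ComplexNormalMean

/-! ### Assembly of the risk identity -/

namespace ComplexNormalMean

open Filter Topology Set DirectionalCalculus

variable {m p n : ℕ} {Ξ : Matrix (Fin m) (Fin p) ℂ} {Sig : Matrix (Fin p) (Fin p) ℂ}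

theorem loss_add (hSig : Sig.PosDef) (z g : Matrix (Fin m) (Fin p) ℂ) :
    loss Ξ Sig (z + g) = (Sig⁻¹ * (z - Ξ)ᴴ * (z - Ξ)).trace.re +
      2 * (Sig⁻¹ * (z - Ξ)ᴴ * g).trace.re + (gᴴ * g * Sig⁻¹).trace.re := by
  have h1 : (Sig⁻¹ * gᴴ * (z - Ξ)).trace.re = (Sig⁻¹ * (z - Ξ)ᴴ * g).trace.re := by
    have h : (Sig⁻¹ * (z - Ξ)ᴴ * g)ᴴ = gᴴ * (z - Ξ) * Sig⁻¹ := by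
      rw [Matrix.conjTranspose_mul, Matrix.conjTranspose_mul, Matrix.conjTranspose_conjTranspose,
        hSig.inv.isHermitian.eq, Matrix.mul_assoc]
    rw [Matrix.mul_assoc, Matrix.trace_mul_comm, ← h, Matrix.trace_conjTranspose]
    simp
  have h2 : (Sig⁻¹ * gᴴ * g).trace = (gᴴ * g * Sig⁻¹).trace := by
    rw [Matrix.mul_assoc, Matrix.trace_mul_comm]
  have h3 : z + g - Ξ = (z - Ξ) + g := by abel
  rw [loss, h3, Matrix.conjTranspose_add, Matrix.mul_add Sig⁻¹, Matrix.add_mul, Matrix.mul_add,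
    Matrix.mul_add]
  simp only [Matrix.trace_add, Complex.add_re, h1, h2]
  ring

section Transfer

variable {E F V : Type*} [NormedAddCommGroup V] [NormedSpace ℝ V] [AddCommGroup E] [Module ℝ E]
  [AddCommGroup F] [Module ℝ F]

/-- Integration by parts takes place on pairs (z, s), while the operators ∇_Z' and D_S differentiate
in one variable with the other frozen. -/
theorem lineDeriv_prodMk_zero (f : E × F → V) (x : E × F) (w : E) :
    lineDeriv ℝ f x (w, 0) = lineDeriv ℝ (fun z => f (z, x.2)) x.1 w := by
  simp only [lineDeriv]
  congr 1
  ext t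
  congr 1
  exact Prod.ext rfl (by simp)

theorem lineDeriv_zero_prodMk (f : E × F → V) (x : E × F) (v : F) :
    lineDeriv ℝ f x (0, v) = lineDeriv ℝ (fun s => f (x.1, s)) x.2 v := by
  simp only [lineDeriv]
  congr 1
  ext t
  congr 1
  exact Prod.ext (by simp) rfl

end Transfer

/-- The factor -√-1 in ∂/∂z_ij selects the imaginary part of the derivative along Im z_ij. The
identity is obtained almost everywhere, where both components of g are differentiable along the two
lines. -/
theorem IsAbsCont.ae_re_dZ {g : Matrix (Fin m) (Fin p) ℂ → Matrix (Fin p) (Fin p) ℂ → ℂ}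
    (hg : IsAbsCont g) (i : Fin m) (j : Fin p) :
    ∀ᵐ x ∂lebDom m p, (dZ i j (fun z => g z x.2) x.1).re =
      (lineDeriv ℝ (fun z => (g z x.2).re) x.1 (reDir i j) +
        lineDeriv ℝ (fun z => (g z x.2).im) x.1 (imDir i j)) / 2 := by
  have hm := hg.aemeasurable
  rw [lebDom_eq] at hm ⊢
  filter_upwards [ae_hasLineDerivAt_complex (lineInvariant_prod _ isHermitian_zero)
      (lineDomain_posDom _ isHermitian_zero) hm (hg.along_re_z i j).ae_absContLine,
    ae_hasLineDerivAt_complex (lineInvariant_prod _ isHermitian_zero)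
      (lineDomain_posDom _ isHermitian_zero) hm (hg.along_im_z i j).ae_absContLine] with x h1 h2
  have e1 := h1.lineDeriv
  have e2 := h2.lineDeriv
  simp only [lineDeriv_prodMk_zero] at e1 e2
  rw [dZ, e1, e2]
  simp
  ring

variable {Ω : Type*} [MeasurableSpace Ω] {P : Measure Ω}
  {Z : Ω → Matrix (Fin m) (Fin p) ℂ} {S : Ω → Matrix (Fin p) (Fin p) ℂ}
  {G : Matrix (Fin m) (Fin p) ℂ → Matrix (Fin p) (Fin p) ℂ → Matrix (Fin m) (Fin p) ℂ}

/-- Stein's identity for `∇_Z' G`. -/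
theorem JointLaw.integral_nablaT [IsFiniteMeasure P]
    (hX : JointLaw Ξ Sig n P fun ω => (Z ω, S ω))
    (hZ2 : Integrable (fun ω => frobSq (Z ω - Ξ)) P)
    (hG : ∀ i j, IsAbsCont (fun z s => G z s i j))
    (hG2 : Integrable (fun ω => frobSq (G (Z ω) (S ω))) P)
    (hRe : ∀ i j, Integrable (fun ω =>
      lineDeriv ℝ (fun z => (G z (S ω) i j).re) (Z ω) (reDir i j)) P)
    (hIm : ∀ i j, Integrable (fun ω =>
      lineDeriv ℝ (fun z => (G z (S ω) i j).im) (Z ω) (imDir i j)) P) :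
    Integrable (fun ω => (Sig⁻¹ * (Z ω - Ξ)ᴴ * G (Z ω) (S ω)).trace.re) P ∧
    Integrable (fun ω => ((nablaT (fun z => G z (S ω)) (Z ω)).map Complex.re).trace) P ∧
    ∫ ω, ((nablaT (fun z => G z (S ω)) (Z ω)).map Complex.re).trace ∂P =
      ∫ ω, (Sig⁻¹ * (Z ω - Ξ)ᴴ * G (Z ω) (S ω)).trace.re ∂P := by
  have h := hX.integral_trace_normal hZ2 (G := fun x => G x.1 x.2)
    (fun i j => (hG i j).aemeasurable) (fun i j => (hG i j).along_re_z i j)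
    (fun i j => (hG i j).along_im_z i j) hG2
    (fun i j => by simpa only [lineDeriv_prodMk_zero] using hRe i j)
    (fun i j => by simpa only [lineDeriv_prodMk_zero] using hIm i j)
  simp only [lineDeriv_prodMk_zero] at h
  have hterm : ∀ i j, Integrable (fun ω =>
      (lineDeriv ℝ (fun z => (G z (S ω) i j).re) (Z ω) (reDir i j) +
        lineDeriv ℝ (fun z => (G z (S ω) i j).im) (Z ω) (imDir i j)) / 2) P := fun i j =>
    ((hRe i j).add (hIm i j)).div_const 2
  have hsum : Integrable (fun ω => ∑ i, ∑ j,
      (lineDeriv ℝ (fun z => (G z (S ω) i j).re) (Z ω) (reDir i j) +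
        lineDeriv ℝ (fun z => (G z (S ω) i j).im) (Z ω) (imDir i j)) / 2) P :=
    integrable_finsetSum _ fun i _ => integrable_finsetSum _ fun j _ => hterm i j
  have hae : ∀ᵐ ω ∂P, ∑ i, ∑ j,
      (lineDeriv ℝ (fun z => (G z (S ω) i j).re) (Z ω) (reDir i j) +
        lineDeriv ℝ (fun z => (G z (S ω) i j).im) (Z ω) (imDir i j)) / 2 =
      ((nablaT (fun z => G z (S ω)) (Z ω)).map Complex.re).trace := by
    filter_upwards [hX.ae_of_ae_lebDom (ae_all_iff.2 fun i => ae_all_iff.2 fun j =>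
      (hG i j).ae_re_dZ i j)] with ω hω
    rw [Finset.sum_comm]
    simp only [Matrix.trace, Matrix.diag_apply, Matrix.map_apply, nablaT, Matrix.of_apply,
      Complex.re_sum, hω]
  refine ⟨h.1, hsum.congr hae, ?_⟩
  have h2 : ∫ ω, (∑ i, ∑ j, (lineDeriv ℝ (fun z => (G z (S ω) i j).re) (Z ω) (reDir i j) +
      lineDeriv ℝ (fun z => (G z (S ω) i j).im) (Z ω) (imDir i j)) / 2) ∂P =
      (∑ i, ∑ j, (∫ ω, lineDeriv ℝ (fun z => (G z (S ω) i j).re) (Z ω) (reDir i j) ∂P +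
        ∫ ω, lineDeriv ℝ (fun z => (G z (S ω) i j).im) (Z ω) (imDir i j) ∂P)) / 2 := by
    rw [integral_finsetSum _ fun i _ => integrable_finsetSum _ fun j _ => hterm i j,
      Finset.sum_div]
    refine Finset.sum_congr rfl fun i _ => ?_
    rw [integral_finsetSum _ fun j _ => hterm i j, Finset.sum_div]
    refine Finset.sum_congr rfl fun j _ => ?_
    rw [integral_div, integral_add (hRe i j) (hIm i j)]
  rw [← integral_congr_ae hae, h2, ← h.2]
  ring

theorem traceD_eq_trace_matD (x : Matrix (Fin m) (Fin p) ℂ × Matrix (Fin p) (Fin p) ℂ) :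
    traceD (fun x => G x.1 x.2) x = (matD (fun s => (G x.1 s)ᴴ * G x.1 s) x.2).trace := by
  simp only [traceD, matD, dS, Matrix.trace, Matrix.diag_apply, Matrix.of_apply,
    lineDeriv_zero_prodMk]

theorem integrable_frobSq_of_integrable_trace (hSig : Sig.PosDef) {A : Ω → Matrix (Fin m) (Fin p) ℂ}
    (hA : ∀ i j, AEStronglyMeasurable (fun ω => A ω i j) P)
    (h : Integrable (fun ω => ((A ω)ᴴ * A ω * Sig⁻¹).trace.re) P) :
    Integrable (fun ω => frobSq (A ω)) P := by
  refine (h.const_mul Sig.trace.re).mono' ?_ (Eventually.of_forall fun ω => ?_)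
  · unfold frobSq
    exact Finset.aestronglyMeasurable_fun_sum _ fun i _ =>
      Finset.aestronglyMeasurable_fun_sum _ fun j _ => (hA i j).norm.pow 2
  · rw [Real.norm_of_nonneg (frobSq_nonneg _)]
    exact frobSq_le_trace_mul (A ω) hSig

theorem integrable_frobSq_sub_of_hasLaw [IsProbabilityMeasure P] (hSig : Sig.PosDef)
    (hZ : HasLaw Z (complexNormal Ξ Sig) P) : Integrable (fun ω => frobSq (Z ω - Ξ)) P := by
  have : IsProbabilityMeasure (complexNormal Ξ Sig) := by
    rw [← hZ.map_eq]
    exact Measure.isProbabilityMeasure_map hZ.aemeasurable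
  have h := complexNormal_integrable_frobSq (Ξ := Ξ) hSig
  rw [← hZ.map_eq] at h
  exact h.comp_aemeasurable hZ.aemeasurable

end ComplexNormalMean

theorem mainTheorem8 {m p n : ℕ} (hn : p < n)
    (Ξ : Matrix (Fin m) (Fin p) ℂ) (Sig : Matrix (Fin p) (Fin p) ℂ) (hSig : Sig.PosDef)
    {Ω : Type*} [MeasurableSpace Ω] (P : Measure Ω) [IsProbabilityMeasure P]
    (Z : Ω → Matrix (Fin m) (Fin p) ℂ) (S : Ω → Matrix (Fin p) (Fin p) ℂ)
    (hZ : HasLaw Z (ComplexNormalMean.complexNormal Ξ Sig) P)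
    (hS : HasLaw S (ComplexNormalMean.complexWishart Sig n) P)
    (hZS : IndepFun Z S P)
    (G : Matrix (Fin m) (Fin p) ℂ → Matrix (Fin p) (Fin p) ℂ → Matrix (Fin m) (Fin p) ℂ)
    (hG : ∀ i j, ComplexNormalMean.IsAbsCont (fun z s => G z s i j))
    -- the partial derivatives entering `Re (∇_Z' G)` have finite expectations
    (hRe : ∀ i j, Integrable (fun ω =>
      lineDeriv ℝ (fun z => (G z (S ω) i j).re) (Z ω) (ComplexNormalMean.reDir i j)) P)
    (hIm : ∀ i j, Integrable (fun ω =>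
      lineDeriv ℝ (fun z => (G z (S ω) i j).im) (Z ω) (ComplexNormalMean.imDir i j)) P)
    -- the partial derivatives entering `Tr (D_S G^* G)` have finite expectations
    (hDRe : ∀ j l, Integrable (fun ω =>
      lineDeriv ℝ (fun s => ((G (Z ω) s)ᴴ * G (Z ω) s) l j) (S ω)
        (ComplexNormalMean.hermReDir j l)) P)
    (hDIm : ∀ j l, Integrable (fun ω =>
      lineDeriv ℝ (fun s => ((G (Z ω) s)ᴴ * G (Z ω) s) l j) (S ω)
        (ComplexNormalMean.hermImDir j l)) P)
    -- `Tr (G^* G S⁻¹)` has finite expectation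
    (hTr : Integrable (fun ω =>
      ((G (Z ω) (S ω))ᴴ * G (Z ω) (S ω) * (S ω)⁻¹).trace) P) :
    Integrable (fun ω => ComplexNormalMean.loss Ξ Sig (Z ω + G (Z ω) (S ω))) P ∧
    ((∫ ω, ComplexNormalMean.loss Ξ Sig (Z ω + G (Z ω) (S ω)) ∂P : ℝ) : ℂ)
      = (m : ℂ) * (p : ℂ)
        + ∫ ω, (2 * (((ComplexNormalMean.nablaT (fun z => G z (S ω)) (Z ω)).map Complex.re).trace : ℂ)
            + (ComplexNormalMean.matD (fun s => (G (Z ω) s)ᴴ * G (Z ω) s) (S ω)).trace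
            + ((n : ℂ) - (p : ℂ)) * ((G (Z ω) (S ω))ᴴ * G (Z ω) (S ω) * (S ω)⁻¹).trace) ∂P := by
  open ComplexNormalMean in
  have hX := jointLaw_of_indepFun hn hSig hZ hS hZS
  have hZ2 := integrable_frobSq_sub_of_hasLaw hSig hZ
  -- The Wishart identity must come first: its integrability conclusion makes G square integrable,
  -- which Stein's identity needs.
  obtain ⟨hW1, hW2⟩ := hX.integral_trace_wishart (G := fun x => G x.1 x.2)
    (fun i j => (hG i j).aemeasurable) (fun j l i k => (hG i k).along_re_s j l)
    (fun j l i k => (hG i k).along_im_s j l)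
    (fun j l => by simpa only [lineDeriv_zero_prodMk] using hDRe j l)
    (fun j l => by simpa only [lineDeriv_zero_prodMk] using hDIm j l) hTr
  have hD : Integrable (fun ω => traceD (fun x => G x.1 x.2) (Z ω, S ω)) P :=
    integrable_traceD (fun j l => by simpa only [lineDeriv_zero_prodMk] using hDRe j l)
      (fun j l => by simpa only [lineDeriv_zero_prodMk] using hDIm j l)
  have hG2 := integrable_frobSq_of_integrable_trace hSig
    (fun i j => hX.aestronglyMeasurable_comp (hG i j).aemeasurable.aestronglyMeasurable) hW1
  obtain ⟨hN1, hN2, hN3⟩ := hX.integral_nablaT hZ2 hG hG2 hRe hIm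
  obtain ⟨hL1, hL2⟩ := hX.integral_loss_normal hZ2
  have hcast : ((n - p : ℕ) : ℂ) = (n : ℂ) - (p : ℂ) := Nat.cast_sub hn.le
  simp only [loss_add hSig]
  have hL12 : Integrable (fun ω => (Sig⁻¹ * (Z ω - Ξ)ᴴ * (Z ω - Ξ)).trace.re +
      2 * (Sig⁻¹ * (Z ω - Ξ)ᴴ * G (Z ω) (S ω)).trace.re) P := hL1.add (hN1.const_mul 2)
  refine ⟨hL12.add hW1, ?_⟩
  rw [integral_add hL12 hW1, integral_add hL1 (hN1.const_mul 2), integral_const_mul, hL2, ← hN3]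
  simp only [traceD_eq_trace_matD, hcast] at hW2 hD
  have hN2c := (hN2.ofReal (𝕜 := ℂ)).const_mul 2
  have hWi : Integrable (fun ω => (matD (fun s => (G (Z ω) s)ᴴ * G (Z ω) s) (S ω)).trace +
      ((n : ℂ) - (p : ℂ)) * ((G (Z ω) (S ω))ᴴ * G (Z ω) (S ω) * (S ω)⁻¹).trace) P :=
    hD.add (hTr.const_mul ((n : ℂ) - (p : ℂ)))
  simp only [add_assoc]
  refine Eq.trans ?_ (congrArg _ (integral_add hN2c hWi).symm)
  rw [hW2, integral_const_mul]
  refine Eq.trans ?_ (congrArg (fun z => (m : ℂ) * p + (2 * z + _)) integral_ofReal.symm)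
  simp only [RCLike.ofReal_eq_complex_ofReal]
  push_cast
  ring
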